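/- **Definitions.** A *Deligne–Faltings log scheme* over $\mathbb C$ is a scheme $X$ of finite type over $\mathbb C$ together with finitely many line bundles with sections $s_i\colon\mathcal O_X\to L_i$, $i=1,\dots,r$. A *morphism* $X\to Y$ consists of a morphism $f\colon X\to Y$ of $\mathbb C$-schemes, exponents $e_{ij}\in\mathbb N$, and isomorphisms $\varphi_i\colon f^*L_{Y,i}\xrightarrow{\cong}\bigotimes_j L_{X,j}^{\otimes e_{ij}}$ sending $f^*s_{Y,i}$ to $\bigotimes_j s_{X,j}^{\otimes e_{ij}}$. The product $X\times Y$ is $X\times_{\operatorname{Spec}\mathbb C}Y$ with the line bundles with sections of both factors pulled back along the two projections $\pi_1,\pi_2$. The *real oriented blow-up* of $X(\mathbb C)$ (with its analytic topology) in $(L,s)$ is the quotient of $$\{(x,p)\;:\;x\in X(\mathbb C),\ 0\ne p\in L_x,\ \alpha p=s(x)\text{ for some real }\alpha\ge 0\}$$ by multiplication of $p$ with positive real numbers. The *Kato–Nakayama space* (analytification) $X^{\mathrm{KN}}$ is the fibre product over $X(\mathbb C)$ of the real oriented blow-ups in all the $(L_i,s_i)$; its points are a point $x\in X(\mathbb C)$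 together with a ray $[p_i]$ in each $L_{i,x}$. The analytification of a morphism $(f,e,\varphi)\colon X\to Y$ is the map $X^{\mathrm{KN}}\to Y^{\mathrm{KN}}$, $(x,([p_j])_j)\mapsto(f(x),([q_i])_i)$, where $[q_i]$ is the ray in $L_{Y,i,f(x)}$ that $\varphi_i$ sends to the ray of $\bigotimes_j p_j^{\otimes e_{ij}}$. For $m\ge 0$ let $\mathsf S_m=(\mathbb P^m_{\mathbb C},\ 0\colon\mathcal O\to\mathcal O(-1))$, where for $m=0$, $\mathbb P^0=\operatorname{Spec}\mathbb C$, the bundle $\mathcal O(-1)$ is the trivial one; in the first factor below we write $\mathsf S_0=(\operatorname{Spec}\mathbb C,\ 0\colon\mathcal O\to\mathcal O)$. Let $$f\colon\mathsf S_0\times\mathsf S_m\to\mathsf S_m$$ be the morphism of log schemes ("scalar multiplication") given on underlying schemes by the canonical isomorphism $\operatorname{Spec}\mathbb C\times\mathbb P^m\cong\mathbb P^m$ and on log structures by the canonical isomorphism $f^*\mathcal O(-1)\cong\pi_1^*\mathcal O_{\operatorname{Spec}\mathbb C}\otimes\pi_2^*\mathcal O(-1)$, inverse to $u\otimes v\mapsto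 uv$. **Proposition.** Let $m\ge 0$. 1. There are homeomorphisms $\mathsf S_0^{\mathrm{KN}}\cong S^1$, sending a ray in the fibre $\mathbb C$ of $\mathcal O$ to the complex number of modulus one on it, and $\mathsf S_m^{\mathrm{KN}}\cong S^{2m+1}\subset\mathbb C^{m+1}=\mathbb R^{2(m+1)}$, sending a ray in the fibre of $\mathcal O(-1)$ at $\ell\in\mathbb P^m(\mathbb C)$, which is the line $\ell\subset\mathbb C^{m+1}$, to the unit vector on it (so that $\mathsf S_m^{\mathrm{KN}}\to\mathbb P^m(\mathbb C)$ becomes the Hopf fibration). There is a homeomorphism $(\mathsf S_0\times\mathsf S_m)^{\mathrm{KN}}\cong\mathsf S_0^{\mathrm{KN}}\times\mathsf S_m^{\mathrm{KN}}$ whose two components are the analytifications of the two projections of log schemes. 2. Under these identifications, the analytification $f^{\mathrm{KN}}\colon S^1\times S^{2m+1}\to S^{2m+1}$ is the action of $S^1\cong\mathrm{SO}(2)$ ($z$ corresponding to multiplication by $z$ on $\mathbb C=\mathbb R^2$) on the unit sphere of $\mathbb R^{2(m+1)}=(\mathbb R^2)^{m+1}$ through the diagonal inclusion $\mathrm{SO}(2)\hookrightarrow\mathrm{SO}(2(m+1))$,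 $A\mapsto\operatorname{diag}(A,\dots,A)$. -/

import Mathlib

noncomputable section
open CategoryTheory MonoidalCategory TopologicalSpace AlgebraicGeometry

namespace DFLog

/-- The structure sheaf `𝒪_X`, as a sheaf of modules over itself. -/
def structureModule (X : Scheme.{0}) : X.Modules := SheafOfModules.unit X.ringCatSheaf

/-- A line bundle (invertible sheaf): a sheaf of `𝒪_X`-modules that is locally isomorphic to `𝒪_X`. -/
def IsInvertible {X : Scheme.{0}} (M : X.Modules) : Prop :=
  ∀ x : X, ∃ U : X.Opens, x ∈ U ∧ Nonempty (M.restrict U.ι ≅ structureModule U)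

lemma structureModule_isInvertible (X : Scheme.{0}) : IsInvertible (structureModule X) :=
  fun _ => ⟨⊤, trivial, ⟨Scheme.Modules.restrictUnitIso _⟩⟩

lemma opensMap_final {X Y : Scheme.{0}} (f : X ⟶ Y) : (Opens.map f.base).Final where
  out U := by
    have : Limits.IsTerminal (StructuredArrow.mk (Y := (⊤ : Y.Opens)) (T := Opens.map f.base)
        (homOfLE le_top : U ⟶ (Opens.map f.base).obj ⊤)) :=
      Limits.IsTerminal.ofUniqueHom (fun W => StructuredArrow.homMk (homOfLE le_top) rfl)
        (fun _ _ => by ext; rfl)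
    exact isConnected_of_isTerminal _ this

/-- The canonical isomorphism `f^* 𝒪_Y ≅ 𝒪_X`. -/
def pullbackUnitIso {X Y : Scheme.{0}} (f : X ⟶ Y) :
    (Scheme.Modules.pullback f).obj (structureModule Y) ≅ structureModule X :=
  have : (Opens.map f.base).Final := opensMap_final f
  have : (SheafOfModules.pushforward.{0} f.toRingCatSheafHom).IsRightAdjoint :=
    (Scheme.Modules.pullbackPushforwardAdjunction f).isRightAdjoint
  @asIso _ _ _ _ (SheafOfModules.pullbackObjUnitToUnit f.toRingCatSheafHom)
    (SheafOfModules.instIsIsoPullbackObjUnitToUnitOfFinal _)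

lemma IsInvertible.pullback {X Y : Scheme.{0}} (f : X ⟶ Y) {M : Y.Modules}
    (hM : IsInvertible M) : IsInvertible ((Scheme.Modules.pullback f).obj M) := by
  intro x
  obtain ⟨U, hU, ⟨i⟩⟩ := hM (f x)
  refine ⟨f ⁻¹ᵁ U, hU, ⟨?_⟩⟩
  refine (Scheme.Modules.restrictFunctorIsoPullback _).app _ ≪≫
    (Scheme.Modules.pullbackComp (f ⁻¹ᵁ U).ι f).app M ≪≫
    (Scheme.Modules.pullbackCongr (morphismRestrict_ι f U).symm).app M ≪≫
    (Scheme.Modules.pullbackComp (f ∣_ U) U.ι).symm.app M ≪≫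
    (Scheme.Modules.pullback (f ∣_ U)).mapIso
      ((Scheme.Modules.restrictFunctorIsoPullback U.ι).symm.app M ≪≫ i) ≪≫ pullbackUnitIso _

open Scheme.Modules in
/-- The pulled back section `f^* m` of `f^* M` over `f⁻¹ V`, for a section `m` of `M` over `V`. -/
def pullbackSection {X Y : Scheme.{0}} (f : X ⟶ Y) (M : Y.Modules) (V : Y.Opens) (m : Γ(M, V)) :
    Γ((Scheme.Modules.pullback f).obj M, f ⁻¹ᵁ V) :=
  ((pullbackPushforwardAdjunction f).unit.app M).app V m

/-- Presheaves of `𝒪_X`-modules, with their monoidal structure. -/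
abbrev PreModules (X : Scheme.{0}) :=
  PresheafOfModules.{0} (X.presheaf ⋙ forget₂ CommRingCat RingCat)

/-- The presheaf of modules underlying a sheaf of modules. -/
def toPre {X : Scheme.{0}} (M : X.Modules) : PreModules X := M.val

/-- The presheaf tensor power `M ⊗ (M ⊗ ⋯ (M ⊗ 𝒪_X))` with `k` factors `M`. -/
def prePow {X : Scheme.{0}} (M : X.Modules) : ℕ → PreModules X
  | 0 => 𝟙_ _
  | k + 1 => tensorObj (toPre M) (prePow M k)

/-- The presheaf tensor product `⨂_j L_j^{⊗ e_j}`. -/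
def preTensor {X : Scheme.{0}} : {n : ℕ} → (Fin n → X.Modules) → (Fin n → ℕ) →
    PreModules X
  | 0, _, _ => 𝟙_ _
  | _ + 1, L, e => tensorObj (prePow (L 0) (e 0)) (preTensor (Fin.tail L) (Fin.tail e))

/-- Sheafification of presheaves of `𝒪_X`-modules. -/
def sheafify (X : Scheme.{0}) : X.PresheafOfModules ⥤ X.Modules :=
  PresheafOfModules.sheafification (𝟙 X.ringCatSheaf.obj)

/-- The sheaf of modules `⨂_j L_j^{⊗ e_j}`: the sheafification of the presheaf tensor product. -/
def tensorPow {X : Scheme.{0}} {n : ℕ} (L : Fin n → X.Modules) (e : Fin n → ℕ) : X.Modules :=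
  (sheafify X).obj (preTensor L e)

/-- The section `m ^ {⊗ k}` of the presheaf tensor power. -/
def prePowSection {X : Scheme.{0}} (M : X.Modules) (U : X.Opens) (m : Γ(M, U)) :
    (k : ℕ) → (prePow M k).obj (.op U)
  | 0 => (1 : Γ(X, U))
  | k + 1 => TensorProduct.tmul Γ(X, U) (m : M.val.obj (.op U)) (prePowSection M U m k)

/-- The section `⨂_j l_j^{⊗ e_j}` of the presheaf tensor product. -/
def preTensorSection {X : Scheme.{0}} (U : X.Opens) : {n : ℕ} → (L : Fin n → X.Modules) → (e : Fin n → ℕ) →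
    (∀ j, Γ(L j, U)) → (preTensor L e).obj (.op U)
  | 0, _, _, _ => (1 : Γ(X, U))
  | _ + 1, L, e, l => TensorProduct.tmul Γ(X, U) (prePowSection (L 0) U (l 0) (e 0))
      (preTensorSection U (Fin.tail L) (Fin.tail e) (Fin.tail l))

/-- The section `⨂_j l_j^{⊗ e_j}` of `⨂_j L_j^{⊗ e_j}` over `U`, for sections `l_j` of `L_j` over `U`. -/
def tensorSection {X : Scheme.{0}} {n : ℕ} (L : Fin n → X.Modules) (e : Fin n → ℕ)
   (U : X.Opens) (l : ∀ j, Γ(L j, U)) : Γ(tensorPow L e, U) :=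
  (((PresheafOfModules.sheafificationAdjunction (𝟙 X.ringCatSheaf.obj)).unit.app (preTensor L e)).app (.op U)
    : _ → Γ(tensorPow L e, U)) (preTensorSection U L e l)

/-- The scheme `Spec ℂ`. -/
abbrev SpecC : Scheme.{0} := Spec (CommRingCat.of ℂ)

open Scheme.Modules in
/-- A section `e` of `M` over `U` is a frame (a nowhere vanishing section of a line bundle): over every
open `V ⊆ U`, every section of `M` is `r • e` for a unique function `r`. -/
def IsFrame {X : Scheme.{0}} (M : X.Modules) (U : X.Opens) (e : Γ(M, U)) : Prop :=
  ∀ (V : X.Opens) (h : V ≤ U),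
    Function.Bijective fun r : Γ(X, V) => r • M.presheaf.map (homOfLE h).op e

/-- A line bundle together with a global section. -/
structure LineWithSection (X : Scheme.{0}) where
  sheaf : X.Modules
  invertible : IsInvertible sheaf
  sec : Γ(sheaf, ⊤)

/-- The pull-back of a line bundle with section along a morphism of schemes. -/
def LineWithSection.pullback {X Y : Scheme.{0}} (f : X ⟶ Y) (L : LineWithSection Y) :
    LineWithSection X where
  sheaf := (Scheme.Modules.pullback f).obj L.sheaf
  invertible := L.invertible.pullback f
  sec := pullbackSection f L.sheaf ⊤ L.sec

/-- A Deligne--Faltings log scheme over `ℂ`: a scheme of finite type over `Spec ℂ` with a finite list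
of line bundles with sections `s_i : 𝒪_X ⟶ L_i`. -/
structure LogScheme where
  X : Scheme.{0}
  str : X ⟶ SpecC
  locallyOfFiniteType : LocallyOfFiniteType str
  quasiCompact : QuasiCompact str
  n : ℕ
  L : Fin n → LineWithSection X

/-- A morphism of Deligne--Faltings log schemes `X ⟶ Y`: a morphism `f` of the underlying schemes over
`Spec ℂ`, exponents `e i j ∈ ℕ`, and isomorphisms `f^* L_{Y,i} ≅ ⨂_j L_{X,j}^{⊗ e i j}` that send the
section `f^* s_{Y,i}` to `⨂_j s_{X,j}^{⊗ e i j}`. -/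
structure LogScheme.Hom (X Y : LogScheme) where
  f : X.X ⟶ Y.X
  comm : f ≫ Y.str = X.str
  e : Fin Y.n → Fin X.n → ℕ
  iso : ∀ i, ((Y.L i).pullback f).sheaf ≅ tensorPow (fun j => (X.L j).sheaf) (e i)
  iso_section : ∀ i, (iso i).hom.app ⊤ ((Y.L i).pullback f).sec =
    tensorSection (fun j => (X.L j).sheaf) (e i) ⊤ (fun j => (X.L j).sec)

/-- The product of two log schemes: the underlying scheme is the fibre product over `Spec ℂ`, and the
line bundles with sections are those of both factors, pulled back along the two projections. -/
def LogScheme.prod (X Y : LogScheme) : LogScheme where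
  X := Limits.pullback X.str Y.str
  str := Limits.pullback.fst X.str Y.str ≫ X.str
  locallyOfFiniteType := by
    have := X.locallyOfFiniteType
    have := Y.locallyOfFiniteType
    infer_instance
  quasiCompact := by
    have := X.quasiCompact
    have := Y.quasiCompact
    infer_instance
  n := X.n + Y.n
  L := Fin.append
    (fun i => (X.L i).pullback (Limits.pullback.fst X.str Y.str))
    (fun j => (Y.L j).pullback (Limits.pullback.snd X.str Y.str))

/-- A complex point of `X`: a section of the structure morphism `X ⟶ Spec ℂ`. -/
@[ext] structure CPoint (X : LogScheme) where
  hom : SpecC ⟶ X.X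
  hom_str : hom ≫ X.str = 𝟙 SpecC

/-- The value `r(x) ∈ ℂ` at a point `x` of `U` of a regular function `r` on `U`. The condition
`⊤ ≤ x ⁻¹ᵁ U` says that the point `x` lies in `U`. -/
def evalAt {X : Scheme.{0}} (x : SpecC ⟶ X) (U : X.Opens) (hx : ⊤ ≤ x ⁻¹ᵁ U) : Γ(X, U) →+* ℂ :=
  (x.appLE U ⊤ hx ≫ (Scheme.ΓSpecIso (CommRingCat.of ℂ)).hom).hom

/-- The analytic topology on the complex points: the coarsest one such that, for every Zariski open
`U`, the set `U(ℂ)` is open and every regular function on `U` is continuous on `U(ℂ)`. (The set `S` below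
is the preimage of `W` in `U(ℂ)`; taking `W = ℂ` gives `U(ℂ)` itself.) -/
instance (X : LogScheme) : TopologicalSpace (CPoint X) :=
  TopologicalSpace.generateFrom
    {S | ∃ (U : X.X.Opens) (r : Γ(X.X, U)) (W : Set ℂ), IsOpen W ∧
      S = {x : CPoint X | ∃ hx : ⊤ ≤ x.hom ⁻¹ᵁ U, evalAt x.hom U hx r ∈ W}}

/-- A frame of `M` on an open neighbourhood of the point `x`. -/
structure FrameAt {X : Scheme.{0}} (M : X.Modules) (x : SpecC ⟶ X) where
  U : X.Opens
  mem : ⊤ ≤ x ⁻¹ᵁ U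
  e : Γ(M, U)
  isFrame : IsFrame M U e

/-- The fibre of a line bundle `M` at a complex point `x`, a complex vector space of dimension one.
A vector is given by its coordinate `c a` with respect to each local frame `a` of `M` near `x`,
subject to the usual rule: if `b = r • a` near `x`, then `c a = r(x) * c b`. Informally, the vector
is `c a • a(x)` for every `a`. -/
def Fibre {X : Scheme.{0}} (M : X.Modules) (x : SpecC ⟶ X) : Submodule ℂ (FrameAt M x → ℂ) where
  carrier := {c | ∀ (a b : FrameAt M x) (W : X.Opens) (ha : W ≤ a.U) (hb : W ≤ b.U)
    (hx : ⊤ ≤ x ⁻¹ᵁ W) (r : Γ(X, W)),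
    M.presheaf.map (homOfLE hb).op b.e = r • M.presheaf.map (homOfLE ha).op a.e →
      c a = evalAt x W hx r * c b}
  add_mem' := by
    intro c d hc hd a b W ha hb hx r h
    simp only [Pi.add_apply, hc a b W ha hb hx r h, hd a b W ha hb hx r h, mul_add]
  zero_mem' := by simp
  smul_mem' := by
    intro t c hc a b W ha hb hx r h
    simp only [Pi.smul_apply, hc a b W ha hb hx r h, smul_eq_mul, mul_left_comm]

lemma evalAt_map {X : Scheme.{0}} (x : SpecC ⟶ X) {V U : X.Opens} (h : V ≤ U)
    (hV : ⊤ ≤ x ⁻¹ᵁ V) (hU : ⊤ ≤ x ⁻¹ᵁ U) (r : Γ(X, U)) :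
    evalAt x V hV (X.presheaf.map (homOfLE h).op r) = evalAt x U hU r := by
  simp only [evalAt, ← Scheme.Hom.map_appLE x hV (homOfLE h).op]
  rfl

/-- The coefficient `r` in `s = r • e`, where `e` is the given frame. -/
def FrameAt.coeff {X : Scheme.{0}} {M : X.Modules} {x : SpecC ⟶ X} (a : FrameAt M x)
    (s : Γ(M, ⊤)) : Γ(X, a.U) :=
  ((a.isFrame a.U le_rfl).2 (M.presheaf.map (homOfLE le_top).op s)).choose

open Scheme.Modules in
lemma FrameAt.coeff_spec {X : Scheme.{0}} {M : X.Modules} {x : SpecC ⟶ X} (a : FrameAt M x)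
    (s : Γ(M, ⊤)) : a.coeff s • a.e = M.presheaf.map (homOfLE le_top).op s := by
  have := ((a.isFrame a.U le_rfl).2 (M.presheaf.map (homOfLE le_top).op s)).choose_spec
  simpa [FrameAt.coeff] using this

open Scheme.Modules in
/-- The value `s(x)` of a global section in the fibre at `x`. -/
def sectionValue {X : Scheme.{0}} {M : X.Modules} (s : Γ(M, ⊤)) (x : SpecC ⟶ X) : Fibre M x :=
  ⟨fun a => evalAt x a.U a.mem (a.coeff s), by
    intro a b W ha hb hx r h
    change evalAt x a.U a.mem (a.coeff s) = evalAt x W hx r * evalAt x b.U b.mem (b.coeff s)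
    rw [← evalAt_map x ha hx, ← evalAt_map x hb hx, ← map_mul]
    congr 1
    apply (a.isFrame W ha).1
    have h1 := congrArg (M.presheaf.map (homOfLE ha).op) (a.coeff_spec s)
    have h2 := congrArg (M.presheaf.map (homOfLE hb).op) (b.coeff_spec s)
    rw [map_smul] at h1 h2
    simp only [mul_comm r, mul_smul, ← h]
    rw [h1, h2]
    simp only [← ConcreteCategory.comp_apply, ← Functor.map_comp]
    rfl⟩

section Twist
variable {A σ : Type} [CommRing A] [SetLike σ A] [AddSubgroupClass σ A] (𝒜 : ℕ → σ) [GradedRing 𝒜]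

/-- The localization `A_x` of the ring `A` at the homogeneous prime `x` (in all degrees). -/
abbrev LocAt (x : ProjectiveSpectrum 𝒜) : Type :=
  Localization x.asHomogeneousIdeal.toIdeal.primeCompl

variable {𝒜} in
/-- The family `t` of elements of the localizations `A_x`, for `x ∈ U`, is given by a single fraction
`a / b` with `a`, `b` homogeneous, `deg a - deg b = d` and `b` not vanishing on `U`. -/
def IsTwistFraction (d : ℤ) {U : Opens (ProjectiveSpectrum.top 𝒜)} (t : ∀ x : U, LocAt 𝒜 x.1) :
    Prop :=
  ∃ (i j : ℕ) (_ : (i : ℤ) - j = d) (a : 𝒜 i) (b : 𝒜 j)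
    (hb : ∀ x : U, (b : A) ∉ x.1.asHomogeneousIdeal),
    ∀ x : U, t x = Localization.mk (a : A) ⟨b, hb x⟩

/-- Being given by a single fraction of degree `d`, as a condition stable under restriction. -/
def twistPrelocal (d : ℤ) : TopCat.PrelocalPredicate fun x : ProjectiveSpectrum.top 𝒜 => LocAt 𝒜 x where
  pred t := IsTwistFraction d t
  res := by
    rintro U V k t ⟨i, j, hij, a, b, hb, h⟩
    exact ⟨i, j, hij, a, b, fun x => hb ⟨x.1, k.le x.2⟩, fun x => h ⟨x.1, k.le x.2⟩⟩

/-- Being given locally by fractions of degree `d`. -/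
def twistLocal (d : ℤ) : TopCat.LocalPredicate fun x : ProjectiveSpectrum.top 𝒜 => LocAt 𝒜 x :=
  (twistPrelocal 𝒜 d).sheafify

lemma twist_add (d : ℤ) {U : Opens (ProjectiveSpectrum.top 𝒜)} {t u : ∀ x : U, LocAt 𝒜 x.1}
    (ht : (twistLocal 𝒜 d).pred t) (hu : (twistLocal 𝒜 d).pred u) :
    (twistLocal 𝒜 d).pred (t + u) := by
  intro x
  obtain ⟨V, hV, kV, i, j, hij, a, b, hb, h⟩ := ht x
  obtain ⟨W, hW, kW, i', j', hij', a', b', hb', h'⟩ := hu x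
  have e1 : i' + j = i + j' := by omega
  refine ⟨V ⊓ W, ⟨hV, hW⟩, Opens.infLELeft _ _ ≫ kV, i + j', j + j', by push_cast; omega,
    ⟨b' * a + b * a', ?_⟩, ⟨b * b', SetLike.mul_mem_graded b.2 b'.2⟩,
    fun y => Submonoid.mul_mem (Ideal.primeCompl (hp := y.1.isPrime) _)
      (hb ⟨y.1, y.2.1⟩) (hb' ⟨y.1, y.2.2⟩),
    fun y => ?_⟩
  · refine add_mem ?_ ?_
    · have := SetLike.mul_mem_graded a.2 b'.2
      rwa [mul_comm] at this
    · have := SetLike.mul_mem_graded a'.2 b.2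
      rwa [mul_comm, e1] at this
  · have h1 := h ⟨y.1, y.2.1⟩
    have h2 := h' ⟨y.1, y.2.2⟩
    change t ⟨y.1, _⟩ = _ at h1
    change u ⟨y.1, _⟩ = _ at h2
    change t ⟨y.1, _⟩ + u ⟨y.1, _⟩ = _
    rw [h1, h2, Localization.add_mk]
    rw [add_comm]
    rfl

lemma exists_homogeneous_notMem (x : ProjectiveSpectrum 𝒜) :
    ∃ m : ℕ, 0 < m ∧ ∃ b ∈ 𝒜 m, b ∉ x.asHomogeneousIdeal := by
  by_contra! h
  refine x.not_irrelevant_le ((HomogeneousIdeal.irrelevant_le 𝒜).mpr fun m hm b hb => ?_)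
  exact h m hm b hb

lemma twist_zero (d : ℤ) (U : Opens (ProjectiveSpectrum.top 𝒜)) :
    (twistLocal 𝒜 d).pred (0 : ∀ x : U, LocAt 𝒜 x.1) := by
  intro x
  obtain ⟨m, hm, b, hb, hx⟩ := exists_homogeneous_notMem 𝒜 x.1
  have hk : (0 : ℤ) ≤ ((m * d.natAbs : ℕ) : ℤ) + d := by
    have h1 : (1 : ℤ) ≤ m := by exact_mod_cast hm
    push_cast
    nlinarith [abs_nonneg d, neg_abs_le d]
  refine ⟨U ⊓ ProjectiveSpectrum.basicOpen 𝒜 b, ⟨x.2, hx⟩, Opens.infLELeft _ _,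
    (((m * d.natAbs : ℕ) : ℤ) + d).toNat, m * d.natAbs, by omega, ⟨0, zero_mem _⟩,
    ⟨b ^ d.natAbs, by simpa [mul_comm] using SetLike.pow_mem_graded d.natAbs hb⟩,
    fun y => Submonoid.pow_mem (Ideal.primeCompl (hp := y.1.isPrime) _) y.2.2 _, fun y => ?_⟩
  exact (Localization.mk_zero _).symm

lemma twist_smul (d : ℤ) {U : Opens (ProjectiveSpectrum.top 𝒜)} {t : ∀ x : U, LocAt 𝒜 x.1}
    (f : Γ(Proj 𝒜, U)) (ht : (twistLocal 𝒜 d).pred t) :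
    (twistLocal 𝒜 d).pred (fun x : U => (f.1 x).val * t x) := by
  intro x
  obtain ⟨V, hV, kV, i, j, hij, a, b, hb, h⟩ := ht x
  obtain ⟨W, hW, kW, i', ⟨a', ha'⟩, ⟨b', hb''⟩, hb', h'⟩ := f.2 x
  refine ⟨V ⊓ W, ⟨hV, hW⟩, Opens.infLELeft _ _ ≫ kV, i' + i, i' + j, by push_cast; omega,
    ⟨a' * a, SetLike.mul_mem_graded ha' a.2⟩, ⟨b' * b, SetLike.mul_mem_graded hb'' b.2⟩,
    fun y => Submonoid.mul_mem (Ideal.primeCompl (hp := y.1.isPrime) _)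
      (hb' ⟨y.1, y.2.2⟩) (hb ⟨y.1, y.2.1⟩), fun y => ?_⟩
  have h1 := h ⟨y.1, y.2.1⟩
  have h2 := h' ⟨y.1, y.2.2⟩
  change t ⟨y.1, _⟩ = _ at h1
  change f.1 ⟨y.1, _⟩ = _ at h2
  change (f.1 ⟨y.1, _⟩).val * t ⟨y.1, _⟩ = _
  rw [h1, h2, HomogeneousLocalization.val_mk, Localization.mk_mul]
  rfl

/-- The sections of `𝒪(d)` over `U`: families of elements of `A_x`, for `x ∈ U`, that are locally
fractions of degree `d`. -/
def twistSections (d : ℤ) (U : Opens (ProjectiveSpectrum.top 𝒜)) :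
    AddSubgroup (∀ x : U, LocAt 𝒜 x.1) where
  carrier := {t | (twistLocal 𝒜 d).pred t}
  add_mem' := twist_add 𝒜 d
  zero_mem' := twist_zero 𝒜 d U
  neg_mem' := by
    intro t ht
    have h : -t = fun x : U => ((-1 : Γ(Proj 𝒜, U)).1 x).val * t x := by
      funext x
      change - t x = (HomogeneousLocalization.val (-1)) * t x
      rw [HomogeneousLocalization.val_neg, HomogeneousLocalization.val_one, neg_one_mul]
    change (twistLocal 𝒜 d).pred (-t)
    rw [h]
    exact twist_smul 𝒜 d (-1 : Γ(Proj 𝒜, U)) ht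

/-- The sections of `𝒪(d)` are a module over the regular functions (fractions of degree `0`). -/
instance twistModule (d : ℤ) (U : Opens (ProjectiveSpectrum.top 𝒜)) :
    Module Γ(Proj 𝒜, U) (twistSections 𝒜 d U) where
  smul f t := ⟨fun x => (f.1 x).val * t.1 x, twist_smul 𝒜 d f t.2⟩
  one_smul t := by
    ext x
    change HomogeneousLocalization.val 1 * t.1 x = _
    rw [HomogeneousLocalization.val_one, one_mul]
  mul_smul f g t := by
    ext x
    change HomogeneousLocalization.val (f.1 x * g.1 x) * t.1 x = _
    rw [HomogeneousLocalization.val_mul, mul_assoc]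
    rfl
  smul_zero f := by
    ext x
    exact mul_zero _
  smul_add f t u := by
    ext x
    exact mul_add _ _ _
  add_smul f g t := by
    ext x
    change HomogeneousLocalization.val (f.1 x + g.1 x) * t.1 x = _
    rw [HomogeneousLocalization.val_add, add_mul]
    rfl
  zero_smul t := by
    ext x
    change HomogeneousLocalization.val 0 * t.1 x = _
    rw [HomogeneousLocalization.val_zero, zero_mul]
    rfl

/-- The presheaf of abelian groups `𝒪(d)` on `Proj 𝒜`. -/
def twistPresheaf (d : ℤ) : TopCat.Presheaf AddCommGrpCat.{0} (Proj 𝒜) where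
  obj U := AddCommGrpCat.of (twistSections 𝒜 d U.unop)
  map {U V} k := AddCommGrpCat.ofHom
    { toFun := fun t => ⟨fun x => t.1 ⟨x.1, k.unop.le x.2⟩, (twistLocal 𝒜 d).res k.unop _ t.2⟩
      map_zero' := rfl
      map_add' := fun _ _ => rfl }

lemma twistPresheaf_isSheaf (d : ℤ) : (twistPresheaf 𝒜 d).IsSheaf := by
  refine (TopCat.Presheaf.isSheaf_iff_isSheaf_comp (forget AddCommGrpCat.{0}) _).mpr ?_
  exact TopCat.Presheaf.isSheaf_of_iso (NatIso.ofComponents (fun _ => Iso.refl _) (fun _ => rfl))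
    (TopCat.subsheafToTypes (twistLocal 𝒜 d)).property

instance (d : ℤ) (U : (Opens (Proj 𝒜))ᵒᵖ) :
    Module ((Proj 𝒜).ringCatSheaf.obj.obj U) ((twistPresheaf 𝒜 d).obj U) :=
  twistModule 𝒜 d U.unop

/-- The twisting sheaf `𝒪(d)` on `Proj 𝒜`, as a sheaf of modules. -/
def serreTwist (d : ℤ) : (Proj 𝒜).Modules where
  val := PresheafOfModules.ofPresheaf (R := (Proj 𝒜).ringCatSheaf.obj) (twistPresheaf 𝒜 d)
    (fun _ _ k r m => by
      apply Subtype.ext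
      funext x
      rfl)
  isSheaf := twistPresheaf_isSheaf 𝒜 d

end Twist

open Scheme.Modules in
/-- The morphism `𝒪_U ⟶ M|_U` that sends `1` to a section `e` of `M` over `U`. -/
def homOfSection {X : Scheme.{0}} {M : X.Modules} {U : X.Opens} (e : Γ(M, U)) :
    structureModule U ⟶ M.restrict U.ι :=
  (SheafOfModules.unitHomEquiv (M.restrict U.ι)).symm
    ⟨fun W => M.presheaf.map (homOfLE (U.ι_image_le W.unop)).op e, fun k => by
      change M.presheaf.map _ (M.presheaf.map _ e) = M.presheaf.map _ e
      rw [← ConcreteCategory.comp_apply, ← Functor.map_comp]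
      rfl⟩

lemma IsFrame.nonempty_iso {X : Scheme.{0}} {M : X.Modules} {U : X.Opens} {e : Γ(M, U)}
    (he : IsFrame M U e) : Nonempty (M.restrict U.ι ≅ structureModule U) := by
  have : IsIso (homOfSection e) := by
    rw [Scheme.Modules.Hom.isIso_iff_isIso_app]
    intro W
    rw [ConcreteCategory.isIso_iff_bijective]
    have h := he (U.ι ''ᵁ W) (U.ι_image_le W)
    have h2 : Function.Bijective (U.ι.appIso W).inv :=
      ConcreteCategory.bijective_of_isIso _
    exact h.comp h2
  exact ⟨(asIso (homOfSection e)).symm⟩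

lemma isInvertible_of_frames {X : Scheme.{0}} {M : X.Modules}
    (h : ∀ x : X, ∃ (U : X.Opens) (e : Γ(M, U)), x ∈ U ∧ IsFrame M U e) : IsInvertible M := by
  intro x
  obtain ⟨U, e, hx, he⟩ := h x
  exact ⟨U, hx, he.nonempty_iso⟩

lemma isFrame_one (X : Scheme.{0}) :
    IsFrame (structureModule X) ⊤ (1 : Γ(X, ⊤)) := by
  intro V h
  have : (fun r : Γ(X, V) => r • (structureModule X).presheaf.map (homOfLE h).op (1 : Γ(X, ⊤))) =
      fun r : Γ(X, V) => r := by
    funext r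
    change r * X.presheaf.map (homOfLE h).op (1 : Γ(X, ⊤)) = r
    rw [map_one, mul_one]
  rw [this]
  exact Function.bijective_id

section
variable {A σ : Type} [CommRing A] [SetLike σ A] [AddSubgroupClass σ A] (𝒜 : ℕ → σ) [GradedRing 𝒜]

variable {𝒜} in
/-- The element `1 / f` of the localization of `A` at `x`. -/
def invAt (f : A) (x : ProjectiveSpectrum 𝒜) (h : f ∉ x.asHomogeneousIdeal) : LocAt 𝒜 x :=
  Localization.mk 1 ⟨f, h⟩

variable {𝒜} in
lemma mul_invAt (f : A) (x : ProjectiveSpectrum 𝒜) (h : f ∉ x.asHomogeneousIdeal) :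
    (Localization.mk f 1 : LocAt 𝒜 x) * invAt f x h = 1 := by
  rw [invAt, Localization.mk_mul, mul_one, one_mul]
  exact Localization.mk_self (⟨f, h⟩ : x.asHomogeneousIdeal.toIdeal.primeCompl)

variable {𝒜} in
lemma eq_of_mul_invAt {f : A} {x : ProjectiveSpectrum 𝒜} {h : f ∉ x.asHomogeneousIdeal}
    {a b : LocAt 𝒜 x} (hab : a * invAt f x h = b * invAt f x h) : a = b := by
  have h2 := congrArg (· * (Localization.mk f 1 : LocAt 𝒜 x)) hab
  simpa only [mul_assoc, mul_comm (invAt f x h), mul_invAt, mul_one] using h2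

/-- The section `1 / f` of `𝒪(-1)` over `D₊(f)`, for `f` homogeneous of degree one. -/
def invSection (f : A) (hf : f ∈ 𝒜 1) : Γ(serreTwist 𝒜 (-1), Proj.basicOpen 𝒜 f) :=
  (⟨fun x => invAt f x.1 x.2, fun x => ⟨Proj.basicOpen 𝒜 f, x.2, 𝟙 _, 0, 1, by norm_num,
    ⟨1, SetLike.GradedOne.one_mem⟩, ⟨f, hf⟩, fun y => y.2, fun _ => rfl⟩⟩ :
    twistSections 𝒜 (-1) (Proj.basicOpen 𝒜 f))

lemma invSection_isFrame (f : A) (hf : f ∈ 𝒜 1) :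
    IsFrame (serreTwist 𝒜 (-1)) (Proj.basicOpen 𝒜 f) (invSection 𝒜 f hf) := by
  intro V h
  constructor
  · intro r r' hr
    apply Subtype.ext
    funext x
    have h1 : (r.1 x).val * invAt f x.1 (h x.2) = (r'.1 x).val * invAt f x.1 (h x.2) :=
      congrFun (congrArg Subtype.val hr) x
    apply HomogeneousLocalization.val_injective
    exact eq_of_mul_invAt h1
  · intro t
    let t' : twistSections 𝒜 (-1) V := t
    have key : ∀ (x : ProjectiveSpectrum 𝒜) (hx : x ∈ V),
        ∃ r : HomogeneousLocalization.AtPrime 𝒜 x.asHomogeneousIdeal.toIdeal,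
        r.val = Localization.mk f 1 * t'.1 ⟨x, hx⟩ := by
      intro x hx
      obtain ⟨W, hW, k, i, j, hij, ⟨a, ha⟩, ⟨b, hb⟩, hbx, hh⟩ := t'.2 ⟨x, hx⟩
      have hj : j = 1 + i := by omega
      subst hj
      refine ⟨HomogeneousLocalization.mk ⟨1 + i, ⟨f * a, SetLike.mul_mem_graded hf ha⟩, ⟨b, hb⟩,
        (hbx ⟨x, hW⟩ : b ∈ x.asHomogeneousIdeal.toIdeal.primeCompl)⟩, ?_⟩
      have h1 := hh ⟨x, hW⟩
      change t'.1 ⟨x, _⟩ = _ at h1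
      rw [h1, HomogeneousLocalization.val_mk, Localization.mk_mul, one_mul]
    choose r hr using key
    refine ⟨(⟨fun x => r x.1 x.2, ?_⟩ : (ProjectiveSpectrum.Proj.structureSheaf 𝒜).1.obj (.op V)), ?_⟩
    · intro x
      obtain ⟨W, hW, k, i, j, hij, ⟨a, ha⟩, ⟨b, hb⟩, hbx, hh⟩ := t'.2 x
      have hj : j = 1 + i := by omega
      subst hj
      refine ⟨W, hW, k, 1 + i, ⟨f * a, SetLike.mul_mem_graded hf ha⟩, ⟨b, hb⟩, hbx, fun y => ?_⟩
      apply HomogeneousLocalization.val_injective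
      have h1 := hh y
      change t'.1 ⟨y.1, _⟩ = _ at h1
      refine (hr y.1 (k.le y.2)).trans ?_
      rw [HomogeneousLocalization.val_mk]
      refine (congrArg (Localization.mk f 1 * ·) h1).trans ?_
      exact (Localization.mk_mul _ _ _ _).trans (by rw [one_mul])
    · apply Subtype.ext
      funext x
      refine (congrArg (· * invAt f x.1 (h x.2)) (hr x.1 x.2)).trans ?_
      exact (mul_right_comm _ _ _).trans
        ((congrArg (· * t'.1 x) (mul_invAt f x.1 (h x.2))).trans (one_mul _))
end

/-- The polynomial ring `ℂ[x_0, …, x_m]`, graded by the degree. -/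
abbrev grading (m : ℕ) : ℕ → Submodule ℂ (MvPolynomial (Fin (m + 1)) ℂ) :=
  MvPolynomial.homogeneousSubmodule (Fin (m + 1)) ℂ

instance (m : ℕ) : GradedAlgebra (grading m) := MvPolynomial.gradedAlgebra

/-- Projective space `ℙ^m` over `ℂ`. -/
abbrev ProjSpace (m : ℕ) : Scheme.{0} := Proj (grading m)

/-- The structure morphism `ℙ^m ⟶ Spec ℂ`. -/
def ProjSpace.str (m : ℕ) : ProjSpace m ⟶ SpecC :=
  Proj.toSpecZero (grading m) ≫ Spec.map (CommRingCat.ofHom (algebraMap ℂ (grading m 0)))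

lemma X_mem {m : ℕ} (i : Fin (m + 1)) : MvPolynomial.X i ∈ grading m 1 :=
  MvPolynomial.isHomogeneous_X ℂ i

instance (m : ℕ) : Algebra.FiniteType (grading m 0) (MvPolynomial (Fin (m + 1)) ℂ) :=
  have : IsScalarTower ℂ (grading m 0) (MvPolynomial (Fin (m + 1)) ℂ) :=
    ⟨fun r a p => smul_mul_assoc r (a : MvPolynomial (Fin (m + 1)) ℂ) p⟩
  Algebra.FiniteType.of_restrictScalars_finiteType ℂ (grading m 0) _

lemma algebraMap_zero_surjective (m : ℕ) : Function.Surjective (algebraMap ℂ (grading m 0)) := by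
  rintro ⟨p, hp⟩
  refine ⟨MvPolynomial.coeff 0 p, Subtype.ext ?_⟩
  exact (MvPolynomial.totalDegree_eq_zero_iff_eq_C.mp
    (Nat.le_zero.mp (MvPolynomial.IsHomogeneous.totalDegree_le hp))).symm

instance (m : ℕ) : LocallyOfFiniteType (ProjSpace.str m) := by
  have : LocallyOfFiniteType (Spec.map (CommRingCat.ofHom (algebraMap ℂ (grading m 0)))) := by
    rw [HasRingHomProperty.Spec_iff (P := @LocallyOfFiniteType)]
    exact RingHom.FiniteType.of_surjective _ (algebraMap_zero_surjective m)
  unfold ProjSpace.str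
  infer_instance

instance (m : ℕ) : QuasiCompact (ProjSpace.str m) := by
  unfold ProjSpace.str
  infer_instance

lemma tautological_isInvertible (m : ℕ) : IsInvertible (serreTwist (grading m) (-1)) := by
  refine isInvertible_of_frames fun x => ?_
  have hc := Proj.iSup_basicOpen_eq_top' (grading m) (fun i : Fin (m + 1) => MvPolynomial.X i)
    (fun i => ⟨1, X_mem i⟩) (by
      refine eq_top_iff.mpr fun p _ => ?_
      induction p using MvPolynomial.induction_on with
      | C a => exact Subalgebra.algebraMap_mem _ (algebraMap ℂ (grading m 0) a)
      | add p q hp hq => exact add_mem (hp trivial) (hq trivial)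
      | mul_X p i hp => exact mul_mem (hp trivial) (Algebra.subset_adjoin ⟨i, rfl⟩))
  have hx : x ∈ (⨆ i, Proj.basicOpen (grading m) (MvPolynomial.X i)) := by rw [hc]; trivial
  obtain ⟨i, hi⟩ := Opens.mem_iSup.mp hx
  exact ⟨_, _, hi, invSection_isFrame (grading m) (MvPolynomial.X i) (X_mem i)⟩

/-- The sheafification of a sheaf is the sheaf itself. -/
def sheafifyIso {X : Scheme.{0}} (M : X.Modules) : (sheafify X).obj (toPre M) ≅ M :=
  (asIso (PresheafOfModules.sheafificationAdjunction (𝟙 X.ringCatSheaf.obj)).counit).app M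

/-- An isomorphism of sheaves of modules, as an isomorphism of presheaves of modules. -/
def toPreIso {X : Scheme.{0}} {M N : X.Modules} (a : M ≅ N) : toPre M ≅ toPre N :=
  (Scheme.Modules.toPresheafOfModules X).mapIso a

/-- The isomorphism `L_0 ⊗ L_1 ≅ L_1` given by a trivialization `L_0 ≅ 𝒪_X`, on presheaves. -/
def preTensorMulIso {X : Scheme.{0}} (L : Fin 2 → X.Modules) (a : L 0 ≅ structureModule X) :
    preTensor L ![1, 1] ≅ toPre (L 1) :=
  tensorIso (ρ_ (toPre (L 0)) ≪≫ toPreIso a) (ρ_ _ ≪≫ ρ_ (toPre (L 1))) ≪≫ λ_ (toPre (L 1))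

/-- The canonical isomorphism `L_0^{⊗ 1} ⊗ L_1^{⊗ 0} ≅ L_0`, on presheaves. -/
def preTensorFstIso {X : Scheme.{0}} (L : Fin 2 → X.Modules) :
    preTensor L ![1, 0] ≅ toPre (L 0) :=
  tensorIso (ρ_ (toPre (L 0))) (λ_ (𝟙_ (PreModules X))) ≪≫ ρ_ (toPre (L 0))

/-- The canonical isomorphism `L_0^{⊗ 0} ⊗ L_1^{⊗ 1} ≅ L_1`, on presheaves. -/
def preTensorSndIso {X : Scheme.{0}} (L : Fin 2 → X.Modules) :
    preTensor L ![0, 1] ≅ toPre (L 1) :=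
  tensorIso (Iso.refl (𝟙_ (PreModules X))) (ρ_ _ ≪≫ ρ_ (toPre (L 1))) ≪≫ λ_ (toPre (L 1))

/-- The isomorphism `L_0 ⊗ L_1 ≅ L_1` given by a trivialization `L_0 ≅ 𝒪_X`: it sends `u ⊗ v` to `u • v`. -/
def tensorMulIso {X : Scheme.{0}} (L : Fin 2 → X.Modules) (a : L 0 ≅ structureModule X) :
    tensorPow L ![1, 1] ≅ L 1 :=
  (sheafify X).mapIso (preTensorMulIso L a) ≪≫ sheafifyIso (L 1)

/-- The canonical isomorphism `L_0^{⊗ 1} ⊗ L_1^{⊗ 0} ≅ L_0`. -/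
def tensorFstIso {X : Scheme.{0}} (L : Fin 2 → X.Modules) :
    tensorPow L ![1, 0] ≅ L 0 :=
  (sheafify X).mapIso (preTensorFstIso L) ≪≫ sheafifyIso (L 0)

/-- The canonical isomorphism `L_0^{⊗ 0} ⊗ L_1^{⊗ 1} ≅ L_1`. -/
def tensorSndIso {X : Scheme.{0}} (L : Fin 2 → X.Modules) :
    tensorPow L ![0, 1] ≅ L 1 :=
  (sheafify X).mapIso (preTensorSndIso L) ≪≫ sheafifyIso (L 1)

/-- The total space of the complex line bundle on `X(ℂ)` defined by `L`: a point and a vector in the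
fibre over it. -/
structure TotalSpace {X : LogScheme} (L : LineWithSection X.X) where
  pt : CPoint X
  vec : Fibre L.sheaf pt.hom

/-- The topology of the total space: the coarsest one for which the projection to `X(ℂ)` is continuous
and, for each frame `e` over each open `U`, the coordinate in the frame `e` is continuous on the part
of the total space over `U(ℂ)`. -/
instance {X : LogScheme} (L : LineWithSection X.X) : TopologicalSpace (TotalSpace L) :=
  TopologicalSpace.induced TotalSpace.pt inferInstance ⊓
  TopologicalSpace.generateFrom
    {S | ∃ (U : X.X.Opens) (e : Γ(L.sheaf, U)) (he : IsFrame L.sheaf U e) (W : Set ℂ), IsOpen W ∧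
      S = {p : TotalSpace L | ∃ hx : ⊤ ≤ p.pt.hom ⁻¹ᵁ U, p.vec.1 ⟨U, hx, e, he⟩ ∈ W}}

/-- The nonzero vectors `p` in the fibres of `L` that have the direction of the section `s`: at the point
`x` below `p`, there is a real `α ≥ 0` with `α p = s(x)`. Where `s(x) ≠ 0`, these are the positive
real multiples of `s(x)`, and where `s(x) = 0`, they are all the nonzero vectors of the fibre. -/
def BlowupVector {X : LogScheme} (L : LineWithSection X.X) : Type :=
  {p : TotalSpace L // p.vec ≠ 0 ∧
    ∃ α : ℝ, 0 ≤ α ∧ (α : ℂ) • p.vec = sectionValue L.sec p.pt.hom}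

instance {X : LogScheme} (L : LineWithSection X.X) : TopologicalSpace (BlowupVector L) :=
  inferInstanceAs (TopologicalSpace {p : TotalSpace L // _})

/-- Two vectors are on the same ray if one is a positive real multiple of the other. -/
def raySetoid {X : LogScheme} (L : LineWithSection X.X) : Setoid (BlowupVector L) where
  r p q := ∃ c : ℝ, 0 < c ∧ q.1 = ⟨p.1.pt, (c : ℂ) • p.1.vec⟩
  iseqv := by
    refine ⟨fun p => ⟨1, one_pos, by simp⟩, ?_, ?_⟩
    · rintro ⟨⟨x, v⟩, hv⟩ ⟨q, hq⟩ ⟨c, hc, rfl⟩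
      refine ⟨c⁻¹, inv_pos.mpr hc, ?_⟩
      have : (c : ℂ) ≠ 0 := by exact_mod_cast hc.ne'
      simp [smul_smul, this]
    · rintro ⟨⟨x, v⟩, hv⟩ ⟨q, hq⟩ ⟨r, hr⟩ ⟨c, hc, rfl⟩ ⟨d, hd, rfl⟩
      exact ⟨d * c, mul_pos hd hc, by simp [smul_smul]⟩

/-- The real oriented blow-up of `X(ℂ)` in `(L, s)`: the quotient of the space of vectors above by
multiplication with positive reals. -/
def RealBlowup {X : LogScheme} (L : LineWithSection X.X) : Type := Quotient (raySetoid L)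

instance {X : LogScheme} (L : LineWithSection X.X) : TopologicalSpace (RealBlowup L) :=
  inferInstanceAs (TopologicalSpace (Quotient (raySetoid L)))

/-- The point of the real oriented blow-up given by a vector. -/
def BlowupVector.ray {X : LogScheme} {L : LineWithSection X.X} (p : BlowupVector L) :
    RealBlowup L := Quotient.mk (raySetoid L) p

/-- The blow-down map to `X(ℂ)`. -/
def RealBlowup.blowdown {X : LogScheme} {L : LineWithSection X.X} : RealBlowup L → CPoint X :=
  Quotient.lift (fun p => p.1.pt) (by
    rintro p q ⟨c, _, h⟩
    rw [h])

/-- The Kato--Nakayama space (analytification) of a log scheme `X`: the fibre product over `X(ℂ)` of the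
real oriented blow-ups of the line bundles with sections that make up the log structure. -/
def KN (X : LogScheme) : Type :=
  {P : CPoint X × (∀ i, RealBlowup (X := X) (X.L i)) // ∀ i, (P.2 i).blowdown = P.1}

instance (X : LogScheme) : TopologicalSpace (KN X) :=
  inferInstanceAs (TopologicalSpace {P : CPoint X × (∀ i, RealBlowup (X := X) (X.L i)) // _})

/-- The point of `X(ℂ)` below a point of the Kato--Nakayama space. -/
def KN.pt {X : LogScheme} (P : KN X) : CPoint X := P.1.1

/-- The ray in the `i`-th line bundle given by a point of the Kato--Nakayama space. -/
def KN.ray {X : LogScheme} (P : KN X) (i : Fin X.n) : RealBlowup (X := X) (X.L i) := P.1.2 i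

open Scheme.Modules in
/-- The map `g` is the Kato--Nakayama analytification `φ^KN` of the morphism `φ : X ⟶ Y`: it lies over
`f : X(ℂ) → Y(ℂ)`, and the `i`-th ray of `g P` is the one which the isomorphism
`f^* L_{Y,i} ≅ ⨂_j L_{X,j}^{⊗ e i j}` sends to the ray of `⨂_j p_j^{⊗ e i j}`, where `p_j` spans the
`j`-th ray of `P`.

The condition is written in local frames `a_j` of `L_{X,j}` and `b` of `L_{Y,i}`. If the isomorphism
sends `f^* b` to `r • ⨂_j a_j^{⊗ e i j}` near the point `x` below `P`, then it sends the vector `q`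
with coordinate `q_b` to the vector with coordinate `r(x) q_b`, while `⨂_j p_j^{⊗ e i j}` has the
coordinate `∏_j (p_j)_{a_j}^{e i j}`. These two have to agree up to a positive real factor. -/
def IsAnalytification {X Y : LogScheme} (φ : X.Hom Y) (g : KN X → KN Y) : Prop :=
  ∀ P : KN X, (g P).pt.hom = P.pt.hom ≫ φ.f ∧
    ∀ (i : Fin Y.n) (p : ∀ j, BlowupVector (X := X) (X.L j)) (q : BlowupVector (X := Y) (Y.L i)),
      (∀ j, (p j).ray = P.ray j) → q.ray = (g P).ray i →
      ∀ (a : ∀ j, FrameAt (X.L j).sheaf (p j).1.pt.hom) (b : FrameAt (Y.L i).sheaf q.1.pt.hom)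
        (W : X.X.Opens) (hx : ⊤ ≤ P.pt.hom ⁻¹ᵁ W) (ha : ∀ j, W ≤ (a j).U) (hb : W ≤ φ.f ⁻¹ᵁ b.U)
        (r : Γ(X.X, W)),
        (φ.iso i).hom.app W (((Y.L i).pullback φ.f).sheaf.presheaf.map (homOfLE hb).op
            (pullbackSection φ.f (Y.L i).sheaf b.U b.e)) =
          r • tensorSection (fun j => (X.L j).sheaf) (φ.e i) W
            (fun j => (X.L j).sheaf.presheaf.map (homOfLE (ha j)).op (a j).e) →
        ∃ c : ℝ, 0 < c ∧
          evalAt P.pt.hom W hx r * q.1.vec.1 b = c * ∏ j, (p j).1.vec.1 (a j) ^ φ.e i j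

/-- A line bundle with the zero section. -/
def zeroLine {X : Scheme.{0}} (M : X.Modules) (h : IsInvertible M) : LineWithSection X :=
  ⟨M, h, 0⟩

/-- The log scheme `𝖲_0 = (Spec ℂ, 0 : 𝒪 ⟶ 𝒪)`. -/
def logPoint : LogScheme where
  X := SpecC
  str := 𝟙 SpecC
  locallyOfFiniteType := inferInstance
  quasiCompact := inferInstance
  n := 1
  L := fun _ => zeroLine (structureModule SpecC) (structureModule_isInvertible SpecC)

/-- The log scheme `𝖲_m = (ℙ^m, 0 : 𝒪 ⟶ 𝒪(-1))`. -/
def logProj (m : ℕ) : LogScheme where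
  X := ProjSpace m
  str := ProjSpace.str m
  locallyOfFiniteType := inferInstance
  quasiCompact := inferInstance
  n := 1
  L := fun _ => zeroLine (serreTwist (grading m) (-1)) (tautological_isInvertible m)

lemma preTensorSection_eq_zero {X : Scheme.{0}} (U : X.Opens) : ∀ {n : ℕ} (L : Fin n → X.Modules)
    (e : Fin n → ℕ) (l : ∀ j, Γ(L j, U)) (j : Fin n), e j ≠ 0 → l j = 0 →
    preTensorSection U L e l = 0
  | 0, _, _, _, j, _, _ => j.elim0
  | n + 1, L, e, l, j, hj, hl => by
    induction j using Fin.cases with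
    | zero =>
      obtain ⟨k, hk⟩ := Nat.exists_eq_succ_of_ne_zero hj
      have h : prePowSection (L 0) U (l 0) (e 0) = 0 := by
        rw [hl]
        generalize e 0 = e0 at hk ⊢
        subst hk
        exact TensorProduct.zero_tmul _ _
      exact (congrArg (fun t => TensorProduct.tmul Γ(X, U) t
        (preTensorSection U (Fin.tail L) (Fin.tail e) (Fin.tail l))) h).trans
          (TensorProduct.zero_tmul _ _)
    | succ j =>
      have h := preTensorSection_eq_zero U (Fin.tail L) (Fin.tail e) (Fin.tail l) j hj hl
      exact (congrArg (fun t => TensorProduct.tmul Γ(X, U)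
        (prePowSection (L 0) U (l 0) (e 0)) t) h).trans (TensorProduct.tmul_zero _ _)

lemma tensorSection_eq_zero {X : Scheme.{0}} (U : X.Opens) {n : ℕ} (L : Fin n → X.Modules)
    (e : Fin n → ℕ) (l : ∀ j, Γ(L j, U)) (j : Fin n) (hj : e j ≠ 0) (hl : l j = 0) :
    tensorSection L e U l = 0 := by
  rw [tensorSection, preTensorSection_eq_zero U L e l j hj hl]
  exact map_zero _

/-- The product `𝖲_0 × 𝖲_m`. -/
abbrev baseProd (m : ℕ) : LogScheme := logPoint.prod (logProj m)

lemma pullbackSection_zero {X Y : Scheme.{0}} (f : X ⟶ Y) (M : Y.Modules) (V : Y.Opens) :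
    pullbackSection f M V 0 = 0 := map_zero _

/-- The two line bundles `π_1^* 𝒪_{Spec ℂ}` and `π_2^* 𝒪(-1)` of the product `𝖲_0 × 𝖲_m`. -/
def prodSheaf (m : ℕ) : Fin 2 → (baseProd m).X.Modules := fun j => ((baseProd m).L j).sheaf

/-- The morphism `f : 𝖲_0 × 𝖲_m ⟶ 𝖲_m` of scalar multiplication. On underlying schemes it is the canonical
isomorphism `Spec ℂ × ℙ^m ≅ ℙ^m`, that is, the second projection. On the log structures it is the
isomorphism `f^* 𝒪(-1) ≅ π_1^* 𝒪_{Spec ℂ} ⊗ π_2^* 𝒪(-1)` inverse to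
`π_1^* 𝒪_{Spec ℂ} ⊗ π_2^* 𝒪(-1) ≅ 𝒪 ⊗ π_2^* 𝒪(-1) ≅ π_2^* 𝒪(-1)`, `u ⊗ v ↦ u v`. -/
def actionHom (m : ℕ) : (logPoint.prod (logProj m)).Hom (logProj m) where
  f := Limits.pullback.snd logPoint.str (logProj m).str
  comm := Limits.pullback.condition.symm
  e := fun _ => ![1, 1]
  iso := fun _ => (tensorMulIso (prodSheaf m)
    (pullbackUnitIso (Limits.pullback.fst logPoint.str (logProj m).str))).symm
  iso_section := fun _ => by
    trans 0
    · refine (congrArg _ (pullbackSection_zero _ _ _)).trans (map_zero _)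
    · exact (tensorSection_eq_zero ⊤ _ _ _ (0 : Fin 2) one_ne_zero (pullbackSection_zero _ _ _)).symm

/-- The first projection `𝖲_0 × 𝖲_m ⟶ 𝖲_0` of log schemes. -/
def fstHom (m : ℕ) : (logPoint.prod (logProj m)).Hom logPoint where
  f := Limits.pullback.fst logPoint.str (logProj m).str
  comm := rfl
  e := fun _ => ![1, 0]
  iso := fun _ => (tensorFstIso (prodSheaf m)).symm
  iso_section := fun _ => by
    trans 0
    · refine (congrArg _ (pullbackSection_zero _ _ _)).trans (map_zero _)
    · exact (tensorSection_eq_zero ⊤ _ _ _ (0 : Fin 2) one_ne_zero (pullbackSection_zero _ _ _)).symm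

/-- The second projection `𝖲_0 × 𝖲_m ⟶ 𝖲_m` of log schemes. -/
def sndHom (m : ℕ) : (logPoint.prod (logProj m)).Hom (logProj m) where
  f := Limits.pullback.snd logPoint.str (logProj m).str
  comm := Limits.pullback.condition.symm
  e := fun _ => ![0, 1]
  iso := fun _ => (tensorSndIso (prodSheaf m)).symm
  iso_section := fun _ => by
    trans 0
    · refine (congrArg _ (pullbackSection_zero _ _ _)).trans (map_zero _)
    · exact (tensorSection_eq_zero ⊤ _ _ _ (1 : Fin 2) one_ne_zero (pullbackSection_zero _ _ _)).symm

open Scheme.Modules in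
/-- The standard identification of `KN 𝖲_0` with the unit circle: a ray in the fibre `ℂ` of `𝒪` goes to
the complex number of modulus one on it. -/
def IsStandardCircle (h0 : KN logPoint ≃ₜ Circle) : Prop :=
  ∀ (P : KN logPoint) (p : BlowupVector (X := logPoint) (logPoint.L (0 : Fin 1))),
    p.ray = P.ray (0 : Fin 1) →
    ∃ c : ℝ, 0 < c ∧ (h0 P : ℂ) = c * p.1.vec.1 ⟨⊤, fun _ _ => trivial, (1 : Γ(SpecC, ⊤)), isFrame_one SpecC⟩

/-- The regular function `x_j / x_i` on `D₊(x_i) ⊆ ℙ^m`. -/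
def coordRatio (m : ℕ) (i j : Fin (m + 1)) :
    Γ(ProjSpace m, Proj.basicOpen (grading m) (MvPolynomial.X i)) :=
  Proj.awayToSection (grading m) (MvPolynomial.X i)
    (HomogeneousLocalization.Away.mk (grading m) (X_mem i) 1 (MvPolynomial.X j)
      (by rw [one_smul]; exact X_mem j))

/-- The `j`-th complex coordinate of a vector of `ℝ^{2k} = (ℝ²)^k = ℂ^k`. -/
def complexCoord {k : ℕ} (v : EuclideanSpace ℝ (Fin 2 × Fin k)) (j : Fin k) : ℂ :=
  ⟨v (0, j), v (1, j)⟩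

/-- The sphere `S^{2k-1}`, as the unit sphere of the Euclidean space `ℝ^{2k} = (ℝ²)^k`. -/
abbrev UnitSphere (k : ℕ) : Type := Metric.sphere (0 : EuclideanSpace ℝ (Fin 2 × Fin k)) 1

/-- The standard identification of `KN 𝖲_m` with the unit sphere `S^{2m+1}` of `ℂ^{m+1}`. The fibre of
`𝒪(-1)` over a point `ℓ` of `ℙ^m` is the line `ℓ ⊆ ℂ^{m+1}` itself, where the value at `ℓ` of the
section `1 / x_i` is the vector of `ℓ` with `i`-th coordinate `1`, so with `j`-th coordinate
`(x_j / x_i)(ℓ)`. A ray in `ℓ` goes to the unit vector on it. In particular the blow-down map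
`KN 𝖲_m → ℙ^m(ℂ)` becomes the Hopf fibration. -/
def IsStandardSphere {m : ℕ} (hS : KN (logProj m) ≃ₜ UnitSphere (m + 1)) : Prop :=
  ∀ (P : KN (logProj m)) (p : BlowupVector (X := logProj m) ((logProj m).L (0 : Fin 1))),
    p.ray = P.ray (0 : Fin 1) →
    ∃ c : ℝ, 0 < c ∧
      ∀ (i : Fin (m + 1))
        (hi : ⊤ ≤ p.1.pt.hom ⁻¹ᵁ Proj.basicOpen (grading m) (MvPolynomial.X i)) (j : Fin (m + 1)),
        complexCoord (hS P).1 j =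
          c * (p.1.vec.1 ⟨_, hi, _, invSection_isFrame (grading m) (MvPolynomial.X i) (X_mem i)⟩ *
            evalAt p.1.pt.hom _ hi (coordRatio m i j))

/-- The isomorphism of the circle group with `SO(2)`, which sends `z` to the matrix of multiplication by `z`. -/
def circleEquivSO : Circle ≃* Matrix.specialOrthogonalGroup (Fin 2) ℝ where
  toFun z := ⟨!![(z : ℂ).re, -(z : ℂ).im; (z : ℂ).im, (z : ℂ).re],
    Matrix.of_mem_specialOrthogonalGroup_fin_two_iff.mpr ⟨rfl, rfl, by
      have h := Circle.normSq_coe z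
      rw [Complex.normSq_apply] at h
      nlinarith⟩⟩
  invFun A := ⟨⟨A.1 0 0, A.1 1 0⟩, by
    obtain ⟨h1, h2, h3⟩ := Matrix.mem_specialOrthogonalGroup_fin_two_iff.mp A.2
    refine mem_sphere_zero_iff_norm.mpr ?_
    rw [Complex.norm_def, Real.sqrt_eq_one, Complex.normSq_mk]
    rw [h2] at h3
    nlinarith⟩
  left_inv z := by
    apply Circle.ext
    rfl
  right_inv A := by
    obtain ⟨h1, h2, h3⟩ := Matrix.mem_specialOrthogonalGroup_fin_two_iff.mp A.2
    apply Subtype.ext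
    ext i j
    fin_cases i <;> fin_cases j <;> simp [h1, h2]
  map_mul' z w := by
    apply Subtype.ext
    ext i j
    fin_cases i <;> fin_cases j <;> simp <;> ring

/-- The diagonal inclusion `SO(2) ↪ SO(2k)`, which sends `A` to the block diagonal matrix with `k` blocks
`A`; it acts on each of the `k` factors of `ℝ^{2k} = (ℝ²)^k` through `A`. -/
def diagonalSO (k : ℕ) : Matrix.specialOrthogonalGroup (Fin 2) ℝ →*
    Matrix.specialOrthogonalGroup (Fin 2 × Fin k) ℝ where
  toFun A := ⟨Matrix.blockDiagonal fun _ : Fin k => A.1, by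
    obtain ⟨h, h'⟩ := Matrix.mem_specialOrthogonalGroup_iff.mp A.2
    rw [Matrix.mem_orthogonalGroup_iff] at h
    refine Matrix.mem_specialOrthogonalGroup_iff.mpr ⟨?_, ?_⟩
    · rw [Matrix.mem_orthogonalGroup_iff]
      rw [Matrix.blockDiagonal_transpose, ← Matrix.blockDiagonal_mul, h]
      exact Matrix.blockDiagonal_one
    · rw [Matrix.det_blockDiagonal, h', Finset.prod_const_one]⟩
  map_one' := Subtype.ext Matrix.blockDiagonal_one
  map_mul' A B := Subtype.ext
    (Matrix.blockDiagonal_mul (fun _ : Fin k => A.1) (fun _ : Fin k => B.1))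

end DFLog
end

/-!
The Kato--Nakayama space of `𝖲_m` is the real oriented blow-up of `ℙ^m(ℂ)` in the zero section of
`𝒪(-1)`, hence the space of nonzero vectors of the tautological bundle up to positive reals. A nonzero
vector `p` of the line `ℓ` has coordinates in `ℂ^{m+1}`: in the frame `1/x_i` of `𝒪(-1)` they are
`p_i · (x_j/x_i)(ℓ)`, independently of `i` (`tautCoord`). These coordinates determine the point `ℓ` as
well as the vector, since a complex point of `ℙ^m` is determined by the ratios of the coordinates and every
nonzero vector `v` of `ℂ^{m+1}` defines a point (`CPoint.ext_coordRatio`, `exists_eq_projPoint`). So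
the nonzero vectors of the bundle are those of `ℂ^{m+1}`, both `tautCoord` and its inverse `tautPoint` are
continuous, and dividing by the norm gives the homeomorphism `sphereHomeo` (through the general
`blowupHomeoSphere`). In the same way `circleHomeo` comes from the coordinate in the frame `1` of `𝒪`.

A continuous map into the total space of a line bundle can be tested in one frame near each point
(`continuous_totalSpace_of_frame`). If frames of `M` pull back to frames of `f^* M`, then a vector of
the fibre of `f^* M` at `x` is the same as a vector of the fibre of `M` at `f(x)` (`Fibre.push`). This
applies to both projections of `Spec ℂ × ℙ^m`: the second is an isomorphism
(`IsFrame.pullback_of_isIso`), and along the first one only `𝒪` is pulled back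
(`IsFrame.pullback_structureModule`). Hence the two push-forwards of rays define a continuous bijection
`prodHomeo`, with an inverse that is continuous by the same frame criterion.

The condition `IsAnalytification` compares coordinates in frames. By `isAnalytification_iff` it amounts
to a rule for vectors, as soon as that rule is compatible with all frames and some frames exist
for which the compatibility determines the result. For the three morphisms of log schemes the isomorphisms
of line bundles are the inverses of `u ⊗ 1 ↦ u`, `1 ⊗ v ↦ v` and `u ⊗ v ↦ uv`; they are computed on
sections via the unit of the sheafification adjunction (`sheafify_map_toSheafify`). The resulting rules are
the two push-forwards and the product `actionVec`, which in the coordinates of `ℂ^{m+1}` is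
multiplication by a complex number (`isAnalytification_action_iff`).
-/

noncomputable section
open CategoryTheory MonoidalCategory TopologicalSpace AlgebraicGeometry Topology

namespace DFLog

/-! ### Fibres of line bundles -/

lemma evalAt_comp {X Y : Scheme.{0}} (x : SpecC ⟶ X) (f : X ⟶ Y) (U : Y.Opens)
    (hx : ⊤ ≤ (x ≫ f) ⁻¹ᵁ U) (hx' : ⊤ ≤ x ⁻¹ᵁ (f ⁻¹ᵁ U)) (r : Γ(Y, U)) :
    evalAt (x ≫ f) U hx r = evalAt x (f ⁻¹ᵁ U) hx' (f.app U r) := by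
  simp only [evalAt, Scheme.Hom.comp_appLE]
  rfl

section Fibre
variable {X : Scheme.{0}} {M : X.Modules} {x : SpecC ⟶ X}

lemma FrameAt.le_inf (a b : FrameAt M x) : ⊤ ≤ x ⁻¹ᵁ (a.U ⊓ b.U) :=
  fun _ h => ⟨a.mem h, b.mem h⟩

lemma FrameAt.exists_transition (a b : FrameAt M x) :
    ∃ r : Γ(X, a.U ⊓ b.U), M.presheaf.map (homOfLE inf_le_right).op b.e =
      r • M.presheaf.map (homOfLE inf_le_left).op a.e := by
  obtain ⟨r, hr⟩ := (a.isFrame (a.U ⊓ b.U) inf_le_left).2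
    (M.presheaf.map (homOfLE inf_le_right).op b.e)
  exact ⟨r, hr.symm⟩

/-- The transition function `r` from `a` to `b`: the function with `b = r • a` near the point `x`. -/
def FrameAt.transition (a b : FrameAt M x) : Γ(X, a.U ⊓ b.U) := (a.exists_transition b).choose

lemma FrameAt.transition_spec (a b : FrameAt M x) :
    M.presheaf.map (homOfLE inf_le_right).op b.e =
      a.transition b • M.presheaf.map (homOfLE inf_le_left).op a.e :=
  (a.exists_transition b).choose_spec

lemma Fibre.apply_eq_transition (v : Fibre M x) (a b : FrameAt M x) :
    v.1 a = evalAt x _ (a.le_inf b) (a.transition b) * v.1 b :=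
  v.2 a b _ inf_le_left inf_le_right (a.le_inf b) _ (a.transition_spec b)

lemma Fibre.ext_frame (a : FrameAt M x) {v w : Fibre M x} (h : v.1 a = w.1 a) : v = w := by
  apply Subtype.ext
  funext b
  rw [Fibre.apply_eq_transition v b a, Fibre.apply_eq_transition w b a, h]

lemma Fibre.apply_ne_zero (a : FrameAt M x) {v : Fibre M x} (h : v ≠ 0) : v.1 a ≠ 0 :=
  fun h' => h (Fibre.ext_frame a h')

lemma map_map_apply (M : X.Modules) {U V W : X.Opens} (h : V ≤ U) (h' : W ≤ V) (e : Γ(M, U)) :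
    M.presheaf.map (homOfLE h').op (M.presheaf.map (homOfLE h).op e) =
      M.presheaf.map (homOfLE (h'.trans h)).op e := by
  rw [← ConcreteCategory.comp_apply, ← Functor.map_comp]
  rfl

lemma map_self_apply (M : X.Modules) {U : X.Opens} (e : Γ(M, U)) :
    M.presheaf.map (homOfLE (le_refl U)).op e = e := by
  have : (homOfLE (le_refl U)).op = 𝟙 _ := rfl
  rw [this, CategoryTheory.Functor.map_id]
  rfl

/-- The vector of the fibre with a given coordinate in a given frame. -/
def Fibre.ofFrame (a : FrameAt M x) (z : ℂ) : Fibre M x :=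
  ⟨fun b => evalAt x _ (b.le_inf a) (b.transition a) * z, by
    intro b c W hb hc hx r h
    change _ * z = _ * (_ * z)
    have hW : ⊤ ≤ x ⁻¹ᵁ (W ⊓ a.U) := fun _ h => ⟨hx h, a.mem h⟩
    have h1 : W ⊓ a.U ≤ b.U ⊓ a.U := inf_le_inf_right _ hb
    have h2 : W ⊓ a.U ≤ c.U ⊓ a.U := inf_le_inf_right _ hc
    rw [← mul_assoc, ← evalAt_map x h1 hW, ← evalAt_map x h2 hW, ← evalAt_map x inf_le_left hW,
      ← map_mul]
    congr 2
    apply (b.isFrame (W ⊓ a.U) (inf_le_left.trans hb)).1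
    have e1 := congrArg (M.presheaf.map (homOfLE h1).op) (b.transition_spec a)
    have e2 := congrArg (M.presheaf.map (homOfLE h2).op) (c.transition_spec a)
    have e3 := congrArg (M.presheaf.map (homOfLE (inf_le_left : W ⊓ a.U ≤ W)).op) h
    rw [Scheme.Modules.map_smul] at e1 e2 e3
    simp only [map_map_apply] at e1 e2 e3
    change _ • _ = _ • _
    rw [← e1, mul_comm, mul_smul, ← e3, ← e2]⟩

lemma Fibre.ofFrame_apply (a : FrameAt M x) (z : ℂ) : (Fibre.ofFrame a z).1 a = z := by
  change evalAt x _ (a.le_inf a) (a.transition a) * z = z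
  have : a.transition a = 1 := by
    apply (a.isFrame _ inf_le_left).1
    change _ • _ = _ • _
    rw [← a.transition_spec a, one_smul]
  rw [this, map_one, one_mul]

lemma sectionValue_zero (x : SpecC ⟶ X) : sectionValue (0 : Γ(M, ⊤)) x = 0 := by
  apply Subtype.ext
  funext a
  change evalAt x a.U a.mem (a.coeff 0) = 0
  have : a.coeff (0 : Γ(M, ⊤)) = 0 := by
    apply (a.isFrame a.U le_rfl).1
    have h := a.coeff_spec (0 : Γ(M, ⊤))
    change _ • _ = _ • _
    rw [map_self_apply, h, zero_smul, map_zero]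
  rw [this, map_zero]

end Fibre

/-! ### The analytic topology -/

section Topology
variable {X : LogScheme}

open Classical in
/-- The value of a regular function on `U`, extended by zero to all complex points. -/
def evalOrZero (U : X.X.Opens) (r : Γ(X.X, U)) (x : CPoint X) : ℂ :=
  if hx : ⊤ ≤ x.hom ⁻¹ᵁ U then evalAt x.hom U hx r else 0

lemma evalOrZero_eq {U : X.X.Opens} (r : Γ(X.X, U)) {x : CPoint X} (hx : ⊤ ≤ x.hom ⁻¹ᵁ U) :
    evalOrZero U r x = evalAt x.hom U hx r := dif_pos hx

lemma isOpen_evalAt (U : X.X.Opens) (r : Γ(X.X, U)) {W : Set ℂ} (hW : IsOpen W) :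
    IsOpen {x : CPoint X | ∃ hx : ⊤ ≤ x.hom ⁻¹ᵁ U, evalAt x.hom U hx r ∈ W} :=
  isOpen_generateFrom_of_mem ⟨U, r, W, hW, rfl⟩

lemma isOpen_mem (U : X.X.Opens) : IsOpen {x : CPoint X | ⊤ ≤ x.hom ⁻¹ᵁ U} := by
  have h := isOpen_evalAt (X := X) U 0 isOpen_univ
  convert! h using 1
  ext x
  simp

lemma continuousAt_evalOrZero (U : X.X.Opens) (r : Γ(X.X, U)) {x : CPoint X}
    (hx : ⊤ ≤ x.hom ⁻¹ᵁ U) : ContinuousAt (evalOrZero U r) x := by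
  intro N hN
  obtain ⟨W, hWN, hW, hxW⟩ := mem_nhds_iff.mp hN
  rw [evalOrZero_eq r hx] at hxW
  refine Filter.mem_map.mpr <| Filter.mem_of_superset ((isOpen_evalAt U r hW).mem_nhds ⟨hx, hxW⟩) ?_
  rintro y ⟨hy, hyW⟩
  apply hWN
  rwa [evalOrZero_eq r hy]

variable {L : LineWithSection X.X}

open Classical in
/-- The coordinate in a frame over `U`, extended by zero to the whole total space. -/
def coordOrZero (L : LineWithSection X.X) {U : X.X.Opens} {e : Γ(L.sheaf, U)}
    (he : IsFrame L.sheaf U e) (p : TotalSpace L) : ℂ :=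
  if hx : ⊤ ≤ p.pt.hom ⁻¹ᵁ U then p.vec.1 ⟨U, hx, e, he⟩ else 0

lemma coordOrZero_eq {U : X.X.Opens} {e : Γ(L.sheaf, U)} (he : IsFrame L.sheaf U e)
    {p : TotalSpace L} (hx : ⊤ ≤ p.pt.hom ⁻¹ᵁ U) :
    coordOrZero L he p = p.vec.1 ⟨U, hx, e, he⟩ := dif_pos hx

lemma totalSpace_topology (L : LineWithSection X.X) : instTopologicalSpaceTotalSpace L =
    TopologicalSpace.induced TotalSpace.pt (instTopologicalSpaceCPoint X) ⊓ TopologicalSpace.generateFrom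
      {S | ∃ (U : X.X.Opens) (e : Γ(L.sheaf, U)) (he : IsFrame L.sheaf U e) (W : Set ℂ), IsOpen W ∧
        S = {p : TotalSpace L | ∃ hx : ⊤ ≤ p.pt.hom ⁻¹ᵁ U, p.vec.1 ⟨U, hx, e, he⟩ ∈ W}} := rfl

lemma continuous_pt : Continuous (TotalSpace.pt : TotalSpace L → CPoint X) := by
  rw [totalSpace_topology L]
  exact continuous_le_dom inf_le_left continuous_induced_dom

lemma continuousAt_coordOrZero {U : X.X.Opens} {e : Γ(L.sheaf, U)} (he : IsFrame L.sheaf U e)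
    {p : TotalSpace L} (hx : ⊤ ≤ p.pt.hom ⁻¹ᵁ U) : ContinuousAt (coordOrZero L he) p := by
  intro N hN
  obtain ⟨W, hWN, hW, hxW⟩ := mem_nhds_iff.mp hN
  rw [coordOrZero_eq he hx] at hxW
  have ho : IsOpen {p : TotalSpace L | ∃ hx : ⊤ ≤ p.pt.hom ⁻¹ᵁ U, p.vec.1 ⟨U, hx, e, he⟩ ∈ W} := by
    rw [totalSpace_topology L]
    refine (inf_le_right : _ ⊓ TopologicalSpace.generateFrom _ ≤ _) _ ?_
    exact isOpen_generateFrom_of_mem ⟨U, e, he, W, hW, rfl⟩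
  refine Filter.mem_map.mpr <| Filter.mem_of_superset (ho.mem_nhds ⟨hx, hxW⟩) ?_
  rintro y ⟨hy, hyW⟩
  apply hWN
  rwa [coordOrZero_eq he hy]

/-- Continuity of a map to the total space can be tested in a single frame near each point, as the
transition functions are regular, hence continuous. -/
lemma continuous_totalSpace_of_frame {T : Type*} [TopologicalSpace T] {g : T → TotalSpace L}
    (hg : Continuous fun t => (g t).pt)
    (h : ∀ t₀, ∃ (U : X.X.Opens) (e : Γ(L.sheaf, U)) (he : IsFrame L.sheaf U e),
      ⊤ ≤ (g t₀).pt.hom ⁻¹ᵁ U ∧ ContinuousAt (fun t => coordOrZero L he (g t)) t₀) :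
    Continuous g := by
  rw [totalSpace_topology L]
  refine (continuous_inf_rng
    (t₂ := TopologicalSpace.induced TotalSpace.pt (instTopologicalSpaceCPoint X))
    (t₃ := TopologicalSpace.generateFrom _)).mpr ?_
  refine ⟨continuous_induced_rng.mpr hg, ?_⟩
  rw [continuous_generateFrom_iff]
  rintro _ ⟨V, b, hb, W, hW, rfl⟩
  rw [isOpen_iff_mem_nhds]
  rintro t₀ ⟨ht₀, htW⟩
  obtain ⟨U, e, he, hU, hc⟩ := h t₀
  obtain ⟨r, hr⟩ := (hb (V ⊓ U) inf_le_left).2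
    (L.sheaf.presheaf.map (homOfLE inf_le_right).op e)
  have hVU : ⊤ ≤ (g t₀).pt.hom ⁻¹ᵁ (V ⊓ U) := fun _ h => ⟨ht₀ h, hU h⟩
  have key : ∀ t (h1 : ⊤ ≤ (g t).pt.hom ⁻¹ᵁ (V ⊓ U)),
      (g t).vec.1 ⟨V, fun _ h => (h1 h).1, b, hb⟩ =
        evalOrZero (V ⊓ U) r (g t).pt * coordOrZero L he (g t) := by
    intro t h1
    rw [evalOrZero_eq r h1, coordOrZero_eq he (fun _ h => (h1 h).2)]
    exact (g t).vec.2 ⟨V, fun _ h => (h1 h).1, b, hb⟩ ⟨U, fun _ h => (h1 h).2, e, he⟩ (V ⊓ U)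
      inf_le_left inf_le_right h1 r hr.symm
  have hcont : ContinuousAt
      (fun t => evalOrZero (V ⊓ U) r (g t).pt * coordOrZero L he (g t)) t₀ :=
    ((continuousAt_evalOrZero (V ⊓ U) r hVU).comp (f := fun t => (g t).pt) hg.continuousAt).mul hc
  have hmem : ∀ᶠ t in 𝓝 t₀, ⊤ ≤ (g t).pt.hom ⁻¹ᵁ (V ⊓ U) :=
    hg.continuousAt.eventually ((isOpen_mem (X := X) (V ⊓ U)).mem_nhds hVU)
  have hW' := hcont (hW.mem_nhds (by beta_reduce; rw [← key t₀ hVU]; exact htW))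
  filter_upwards [hmem, hW'] with t h1 h2
  refine ⟨fun _ h => (h1 h).1, ?_⟩
  rw [key t h1]
  exact h2

end Topology

/-! ### Real oriented blow-ups in the zero section -/

section Blowup
variable {X : LogScheme} {L : LineWithSection X.X}

lemma continuous_blowdown : Continuous (RealBlowup.blowdown : RealBlowup L → CPoint X) :=
  Continuous.quotient_lift (continuous_pt.comp continuous_subtype_val) _

lemma continuous_ray : Continuous (BlowupVector.ray : BlowupVector L → RealBlowup L) :=
  continuous_quotient_mk'

lemma exists_ray (R : RealBlowup L) : ∃ p : BlowupVector L, p.ray = R := Quotient.exists_rep R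

lemma ray_eq_iff {p q : BlowupVector L} :
    p.ray = q.ray ↔ ∃ c : ℝ, 0 < c ∧ q.1 = ⟨p.1.pt, (c : ℂ) • p.1.vec⟩ :=
  Quotient.eq (r := raySetoid L)

/-- A nonzero vector of a line bundle with the zero section. -/
def BlowupVector.ofNeZero (hL : L.sec = 0) (p : TotalSpace L) (hp : p.vec ≠ 0) : BlowupVector L :=
  ⟨p, hp, 0, le_rfl, by rw [hL, sectionValue_zero]; simp⟩

/-- If `T` is a continuous coordinate on the vectors of `L` with values in a normed space `E`,
injective on the nonzero vectors, with a continuous right inverse `σ` on the unit sphere of `E`, then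
the real oriented blow-up of `X(ℂ)` in `(L, 0)` is the unit sphere of `E`. -/
def blowupHomeoSphere (hL : L.sec = 0) {E : Type*} [NormedAddCommGroup E] [NormedSpace ℝ E]
    (T : TotalSpace L → E) (hT : Continuous T)
    (hsmul : ∀ x v (c : ℝ), T ⟨x, (c : ℂ) • v⟩ = c • T ⟨x, v⟩)
    (hne : ∀ p, p.vec ≠ 0 → T p ≠ 0)
    (hinj : ∀ p q, p.vec ≠ 0 → q.vec ≠ 0 → T p = T q → p = q)
    (σ : Metric.sphere (0 : E) 1 → TotalSpace L) (hσ : Continuous σ) (hTσ : ∀ s, T (σ s) = s) :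
    RealBlowup L ≃ₜ Metric.sphere (0 : E) 1 :=
  have hzero : ∀ s, (σ s).vec ≠ 0 := by
    intro s h
    have h1 := hsmul (σ s).pt 0 0
    rw [zero_smul, smul_zero] at h1
    have h2 : T (σ s) = 0 := by rw [← h1, ← h]
    rw [hTσ] at h2
    exact ne_zero_of_mem_unit_sphere s h2
  { toFun := Quotient.lift
      (fun p : BlowupVector L => (⟨‖T p.1‖⁻¹ • T p.1, by
        rw [mem_sphere_zero_iff_norm, norm_smul, norm_inv, norm_norm]
        exact inv_mul_cancel₀ (norm_ne_zero_iff.mpr (hne _ p.2.1))⟩ : Metric.sphere (0 : E) 1)) (by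
        rintro p q ⟨c, hc, h⟩
        apply Subtype.ext
        have h1 : T q.1 = c • T p.1 := by rw [h, hsmul]
        change ‖T p.1‖⁻¹ • T p.1 = ‖T q.1‖⁻¹ • T q.1
        rw [h1, norm_smul, Real.norm_of_nonneg hc.le, smul_smul, mul_inv, mul_right_comm,
          inv_mul_cancel₀ hc.ne', one_mul])
    invFun := fun s => (BlowupVector.ofNeZero hL (σ s) (hzero s)).ray
    left_inv := by
      intro R
      obtain ⟨p, rfl⟩ := exists_ray R
      rw [eq_comm, ray_eq_iff]
      have hp : 0 < ‖T p.1‖⁻¹ := inv_pos.mpr (norm_pos_iff.mpr (hne _ p.2.1))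
      refine ⟨‖T p.1‖⁻¹, hp, hinj _ _ (hzero _) ?_ ?_⟩
      · exact smul_ne_zero (by exact_mod_cast hp.ne') p.2.1
      · rw [hsmul]
        exact hTσ _
    right_inv := by
      intro s
      apply Subtype.ext
      change ‖T (σ s)‖⁻¹ • T (σ s) = s
      rw [hTσ, norm_eq_of_mem_sphere, inv_one, one_smul]
    continuous_toFun := by
      refine Continuous.quotient_lift ?_ _
      have h1 : Continuous fun p : BlowupVector L => T p.1 := hT.comp continuous_subtype_val
      exact (((continuous_norm.comp h1).inv₀
        fun p => norm_ne_zero_iff.mpr (hne _ p.2.1)).smul h1).subtype_mk _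
    continuous_invFun := continuous_ray.comp (hσ.subtype_mk _) }

lemma blowupHomeoSphere_ray (hL : L.sec = 0) {E : Type*} [NormedAddCommGroup E] [NormedSpace ℝ E]
    {T : TotalSpace L → E} (hT : Continuous T)
    (hsmul : ∀ x v (c : ℝ), T ⟨x, (c : ℂ) • v⟩ = c • T ⟨x, v⟩)
    (hne : ∀ p, p.vec ≠ 0 → T p ≠ 0)
    (hinj : ∀ p q, p.vec ≠ 0 → q.vec ≠ 0 → T p = T q → p = q)
    {σ : Metric.sphere (0 : E) 1 → TotalSpace L} (hσ : Continuous σ) (hTσ : ∀ s, T (σ s) = s)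
    (p : BlowupVector L) :
    (blowupHomeoSphere hL T hT hsmul hne hinj σ hσ hTσ p.ray : E) = ‖T p.1‖⁻¹ • T p.1 := rfl

/-- The Kato--Nakayama space of a log scheme with a single line bundle is the real oriented blow-up. -/
def knHomeoBlowup (X : LogScheme) (i₀ : Fin X.n) (h : ∀ i, i = i₀) :
    KN X ≃ₜ RealBlowup (X := X) (X.L i₀) where
  toFun P := P.ray i₀
  invFun R := ⟨(R.blowdown, fun i => (h i).symm ▸ R), by
    intro i
    obtain rfl := h i
    rfl⟩
  left_inv P := by
    apply Subtype.ext
    refine Prod.ext (P.2 i₀) ?_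
    funext i
    obtain rfl := h i
    rfl
  right_inv R := rfl
  continuous_toFun := (continuous_apply i₀).comp (continuous_snd.comp continuous_subtype_val)
  continuous_invFun := by
    refine Continuous.subtype_mk (continuous_blowdown.prodMk (continuous_pi fun i => ?_)) _
    obtain rfl := h i
    exact continuous_id

end Blowup

/-! ### Complex points of projective space -/

instance : Subsingleton (SpecC : Scheme.{0}) :=
  inferInstanceAs (Subsingleton (PrimeSpectrum ℂ))

instance : Nonempty (SpecC : Scheme.{0}) :=
  inferInstanceAs (Nonempty (PrimeSpectrum ℂ))

lemma top_le_preimage_iff {X : Scheme.{0}} (x : SpecC ⟶ X) (U : X.Opens) (p : SpecC) :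
    ⊤ ≤ x ⁻¹ᵁ U ↔ x p ∈ U :=
  ⟨fun h => h (trivial : p ∈ (⊤ : SpecC.Opens)), fun h q _ => by
    rw [Subsingleton.elim q p]; exact h⟩

/-- A complex point of an affine open set is determined by the values of the regular functions. -/
lemma specMap_evalAt_fromSpec {X : Scheme.{0}} (x : SpecC ⟶ X) {U : X.Opens} (hU : IsAffineOpen U)
    (hx : ⊤ ≤ x ⁻¹ᵁ U) : Spec.map (CommRingCat.ofHom (evalAt x U hx)) ≫ hU.fromSpec = x := by
  have h := hU.SpecMap_appLE_fromSpec x (isAffineOpen_top SpecC) hx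
  rw [IsAffineOpen.fromSpec_top, Scheme.isoSpec_Spec_inv] at h
  have h2 : CommRingCat.ofHom (evalAt x U hx) =
      x.appLE U ⊤ hx ≫ (Scheme.ΓSpecIso (CommRingCat.of ℂ)).hom := rfl
  rw [h2, Spec.map_comp, Category.assoc, h, ← Category.assoc, ← Spec.map_comp, Iso.inv_hom_id,
    Spec.map_id, Category.id_comp]

lemma hom_ext_of_evalAt {X : Scheme.{0}} {x y : SpecC ⟶ X} {U : X.Opens} (hU : IsAffineOpen U)
    (hx : ⊤ ≤ x ⁻¹ᵁ U) (hy : ⊤ ≤ y ⁻¹ᵁ U) (h : evalAt x U hx = evalAt y U hy) : x = y := by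
  rw [← specMap_evalAt_fromSpec x hU hx, h, specMap_evalAt_fromSpec]

section Proj
variable {A σ : Type} [CommRing A] [SetLike σ A] [AddSubgroupClass σ A] (𝒜 : ℕ → σ) [GradedRing 𝒜]

open HomogeneousLocalization

lemma awayι_eq_fromSpec {f : A} {d : ℕ} (hf : f ∈ 𝒜 d) (hd : 0 < d) :
    Spec.map (Proj.awayToSection 𝒜 f) ≫ Proj.awayι 𝒜 f hf hd =
      (Proj.isAffineOpen_basicOpen 𝒜 f hf hd).fromSpec := by
  have : IsIso (Proj.basicOpen 𝒜 f).toSpecΓ := by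
    rw [← (Proj.isAffineOpen_basicOpen 𝒜 f hf hd).isoSpec_hom]
    infer_instance
  rw [← cancel_epi (Proj.basicOpen 𝒜 f).toSpecΓ, IsAffineOpen.toSpecΓ_fromSpec, ← Category.assoc]
  change Proj.basicOpenToSpec 𝒜 f ≫ _ = _
  rw [← Proj.basicOpenIsoSpec_hom 𝒜 f hf hd, ← Proj.basicOpenIsoSpec_inv_ι, Iso.hom_inv_id_assoc]

lemma top_le_preimage_awayι {f : A} {d : ℕ} (hf : f ∈ 𝒜 d) (hd : 0 < d) (χ : Away 𝒜 f →+* ℂ) :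
    ⊤ ≤ (Spec.map (CommRingCat.ofHom χ) ≫ Proj.awayι 𝒜 f hf hd : SpecC ⟶ _) ⁻¹ᵁ
      Proj.basicOpen 𝒜 f := by
  intro p _
  rw [← Proj.opensRange_awayι 𝒜 f hf hd]
  exact ⟨Spec.map (CommRingCat.ofHom χ) p, rfl⟩

/-- The value of a fraction at the complex point given by a ring homomorphism `χ` on the fractions. -/
lemma evalAt_specMap_awayι {f : A} {d : ℕ} (hf : f ∈ 𝒜 d) (hd : 0 < d) (χ : Away 𝒜 f →+* ℂ)
    (hx : ⊤ ≤ (Spec.map (CommRingCat.ofHom χ) ≫ Proj.awayι 𝒜 f hf hd : SpecC ⟶ _) ⁻¹ᵁ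
      Proj.basicOpen 𝒜 f) (a : Away 𝒜 f) :
    evalAt (Spec.map (CommRingCat.ofHom χ) ≫ Proj.awayι 𝒜 f hf hd) _ hx
      (Proj.awayToSection 𝒜 f a) = χ a := by
  have h := specMap_evalAt_fromSpec _ (Proj.isAffineOpen_basicOpen 𝒜 f hf hd) hx
  rw [← awayι_eq_fromSpec 𝒜 hf hd, ← Category.assoc, cancel_mono, ← Spec.map_comp] at h
  exact congrArg (fun g => g.hom a) (Spec.map_injective h)

lemma awayToSection_surjective {f : A} {d : ℕ} (hf : f ∈ 𝒜 d) (hd : 0 < d) :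
    Function.Surjective (Proj.awayToSection 𝒜 f) := by
  have : IsIso (Proj.awayToSection 𝒜 f) := by
    rw [← Proj.basicOpenIsoAway_hom 𝒜 f hf hd]
    infer_instance
  exact (ConcreteCategory.bijective_of_isIso (Proj.awayToSection 𝒜 f)).2

/-- The evaluation `a / f ^ n ↦ φ a / (φ f) ^ n` of fractions. -/
def awayEval (φ : A →+* ℂ) (f : A) (hf : φ f ≠ 0) : Away 𝒜 f →+* ℂ :=
  (IsLocalization.Away.lift (S := Localization.Away f) f (g := φ) (isUnit_iff_ne_zero.mpr hf)).comp
    (algebraMap (Away 𝒜 f) (Localization.Away f))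

lemma awayEval_mk (φ : A →+* ℂ) {f : A} (h : φ f ≠ 0) {d : ℕ} (hf : f ∈ 𝒜 d) (n : ℕ) (a : A)
    (ha : a ∈ 𝒜 (n • d)) : awayEval 𝒜 φ f h (Away.mk 𝒜 hf n a ha) = φ a / φ f ^ n := by
  rw [eq_div_iff (pow_ne_zero _ h)]
  change IsLocalization.Away.lift (S := Localization.Away f) f (g := φ)
    (isUnit_iff_ne_zero.mpr h)
    (Localization.mk a ⟨f ^ n, _⟩) * _ = _
  rw [← map_pow, ← IsLocalization.Away.lift_eq (S := Localization.Away f) f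
    (isUnit_iff_ne_zero.mpr h) (f ^ n), ← map_mul, Localization.mk_eq_mk',
    IsLocalization.mk'_spec (Localization.Away f) a ⟨f ^ n, _⟩, IsLocalization.Away.lift_eq]

lemma awayEval_fromZeroRingHom (φ : A →+* ℂ) {f : A} (h : φ f ≠ 0) (a : 𝒜 0) :
    awayEval 𝒜 φ f h (fromZeroRingHom 𝒜 _ a) = φ a := by
  change IsLocalization.Away.lift (S := Localization.Away f) f (g := φ)
    (isUnit_iff_ne_zero.mpr h)
    (Localization.mk (a : A) 1) = _
  rw [Localization.mk_one_eq_algebraMap, IsLocalization.Away.lift_eq]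

lemma awayEval_comp_awayMap (φ : A →+* ℂ) {f g x : A} (hf : φ f ≠ 0) (hx : φ x ≠ 0) {e : ℕ}
    (hg : g ∈ 𝒜 e) (h : x = f * g) {d : ℕ} (hfd : f ∈ 𝒜 d) :
    (awayEval 𝒜 φ x hx).comp (awayMap 𝒜 hg h) = awayEval 𝒜 φ f hf := by
  ext a
  obtain ⟨n, a, ha, rfl⟩ := Away.mk_surjective 𝒜 hfd a
  have hgn : φ g ≠ 0 := by
    rintro h0
    apply hx
    rw [h, map_mul, h0, mul_zero]
  rw [RingHom.comp_apply, awayMap_mk 𝒜 hg h n hfd a ha, awayEval_mk, awayEval_mk, h, map_mul,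
    map_mul, map_pow, mul_pow, mul_div_mul_right _ _ (pow_ne_zero _ hgn)]

/-- The complex point of `Proj` given by a homomorphism `φ` does not depend on the chart. -/
lemma specMap_awayEval_awayι (φ : A →+* ℂ) {f g : A} (hf : φ f ≠ 0) (hg : φ g ≠ 0) {d e : ℕ}
    (hfd : f ∈ 𝒜 d) (hd : 0 < d) (hge : g ∈ 𝒜 e) (he : 0 < e) :
    (Spec.map (CommRingCat.ofHom (awayEval 𝒜 φ f hf)) ≫ Proj.awayι 𝒜 f hfd hd : SpecC ⟶ _) =
      Spec.map (CommRingCat.ofHom (awayEval 𝒜 φ g hg)) ≫ Proj.awayι 𝒜 g hge he := by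
  have hfg : φ (f * g) ≠ 0 := by rw [map_mul]; exact mul_ne_zero hf hg
  rw [← awayEval_comp_awayMap 𝒜 φ hf hfg hge rfl hfd,
    ← awayEval_comp_awayMap 𝒜 φ hg hfg hfd (mul_comm f g) hge, CommRingCat.ofHom_comp,
    CommRingCat.ofHom_comp, Spec.map_comp, Spec.map_comp, Category.assoc, Category.assoc,
    Proj.SpecMap_awayMap_awayι, Proj.SpecMap_awayMap_awayι]
  rfl

lemma mem_basicOpen_specMap_awayEval_iff (φ : A →+* ℂ) {f g : A} (hf : φ f ≠ 0) {d e : ℕ}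
    (hfd : f ∈ 𝒜 d) (hd : 0 < d) (hge : g ∈ 𝒜 e) (he : 0 < e) :
    ⊤ ≤ (Spec.map (CommRingCat.ofHom (awayEval 𝒜 φ f hf)) ≫ Proj.awayι 𝒜 f hfd hd : SpecC ⟶ _) ⁻¹ᵁ
      Proj.basicOpen 𝒜 g ↔ φ g ≠ 0 := by
  constructor
  · intro h h0
    rw [Scheme.Hom.comp_preimage, Proj.awayι_preimage_basicOpen 𝒜 hfd hd hge he] at h
    obtain ⟨p⟩ : Nonempty (PrimeSpectrum ℂ) := inferInstance
    have h1 : awayEval 𝒜 φ f hf (Away.isLocalizationElem hfd hge) ∉ p.asIdeal :=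
      h (trivial : p ∈ (⊤ : SpecC.Opens))
    apply h1
    rw [awayEval_mk, map_pow, h0, zero_pow hd.ne', zero_div]
    exact zero_mem _
  · intro h
    rw [specMap_awayEval_awayι 𝒜 φ hf h hfd hd hge he]
    exact top_le_preimage_awayι 𝒜 hge he _

end Proj

section
open HomogeneousLocalization

lemma evalAt_congr {X : Scheme.{0}} {x y : SpecC ⟶ X} (h : x = y) {U : X.Opens}
    (hx : ⊤ ≤ x ⁻¹ᵁ U) (hy : ⊤ ≤ y ⁻¹ᵁ U) : evalAt x U hx = evalAt y U hy := by
  subst h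
  rfl

section ProjPoint
variable {m : ℕ}

lemma eval_X_ne_zero {v : Fin (m + 1) → ℂ} {i : Fin (m + 1)} (h : v i ≠ 0) :
    MvPolynomial.eval v (MvPolynomial.X i) ≠ 0 := by
  rwa [MvPolynomial.eval_X]

/-- The morphism `Spec ℂ ⟶ ℙ^m` with image `[v_0 : … : v_m]`, written in some chart around it. -/
def projHom (v : Fin (m + 1) → ℂ) (hv : v ≠ 0) : SpecC ⟶ ProjSpace m :=
  Spec.map (CommRingCat.ofHom (awayEval (grading m) (MvPolynomial.eval v)
    (MvPolynomial.X (Function.ne_iff.mp hv).choose)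
      (eval_X_ne_zero (Function.ne_iff.mp hv).choose_spec))) ≫
        Proj.awayι (grading m) _ (X_mem _) one_pos

lemma projHom_str (v : Fin (m + 1) → ℂ) (hv : v ≠ 0) :
    projHom v hv ≫ ProjSpace.str m = 𝟙 SpecC := by
  unfold projHom ProjSpace.str
  rw [Category.assoc, Proj.awayι_toSpecZero_assoc, ← Spec.map_comp, ← Spec.map_comp,
    ← Spec.map_id]
  congr 1
  ext c
  exact (awayEval_fromZeroRingHom (grading m) (MvPolynomial.eval v)
    (eval_X_ne_zero (Function.ne_iff.mp hv).choose_spec) (algebraMap ℂ (grading m 0) c)).trans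
      (MvPolynomial.eval_C c)

/-- The complex point `[v_0 : … : v_m]` of projective space. -/
def projPoint (v : Fin (m + 1) → ℂ) (hv : v ≠ 0) : CPoint (logProj m) where
  hom := projHom v hv
  hom_str := projHom_str v hv

lemma projPoint_hom (v : Fin (m + 1) → ℂ) (hv : v ≠ 0) {h : MvPolynomial (Fin (m + 1)) ℂ} {d : ℕ}
    (hh : h ∈ grading m d) (hd : 0 < d) (h0 : MvPolynomial.eval v h ≠ 0) :
    (projPoint v hv).hom = Spec.map (CommRingCat.ofHom (awayEval (grading m) (MvPolynomial.eval v) h h0)) ≫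
      Proj.awayι (grading m) h hh hd :=
  specMap_awayEval_awayι (grading m) _ _ h0 _ _ hh hd

lemma projPoint_mem_basicOpen_iff (v : Fin (m + 1) → ℂ) (hv : v ≠ 0)
    {h : MvPolynomial (Fin (m + 1)) ℂ} {d : ℕ} (hh : h ∈ grading m d) (hd : 0 < d) :
    ⊤ ≤ (projPoint v hv).hom ⁻¹ᵁ Proj.basicOpen (grading m) h ↔ MvPolynomial.eval v h ≠ 0 :=
  mem_basicOpen_specMap_awayEval_iff (grading m) _ _ _ _ hh hd

lemma projPoint_mem_iff (v : Fin (m + 1) → ℂ) (hv : v ≠ 0) (i : Fin (m + 1)) :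
    ⊤ ≤ (projPoint v hv).hom ⁻¹ᵁ Proj.basicOpen (grading m) (MvPolynomial.X i) ↔ v i ≠ 0 := by
  rw [projPoint_mem_basicOpen_iff v hv (X_mem i) one_pos, MvPolynomial.eval_X]

lemma evalAt_projPoint (v : Fin (m + 1) → ℂ) (hv : v ≠ 0) {h : MvPolynomial (Fin (m + 1)) ℂ} {d : ℕ}
    (hh : h ∈ grading m d) (hd : 0 < d) (n : ℕ) (a : MvPolynomial (Fin (m + 1)) ℂ)
    (ha : a ∈ grading m (n • d))
    (hx : ⊤ ≤ (projPoint v hv).hom ⁻¹ᵁ Proj.basicOpen (grading m) h) :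
    evalAt _ _ hx (Proj.awayToSection (grading m) h (Away.mk (grading m) hh n a ha)) =
      MvPolynomial.eval v a / MvPolynomial.eval v h ^ n := by
  have h0 := (projPoint_mem_basicOpen_iff v hv hh hd).mp hx
  have e := projPoint_hom v hv hh hd h0
  rw [evalAt_congr e hx (by rw [← e]; exact hx)]
  exact (evalAt_specMap_awayι (grading m) hh hd _ _ _).trans (awayEval_mk _ _ _ _ _ _ _)

lemma evalAt_projPoint_coordRatio (v : Fin (m + 1) → ℂ) (hv : v ≠ 0) (i j : Fin (m + 1))
    (hx : ⊤ ≤ (projPoint v hv).hom ⁻¹ᵁ Proj.basicOpen (grading m) (MvPolynomial.X i)) :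
    evalAt _ _ hx (coordRatio m i j) = v j / v i := by
  refine (evalAt_projPoint v hv (X_mem i) one_pos 1 _ _ hx).trans ?_
  rw [MvPolynomial.eval_X, MvPolynomial.eval_X, pow_one]

lemma exists_mem_basicOpen_X (x : ProjSpace m) :
    ∃ i : Fin (m + 1), x ∈ Proj.basicOpen (grading m) (MvPolynomial.X i) := by
  by_contra! h
  refine x.not_irrelevant_le ((HomogeneousIdeal.irrelevant_le _).mpr fun k hk b hb => ?_)
  change b ∈ x.asHomogeneousIdeal.toIdeal
  rw [b.as_sum]
  refine sum_mem fun s hs => ?_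
  have hs0 : s ≠ 0 := by
    rintro rfl
    have h1 := hb (MvPolynomial.mem_support_iff.mp hs)
    simp only [map_zero] at h1
    omega
  obtain ⟨i, hi⟩ := Finsupp.ne_iff.mp hs0
  have hX : (MvPolynomial.X i : MvPolynomial (Fin (m + 1)) ℂ) ∈ x.asHomogeneousIdeal.toIdeal :=
    not_not.mp (h i)
  exact Ideal.mem_of_dvd _ ((MvPolynomial.X_dvd_monomial).mpr (Or.inr hi)) hX

lemma exists_mem_chart (x : CPoint (logProj m)) :
    ∃ i : Fin (m + 1), ⊤ ≤ x.hom ⁻¹ᵁ Proj.basicOpen (grading m) (MvPolynomial.X i) := by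
  obtain ⟨p⟩ : Nonempty SpecC := inferInstance
  obtain ⟨i, hi⟩ := exists_mem_basicOpen_X (x.hom p)
  exact ⟨i, (top_le_preimage_iff x.hom _ p).mpr hi⟩

lemma exists_homogeneous_basicOpen_le {x : ProjSpace m} {U : (ProjSpace m).Opens} (hx : x ∈ U) :
    ∃ (d : ℕ) (h : MvPolynomial (Fin (m + 1)) ℂ), 0 < d ∧ h ∈ grading m d ∧
      x ∈ Proj.basicOpen (grading m) h ∧ Proj.basicOpen (grading m) h ≤ U := by
  obtain ⟨_, ⟨f, rfl⟩, hxf, hfU⟩ :=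
    (Opens.isBasis_iff_nbhd.mp (Proj.isBasis_basicOpen (grading m))) hx
  rw [Proj.basicOpen_eq_iSup_proj] at hxf
  obtain ⟨k, hk⟩ := Opens.mem_iSup.mp hxf
  obtain ⟨i, hi⟩ := exists_mem_basicOpen_X x
  -- the factor `x_i` makes the degree positive
  refine ⟨k + 1, GradedRing.proj (grading m) k f * MvPolynomial.X i, k.succ_pos,
    SetLike.mul_mem_graded (SetLike.coe_mem _) (X_mem i), ?_, ?_⟩
  · rw [Proj.basicOpen_mul]
    exact ⟨hk, hi⟩
  · rw [Proj.basicOpen_mul]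
    refine inf_le_left.trans (le_trans ?_ hfU)
    rw [Proj.basicOpen_eq_iSup_proj (grading m) f]
    exact le_iSup (fun i => Proj.basicOpen (grading m) (GradedRing.proj (grading m) i f)) k

/-- The map `v ↦ [v]` is continuous for the analytic topology: locally in the Zariski topology, a regular
function is a quotient of two homogeneous polynomials. -/
lemma continuous_projPoint {T : Type*} [TopologicalSpace T] {v : T → Fin (m + 1) → ℂ}
    (hc : Continuous v) (hv : ∀ t, v t ≠ 0) : Continuous fun t => projPoint (v t) (hv t) := by
  refine continuous_generateFrom_iff.mpr ?_
  rintro _ ⟨U, r, W, hW, rfl⟩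
  rw [isOpen_iff_mem_nhds]
  rintro t₀ ⟨ht₀, hrW⟩
  obtain ⟨p⟩ : Nonempty SpecC := inferInstance
  obtain ⟨d, h, hd, hh, hxh, hhU⟩ :=
    exists_homogeneous_basicOpen_le ((top_le_preimage_iff _ _ p).mp ht₀)
  have hxh' : ⊤ ≤ (projPoint (v t₀) (hv t₀)).hom ⁻¹ᵁ Proj.basicOpen (grading m) h :=
    (top_le_preimage_iff _ _ p).mpr hxh
  obtain ⟨a', ha'⟩ := awayToSection_surjective (grading m) hh hd
    ((ProjSpace m).presheaf.map (homOfLE hhU).op r)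
  obtain ⟨n, a, ha, rfl⟩ := Away.mk_surjective (grading m) hh a'
  have key : ∀ t (h1 : ⊤ ≤ (projPoint (v t) (hv t)).hom ⁻¹ᵁ Proj.basicOpen (grading m) h)
      (h2 : ⊤ ≤ (projPoint (v t) (hv t)).hom ⁻¹ᵁ U),
      evalAt _ U h2 r = MvPolynomial.eval (v t) a / MvPolynomial.eval (v t) h ^ n := by
    intro t h1 h2
    refine (evalAt_map (X := ProjSpace m) _ hhU h1 h2 r).symm.trans ?_
    rw [← ha']
    exact evalAt_projPoint _ _ hh hd n a ha h1
  have hch : Continuous fun t => MvPolynomial.eval (v t) h := (MvPolynomial.continuous_eval h).comp hc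
  have hca : Continuous fun t => MvPolynomial.eval (v t) a := (MvPolynomial.continuous_eval a).comp hc
  have h0 := (projPoint_mem_basicOpen_iff (v t₀) (hv t₀) hh hd).mp hxh'
  have hcont : ContinuousAt
      (fun t => MvPolynomial.eval (v t) a / MvPolynomial.eval (v t) h ^ n) t₀ :=
    hca.continuousAt.div (hch.continuousAt.pow n) (pow_ne_zero _ h0)
  have hW' := hcont (hW.mem_nhds (by beta_reduce; rw [← key t₀ hxh' ht₀]; exact hrW))
  filter_upwards [hW', hch.continuousAt.eventually_ne h0] with t h1 h2
  have h3 := (projPoint_mem_basicOpen_iff (v t) (hv t) hh hd).mpr h2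
  refine ⟨h3.trans (Scheme.Hom.preimage_mono _ hhU), ?_⟩
  rw [key t h3]
  exact h1

end ProjPoint

end

section
open HomogeneousLocalization

lemma away_val_mk_eq_invSelf_pow_mul {A σ : Type} [CommRing A] [SetLike σ A] [AddSubgroupClass σ A]
    (𝒜 : ℕ → σ) [GradedRing 𝒜] {f : A} {d : ℕ} (hf : f ∈ 𝒜 d) (n : ℕ) (a : A)
    (ha : a ∈ 𝒜 (n • d)) : (Away.mk 𝒜 hf n a ha).val =
      IsLocalization.Away.invSelf (S := Localization.Away f) f ^ n *
        algebraMap A (Localization.Away f) a := by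
  rw [Away.val_mk, Localization.mk_eq_mk', IsLocalization.mk'_eq_iff_eq_mul, mul_right_comm, map_pow,
    ← mul_pow, mul_comm (IsLocalization.Away.invSelf f), IsLocalization.Away.mul_invSelf, one_pow,
    one_mul]

section Taut
variable {m : ℕ}

lemma eval₂_mul_left_of_isHomogeneous {R S σ : Type*} [CommRing R] [CommRing S] (g : R →+* S)
    (u : S) (w : σ → S) {p : MvPolynomial σ R} {n : ℕ} (hp : p.IsHomogeneous n) :
    MvPolynomial.eval₂ g (fun j => u * w j) p = u ^ n * MvPolynomial.eval₂ g w p := by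
  rw [MvPolynomial.eval₂_eq, MvPolynomial.eval₂_eq, Finset.mul_sum]
  refine Finset.sum_congr rfl fun s hs => ?_
  have h1 : ∑ i ∈ s.support, s i = n := by
    have h := hp (MvPolynomial.mem_support_iff.mp hs)
    rw [Finsupp.weight_apply] at h
    simpa [Finsupp.sum] using h
  simp only [mul_pow, Finset.prod_mul_distrib, Finset.prod_pow_eq_pow_sum, h1]
  ring

/-- A ring homomorphism on the fractions `a / x_i ^ n` is determined by its values on the constants and
on the ratios `x_j / x_i`. -/
lemma away_hom_ext {i : Fin (m + 1)}
    {χ ψ : Away (grading m) (MvPolynomial.X i : MvPolynomial (Fin (m + 1)) ℂ) →+* ℂ}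
    (h0 : ∀ c : ℂ, χ (fromZeroRingHom (grading m) _ (algebraMap ℂ _ c)) =
      ψ (fromZeroRingHom (grading m) _ (algebraMap ℂ _ c)))
    (h : ∀ j, χ (Away.mk (grading m) (X_mem i) 1 (MvPolynomial.X j) (by rw [one_smul]; exact X_mem j)) =
      ψ (Away.mk (grading m) (X_mem i) 1 (MvPolynomial.X j) (by rw [one_smul]; exact X_mem j))) :
    χ = ψ := by
  ext a
  obtain ⟨n, a, ha, rfl⟩ := Away.mk_surjective (grading m) (X_mem i) a
  have key : Away.mk (grading m) (X_mem i) n a ha =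
      MvPolynomial.eval₂ ((fromZeroRingHom (grading m) _).comp (algebraMap ℂ (grading m 0)))
        (fun j => Away.mk (grading m) (X_mem i) 1 (MvPolynomial.X j)
          (by rw [one_smul]; exact X_mem j)) a := by
    apply HomogeneousLocalization.val_injective
    let f : MvPolynomial (Fin (m + 1)) ℂ := MvPolynomial.X i
    let α := algebraMap (Away (grading m) f) (Localization.Away f)
    let β := algebraMap (MvPolynomial (Fin (m + 1)) ℂ) (Localization.Away f)
    change _ = α (MvPolynomial.eval₂ _ _ a)
    rw [MvPolynomial.hom_eval₂]
    have hX : (fun j => α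
        (Away.mk (grading m) (X_mem i) 1 (MvPolynomial.X j) (by rw [one_smul]; exact X_mem j))) =
        fun j : Fin (m + 1) => IsLocalization.Away.invSelf (S := Localization.Away f) f *
          β (MvPolynomial.X j) := by
      funext j
      refine (away_val_mk_eq_invSelf_pow_mul (grading m) (X_mem i) 1 _ _).trans ?_
      rw [pow_one]
    have hC : α.comp ((fromZeroRingHom (grading m) _).comp (algebraMap ℂ (grading m 0))) =
        β.comp MvPolynomial.C := by
      ext c
      rfl
    have hn : (a : MvPolynomial (Fin (m + 1)) ℂ).IsHomogeneous n := by
      have := ha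
      rwa [smul_eq_mul, mul_one] at this
    have e1 := MvPolynomial.hom_eval₂ a MvPolynomial.C β MvPolynomial.X
    rw [MvPolynomial.eval₂_eta] at e1
    refine Eq.trans ?_ (congrArg₂ (fun g w => MvPolynomial.eval₂ g w a) hC hX).symm
    rw [eval₂_mul_left_of_isHomogeneous _ _ _ hn]
    refine Eq.trans ?_ (congrArg _ e1)
    exact away_val_mk_eq_invSelf_pow_mul (grading m) (X_mem i) n a ha
  rw [key, MvPolynomial.hom_eval₂, MvPolynomial.hom_eval₂]
  congr 1
  · ext c
    exact h0 c
  · funext j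
    exact h j

/-- A morphism over `Spec ℂ` takes constants to themselves. -/
lemma evalAt_fromZeroRingHom {x : SpecC ⟶ ProjSpace m} (hstr : x ≫ ProjSpace.str m = 𝟙 SpecC)
    {h : MvPolynomial (Fin (m + 1)) ℂ} {d : ℕ} (hh : h ∈ grading m d) (hd : 0 < d)
    (hx : ⊤ ≤ x ⁻¹ᵁ Proj.basicOpen (grading m) h) (c : ℂ) :
    evalAt x _ hx (Proj.awayToSection (grading m) h
      (fromZeroRingHom (grading m) _ (algebraMap ℂ _ c))) = c := by
  have h1 := specMap_evalAt_fromSpec x (Proj.isAffineOpen_basicOpen (grading m) h hh hd) hx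
  have h2 := hstr
  rw [← h1, ← awayι_eq_fromSpec (grading m) hh hd] at h2
  unfold ProjSpace.str at h2
  simp only [Category.assoc] at h2
  rw [Proj.awayι_toSpecZero_assoc, ← Spec.map_comp, ← Spec.map_comp, ← Spec.map_comp,
    ← Spec.map_id] at h2
  exact congrArg (fun g => g.hom c) (Spec.map_injective h2)

lemma CPoint.ext_coordRatio {x y : CPoint (logProj m)} (i : Fin (m + 1))
    (hx : ⊤ ≤ x.hom ⁻¹ᵁ Proj.basicOpen (grading m) (MvPolynomial.X i))
    (hy : ⊤ ≤ y.hom ⁻¹ᵁ Proj.basicOpen (grading m) (MvPolynomial.X i))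
    (h : ∀ j, evalAt x.hom _ hx (coordRatio m i j) = evalAt y.hom _ hy (coordRatio m i j)) :
    x = y := by
  apply CPoint.ext
  refine hom_ext_of_evalAt (X := ProjSpace m)
    (Proj.isAffineOpen_basicOpen (grading m) _ (X_mem i) one_pos) hx hy ?_
  have e : (evalAt x.hom _ hx).comp (Proj.awayToSection (grading m) (MvPolynomial.X i)).hom =
      (evalAt y.hom _ hy).comp (Proj.awayToSection (grading m) (MvPolynomial.X i)).hom :=
    away_hom_ext (fun c => (evalAt_fromZeroRingHom x.hom_str (X_mem i) one_pos hx c).trans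
      (evalAt_fromZeroRingHom y.hom_str (X_mem i) one_pos hy c).symm) h
  ext r
  obtain ⟨a, rfl⟩ := awayToSection_surjective (grading m) (X_mem i) one_pos r
  exact congrArg (fun g => g a) e

lemma exists_eq_projPoint (x : CPoint (logProj m)) : ∃ v hv, x = projPoint v hv := by
  obtain ⟨i, hi⟩ := exists_mem_chart x
  have hii : evalAt x.hom _ hi (coordRatio m i i) = 1 := by
    have : coordRatio m i i = 1 := by
      refine (congrArg (Proj.awayToSection (grading m) (MvPolynomial.X i)) ?_).trans (map_one _)
      apply HomogeneousLocalization.val_injective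
      rw [Away.val_mk, HomogeneousLocalization.val_one]
      refine Eq.trans ?_ (Localization.mk_self (⟨MvPolynomial.X i, Submonoid.mem_powers _⟩ :
        Submonoid.powers (MvPolynomial.X i : MvPolynomial (Fin (m + 1)) ℂ)))
      simp
    exact (congrArg _ this).trans (map_one _)
  have hv : (fun j => evalAt x.hom _ hi (coordRatio m i j)) ≠ 0 :=
    fun h => one_ne_zero (hii.symm.trans (congrFun h i))
  refine ⟨_, hv, ?_⟩
  have hy := (projPoint_mem_iff _ hv i).mpr (by rw [hii]; exact one_ne_zero)
  refine CPoint.ext_coordRatio i hi hy fun j => ?_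
  rw [evalAt_projPoint_coordRatio, hii, div_one]

lemma projPoint_smul (v : Fin (m + 1) → ℂ) (hv : v ≠ 0) (c : ℂ) (hcv : c • v ≠ 0) :
    projPoint (c • v) hcv = projPoint v hv := by
  obtain ⟨i, hi⟩ := Function.ne_iff.mp hcv
  have h : c ≠ 0 ∧ v i ≠ 0 := by
    simpa using hi
  have hx := (projPoint_mem_iff _ hcv i).mpr hi
  have hy := (projPoint_mem_iff _ hv i).mpr h.2
  refine CPoint.ext_coordRatio i hx hy fun j => ?_
  rw [evalAt_projPoint_coordRatio, evalAt_projPoint_coordRatio]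
  exact mul_div_mul_left _ _ h.1

end Taut

end

section
open HomogeneousLocalization

/-! ### The sphere -/

section Sphere
variable {m : ℕ}

/-- The line bundle `𝒪(-1)` with the zero section, which is the log structure of `𝖲_m`. -/
abbrev tautLine (m : ℕ) : LineWithSection (logProj m).X := (logProj m).L (0 : Fin 1)

/-- The total space of `𝒪(-1)`. -/
abbrev TautSpace (m : ℕ) : Type := TotalSpace (tautLine m)

/-- The frame `1 / x_i` of `𝒪(-1)` at a point of `D₊(x_i)`. -/
def invFrame (i : Fin (m + 1)) {x : SpecC ⟶ ProjSpace m}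
    (hi : ⊤ ≤ x ⁻¹ᵁ Proj.basicOpen (grading m) (MvPolynomial.X i)) :
    FrameAt (serreTwist (grading m) (-1)) x :=
  ⟨_, hi, _, invSection_isFrame (grading m) (MvPolynomial.X i) (X_mem i)⟩

lemma fibre_invFrame_eq {x : SpecC ⟶ ProjSpace m} (v : Fibre (serreTwist (grading m) (-1)) x)
    (i k : Fin (m + 1))
    (hi : ⊤ ≤ x ⁻¹ᵁ Proj.basicOpen (grading m) (MvPolynomial.X i))
    (hk : ⊤ ≤ x ⁻¹ᵁ Proj.basicOpen (grading m) (MvPolynomial.X k)) :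
    v.1 (invFrame k hk) = evalAt x _ hi (coordRatio m i k) * v.1 (invFrame i hi) := by
  have hW : ⊤ ≤ x ⁻¹ᵁ (Proj.basicOpen (grading m) (MvPolynomial.X k) ⊓
    Proj.basicOpen (grading m) (MvPolynomial.X i)) := fun _ h => ⟨hk h, hi h⟩
  rw [← evalAt_map x inf_le_right hW hi]
  refine v.2 (invFrame k hk) (invFrame i hi) _ inf_le_left inf_le_right hW _ ?_
  apply Subtype.ext
  funext y
  change invAt (MvPolynomial.X i) y.1 y.2.2 =
    HomogeneousLocalization.val (((coordRatio m i k).1 ⟨y.1, y.2.2⟩)) *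
      invAt (MvPolynomial.X k) y.1 y.2.1
  have h1 : HomogeneousLocalization.val (((coordRatio m i k).1 ⟨y.1, y.2.2⟩)) =
      Localization.mk (MvPolynomial.X k) 1 * invAt (MvPolynomial.X i) y.1 y.2.2 := by
    unfold coordRatio invAt
    refine (HomogeneousLocalization.val_mk _).trans ?_
    rw [Localization.mk_mul]
    congr 1
    exact (mul_one _).symm
  refine Eq.trans ?_ (congrArg (· * invAt (MvPolynomial.X k) y.1 y.2.1) h1).symm
  exact ((mul_right_comm _ _ _).trans ((congrArg (· * _) (mul_invAt _ _ _)).trans (one_mul _))).symm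

lemma fibre_invFrame_projPoint (w : Fin (m + 1) → ℂ) (hw : w ≠ 0)
    (v : Fibre (serreTwist (grading m) (-1)) (projPoint w hw).hom) (i k : Fin (m + 1))
    (hi : ⊤ ≤ (projPoint w hw).hom ⁻¹ᵁ Proj.basicOpen (grading m) (MvPolynomial.X i))
    (hk : ⊤ ≤ (projPoint w hw).hom ⁻¹ᵁ Proj.basicOpen (grading m) (MvPolynomial.X k)) :
    v.1 (invFrame k hk) = w k / w i * v.1 (invFrame i hi) :=
  (fibre_invFrame_eq v i k hi hk).trans
    (congrArg (· * v.1 (invFrame i hi)) (evalAt_projPoint_coordRatio w hw i k hi))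

/-- The index of a standard chart around a complex point. -/
def chartIdx (x : CPoint (logProj m)) : Fin (m + 1) := (exists_mem_chart x).choose

lemma mem_chartIdx (x : CPoint (logProj m)) :
    ⊤ ≤ x.hom ⁻¹ᵁ Proj.basicOpen (grading m) (MvPolynomial.X (chartIdx x)) :=
  (exists_mem_chart x).choose_spec

/-- The linear coordinates of a vector of the tautological line bundle, seen as a vector of `ℂ^{m+1}`. -/
def tautCoord (p : TautSpace m) (j : Fin (m + 1)) : ℂ :=
  p.vec.1 (invFrame _ (mem_chartIdx p.pt)) * evalAt p.pt.hom _ (mem_chartIdx p.pt) (coordRatio m _ j)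

lemma tautCoord_mk (x : CPoint (logProj m)) (v : Fibre (serreTwist (grading m) (-1)) x.hom)
    (i : Fin (m + 1)) (hi : ⊤ ≤ x.hom ⁻¹ᵁ Proj.basicOpen (grading m) (MvPolynomial.X i))
    (j : Fin (m + 1)) :
    tautCoord ⟨x, v⟩ j = v.1 (invFrame i hi) * evalAt x.hom _ hi (coordRatio m i j) := by
  have hk := mem_chartIdx x
  change v.1 (invFrame _ hk) * evalAt x.hom _ hk (coordRatio m (chartIdx x) j) = _
  generalize chartIdx x = k at hk
  obtain ⟨w, hw, rfl⟩ := exists_eq_projPoint x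
  rw [fibre_invFrame_projPoint w hw v i k hi hk, evalAt_projPoint_coordRatio,
    evalAt_projPoint_coordRatio]
  have h3 := (projPoint_mem_iff _ _ _).mp hk
  field_simp

lemma tautCoord_mk_self (x : CPoint (logProj m)) (v : Fibre (serreTwist (grading m) (-1)) x.hom)
    (i : Fin (m + 1)) (hi : ⊤ ≤ x.hom ⁻¹ᵁ Proj.basicOpen (grading m) (MvPolynomial.X i)) :
    tautCoord ⟨x, v⟩ i = v.1 (invFrame i hi) := by
  rw [tautCoord_mk x v i hi]
  obtain ⟨w, hw, rfl⟩ := exists_eq_projPoint x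
  rw [evalAt_projPoint_coordRatio, div_self ((projPoint_mem_iff _ _ _).mp hi), mul_one]

lemma tautCoord_ne_zero (p : TautSpace m) (hp : p.vec ≠ 0) : tautCoord p ≠ 0 := by
  obtain ⟨i, hi⟩ := exists_mem_chart p.pt
  intro h
  exact Fibre.apply_ne_zero (invFrame i hi) hp
    ((tautCoord_mk_self p.pt p.vec i hi).symm.trans (congrFun h i))

lemma tautCoord_smul (x : CPoint (logProj m)) (v : Fibre (tautLine m).sheaf x.hom) (c : ℂ) :
    tautCoord (⟨x, c • v⟩ : TautSpace m) = c • tautCoord (⟨x, v⟩ : TautSpace m) := by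
  funext j
  exact mul_assoc _ _ _

lemma continuous_tautCoord : Continuous (tautCoord : TautSpace m → Fin (m + 1) → ℂ) := by
  refine continuous_pi fun j => continuous_iff_continuousAt.mpr fun p => ?_
  obtain ⟨i, hi⟩ := exists_mem_chart p.pt
  have h1 := continuousAt_coordOrZero (L := tautLine m)
    (invSection_isFrame (grading m) (MvPolynomial.X i) (X_mem i)) hi
  have h2 : ContinuousAt (fun q : TautSpace m =>
      evalOrZero (X := logProj m) _ (coordRatio m i j) q.pt) p :=
    (continuousAt_evalOrZero (X := logProj m) _ (coordRatio m i j) hi).comp continuous_pt.continuousAt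
  refine (h1.mul h2).congr ?_
  filter_upwards [continuous_pt.continuousAt.eventually
    ((isOpen_mem (X := logProj m) (Proj.basicOpen (grading m) (MvPolynomial.X i))).mem_nhds hi)]
    with q hq
  exact (congrArg₂ (· * ·) (coordOrZero_eq (L := tautLine m) _ hq)
    (evalOrZero_eq (X := logProj m) _ hq)).trans (tautCoord_mk q.pt q.vec i hq j).symm

/-- The index of a nonzero coordinate. -/
def pivot (v : Fin (m + 1) → ℂ) (hv : v ≠ 0) : Fin (m + 1) := (Function.ne_iff.mp hv).choose

lemma pivot_spec (v : Fin (m + 1) → ℂ) (hv : v ≠ 0) : v (pivot v hv) ≠ 0 :=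
  (Function.ne_iff.mp hv).choose_spec

/-- The vector `v` of the line spanned by `v`, in the fibre of `𝒪(-1)` at `[v]`. -/
def tautVec (v : Fin (m + 1) → ℂ) (hv : v ≠ 0) :
    Fibre (serreTwist (grading m) (-1)) (projPoint v hv).hom :=
  Fibre.ofFrame (invFrame (pivot v hv) ((projPoint_mem_iff v hv _).mpr (pivot_spec v hv)))
    (v (pivot v hv))

lemma tautVec_apply (v : Fin (m + 1) → ℂ) (hv : v ≠ 0) (i : Fin (m + 1))
    (hi : ⊤ ≤ (projPoint v hv).hom ⁻¹ᵁ Proj.basicOpen (grading m) (MvPolynomial.X i)) :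
    (tautVec v hv).1 (invFrame i hi) = v i := by
  refine (fibre_invFrame_projPoint v hv _ (pivot v hv) i
    ((projPoint_mem_iff v hv _).mpr (pivot_spec v hv)) hi).trans ?_
  exact (congrArg _ (Fibre.ofFrame_apply _ _)).trans (div_mul_cancel₀ _ (pivot_spec v hv))

/-- The vector `v` of the line spanned by `v`, as a point of the total space of `𝒪(-1)`. -/
def tautPoint (v : Fin (m + 1) → ℂ) (hv : v ≠ 0) : TautSpace m := ⟨projPoint v hv, tautVec v hv⟩

lemma tautCoord_tautPoint (v : Fin (m + 1) → ℂ) (hv : v ≠ 0) : tautCoord (tautPoint v hv) = v := by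
  obtain ⟨i, hi⟩ := Function.ne_iff.mp hv
  have h := (projPoint_mem_iff v hv i).mpr hi
  funext j
  refine (tautCoord_mk _ _ i h j).trans ?_
  rw [tautVec_apply, evalAt_projPoint_coordRatio]
  exact mul_div_cancel₀ _ hi

lemma exists_eq_tautPoint (p : TautSpace m) (hp : p.vec ≠ 0) : ∃ v hv, p = tautPoint v hv := by
  obtain ⟨x, v⟩ := p
  obtain ⟨w, hw, rfl⟩ := exists_eq_projPoint x
  obtain ⟨i, hi⟩ := Function.ne_iff.mp hw
  have h := (projPoint_mem_iff w hw i).mpr hi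
  let z : ℂ := v.1 (invFrame i h)
  have hz : z / w i ≠ 0 := div_ne_zero (Fibre.apply_ne_zero (invFrame i h) hp) hi
  have hzw : (z / w i) • w ≠ 0 := smul_ne_zero hz hw
  refine ⟨(z / w i) • w, hzw, ?_⟩
  have key : ∀ (y : CPoint (logProj m)) (_ : y = projPoint w hw)
      (u : Fibre (serreTwist (grading m) (-1)) y.hom)
      (hy : ⊤ ≤ y.hom ⁻¹ᵁ Proj.basicOpen (grading m) (MvPolynomial.X i)),
      u.1 (invFrame i hy) = z → (⟨projPoint w hw, v⟩ : TautSpace m) = ⟨y, u⟩ := by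
    rintro _ rfl u hy hu
    congr 1
    exact Fibre.ext_frame (invFrame i hy) hu.symm
  have hwi : ((z / w i) • w) i = z := div_mul_cancel₀ z hi
  have hne : ((z / w i) • w) i ≠ 0 := smul_ne_zero hz hi
  have hy := (projPoint_mem_iff _ hzw i).mpr hne
  exact key _ (projPoint_smul w hw _ hzw) (tautVec _ hzw) hy ((tautVec_apply _ hzw i hy).trans hwi)

lemma tautCoord_injective {p q : TautSpace m} (hp : p.vec ≠ 0) (hq : q.vec ≠ 0)
    (h : tautCoord p = tautCoord q) : p = q := by
  obtain ⟨v, hv, rfl⟩ := exists_eq_tautPoint p hp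
  obtain ⟨w, hw, rfl⟩ := exists_eq_tautPoint q hq
  rw [tautCoord_tautPoint, tautCoord_tautPoint] at h
  subst h
  rfl

lemma continuous_tautPoint {T : Type*} [TopologicalSpace T] {v : T → Fin (m + 1) → ℂ}
    (hc : Continuous v) (hv : ∀ t, v t ≠ 0) : Continuous fun t => tautPoint (v t) (hv t) := by
  refine continuous_totalSpace_of_frame (L := tautLine m) (continuous_projPoint hc hv) fun t₀ => ?_
  obtain ⟨i, hi⟩ := Function.ne_iff.mp (hv t₀)
  have h := (projPoint_mem_iff _ (hv t₀) i).mpr hi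
  refine ⟨_, _, invSection_isFrame (grading m) (MvPolynomial.X i) (X_mem i), h, ?_⟩
  have hi' : Continuous fun t => v t i := (continuous_apply i).comp hc
  refine hi'.continuousAt.congr ?_
  filter_upwards [hi'.continuousAt.eventually_ne hi] with t ht
  have h' := (projPoint_mem_iff _ (hv t) i).mpr ht
  exact ((coordOrZero_eq (L := tautLine m) (p := tautPoint (v t) (hv t)) _ h').trans
    (tautVec_apply _ _ i h')).symm

end Sphere

end

section Sphere
variable {m k : ℕ}

/-- The vector of `ℝ^{2k} = ℂ^k` with given complex coordinates. -/
def ofComplexCoord (w : Fin k → ℂ) : EuclideanSpace ℝ (Fin 2 × Fin k) :=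
  WithLp.toLp 2 fun a => if a.1 = 0 then (w a.2).re else (w a.2).im

lemma complexCoord_ofComplexCoord (w : Fin k → ℂ) : complexCoord (ofComplexCoord w) = w := by
  funext j
  apply Complex.ext <;> simp [complexCoord, ofComplexCoord]

lemma ofComplexCoord_complexCoord (v : EuclideanSpace ℝ (Fin 2 × Fin k)) :
    ofComplexCoord (complexCoord v) = v := by
  ext ⟨a, j⟩
  fin_cases a <;> simp [complexCoord, ofComplexCoord]

lemma complexCoord_injective :
    Function.Injective (complexCoord : EuclideanSpace ℝ (Fin 2 × Fin k) → Fin k → ℂ) :=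
  Function.LeftInverse.injective ofComplexCoord_complexCoord

lemma complexCoord_smul (c : ℝ) (v : EuclideanSpace ℝ (Fin 2 × Fin k)) (j : Fin k) :
    complexCoord (c • v) j = c * complexCoord v j := by
  apply Complex.ext <;> simp [complexCoord]

lemma ofComplexCoord_smul (c : ℝ) (w : Fin k → ℂ) :
    ofComplexCoord ((c : ℂ) • w) = c • ofComplexCoord w := by
  apply complexCoord_injective
  funext j
  rw [complexCoord_smul, complexCoord_ofComplexCoord, complexCoord_ofComplexCoord]
  rfl

lemma continuous_ofComplexCoord :
    Continuous (ofComplexCoord : (Fin k → ℂ) → EuclideanSpace ℝ (Fin 2 × Fin k)) := by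
  refine (PiLp.continuous_toLp 2 _).comp (continuous_pi fun a => ?_)
  by_cases h : a.1 = 0
  · simp only [h, if_true]
    exact Complex.continuous_re.comp (continuous_apply _)
  · simp only [h, if_false]
    exact Complex.continuous_im.comp (continuous_apply _)

lemma continuous_complexCoord :
    Continuous (complexCoord : EuclideanSpace ℝ (Fin 2 × Fin k) → Fin k → ℂ) := by
  refine continuous_pi fun j => ?_
  have h : ∀ v : EuclideanSpace ℝ (Fin 2 × Fin k),
      complexCoord v j = (v (0, j) : ℂ) + (v (1, j) : ℂ) * Complex.I := fun v => by
    apply Complex.ext <;> simp [complexCoord]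
  simp only [h]
  fun_prop

lemma complexCoord_zero : complexCoord (0 : EuclideanSpace ℝ (Fin 2 × Fin k)) = 0 := by
  funext j
  rfl

lemma complexCoord_ne_zero (s : UnitSphere k) : complexCoord s.1 ≠ 0 := by
  intro h
  refine ne_zero_of_mem_unit_sphere s (complexCoord_injective ?_)
  rw [h, complexCoord_zero]

lemma tautCoord_ofReal_smul (x : CPoint (logProj m)) (v : Fibre (tautLine m).sheaf x.hom) (c : ℝ) :
    ofComplexCoord (tautCoord (⟨x, (c : ℂ) • v⟩ : TautSpace m)) =
      c • ofComplexCoord (tautCoord (⟨x, v⟩ : TautSpace m)) := by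
  rw [tautCoord_smul, ofComplexCoord_smul]

lemma logProj_index_eq (i : Fin (logProj m).n) : i = (0 : Fin 1) :=
  Subsingleton.elim (α := Fin 1) i 0

/-- The homeomorphism of the real oriented blow-up of `ℙ^m(ℂ)` in `(𝒪(-1), 0)` with the sphere. -/
def tautBlowupHomeo (m : ℕ) : RealBlowup (tautLine m) ≃ₜ UnitSphere (m + 1) :=
  blowupHomeoSphere (L := tautLine m) rfl (fun p => ofComplexCoord (tautCoord p))
    (continuous_ofComplexCoord.comp continuous_tautCoord) tautCoord_ofReal_smul
    (fun p hp h => tautCoord_ne_zero p hp (by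
      rw [← complexCoord_ofComplexCoord (tautCoord p), h, complexCoord_zero]))
    (fun p q hp hq h => tautCoord_injective hp hq (by
      rw [← complexCoord_ofComplexCoord (tautCoord p), h, complexCoord_ofComplexCoord]))
    (fun s => tautPoint (complexCoord s.1) (complexCoord_ne_zero s))
    (continuous_tautPoint (continuous_complexCoord.comp continuous_subtype_val) _)
    (fun s => by rw [tautCoord_tautPoint, ofComplexCoord_complexCoord])

lemma tautBlowupHomeo_ray (p : BlowupVector (tautLine m)) : (tautBlowupHomeo m p.ray).1 =
    ‖ofComplexCoord (tautCoord p.1)‖⁻¹ • ofComplexCoord (tautCoord p.1) :=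
  blowupHomeoSphere_ray (L := tautLine m) _ _ _ _ _ _ _ p

/-- The homeomorphism of the Kato--Nakayama space of `𝖲_m` with the sphere `S^{2m+1}`. -/
def sphereHomeo (m : ℕ) : KN (logProj m) ≃ₜ UnitSphere (m + 1) :=
  (knHomeoBlowup (logProj m) (0 : Fin 1) logProj_index_eq).trans (tautBlowupHomeo m)

lemma sphereHomeo_apply (P : KN (logProj m)) :
    sphereHomeo m P = tautBlowupHomeo m (P.ray (0 : Fin 1)) := rfl

lemma exists_complexCoord_sphereHomeo (P : KN (logProj m)) (p : BlowupVector (tautLine m))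
    (h : p.ray = P.ray (0 : Fin 1)) :
    ∃ c : ℝ, 0 < c ∧ complexCoord (sphereHomeo m P).1 = (c : ℂ) • tautCoord p.1 := by
  have hp : tautCoord p.1 ≠ 0 := tautCoord_ne_zero p.1 p.2.1
  refine ⟨‖ofComplexCoord (tautCoord p.1)‖⁻¹, inv_pos.mpr (norm_pos_iff.mpr fun h0 => hp ?_), ?_⟩
  · rw [← complexCoord_ofComplexCoord (tautCoord p.1), h0, complexCoord_zero]
  · rw [sphereHomeo_apply P, ← h, tautBlowupHomeo_ray]
    funext j
    rw [complexCoord_smul, complexCoord_ofComplexCoord]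
    rfl

lemma sphereHomeo_isStandardSphere (m : ℕ) : IsStandardSphere (sphereHomeo m) := by
  intro P p h
  obtain ⟨c, hc, hcoord⟩ := exists_complexCoord_sphereHomeo P p h
  refine ⟨c, hc, fun i hi j => ?_⟩
  rw [hcoord]
  exact congrArg ((c : ℂ) * ·) (tautCoord_mk p.1.pt p.1.vec i hi j)

end Sphere

/-! ### The circle -/

section Circle

/-- The line bundle `𝒪` on the point with the zero section, which is the log structure of `𝖲_0`. -/
abbrev pointLine : LineWithSection logPoint.X := logPoint.L (0 : Fin 1)

/-- The frame `1` of `𝒪` on the point. -/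
def oneFrame (x : SpecC ⟶ SpecC) : FrameAt (structureModule SpecC) x :=
  ⟨⊤, fun _ _ => trivial, (1 : Γ(SpecC, ⊤)), isFrame_one SpecC⟩

lemma cpoint_logPoint_hom (x : CPoint logPoint) : x.hom = 𝟙 SpecC :=
  (Category.comp_id x.hom).symm.trans x.hom_str

instance : Subsingleton (CPoint logPoint) :=
  ⟨fun x y => CPoint.ext ((cpoint_logPoint_hom x).trans (cpoint_logPoint_hom y).symm)⟩

/-- The unique complex point of `Spec ℂ`. -/
def pointOfSpecC : CPoint logPoint := ⟨𝟙 SpecC, Category.comp_id _⟩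

/-- The complex number which is a given vector of the fibre of `𝒪` on the point. -/
def pointCoord (p : TotalSpace pointLine) : ℂ := p.vec.1 (oneFrame p.pt.hom)

lemma continuous_pointCoord : Continuous pointCoord := by
  refine continuous_iff_continuousAt.mpr fun p => ?_
  have h : ∀ q : TotalSpace pointLine, ⊤ ≤ q.pt.hom ⁻¹ᵁ (⊤ : SpecC.Opens) := fun _ _ _ => trivial
  refine (continuousAt_coordOrZero (L := pointLine) (isFrame_one SpecC) (h p)).congr ?_
  exact Filter.Eventually.of_forall fun q => coordOrZero_eq (L := pointLine) (isFrame_one SpecC) (h q)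

/-- The vector of the fibre of `𝒪` on the point which is a given complex number. -/
def pointVec (z : ℂ) : TotalSpace pointLine :=
  ⟨pointOfSpecC, Fibre.ofFrame (oneFrame (𝟙 SpecC)) z⟩

lemma pointCoord_pointVec (z : ℂ) : pointCoord (pointVec z) = z :=
  Fibre.ofFrame_apply (oneFrame (𝟙 SpecC)) z

lemma pointCoord_injective : Function.Injective pointCoord := by
  rintro ⟨x, v⟩ ⟨y, w⟩ h
  obtain rfl := Subsingleton.elim x y
  congr 1
  exact Fibre.ext_frame (oneFrame x.hom) h

lemma continuous_pointVec : Continuous pointVec := by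
  refine continuous_totalSpace_of_frame (L := pointLine) continuous_const fun z => ?_
  refine ⟨⊤, _, isFrame_one SpecC, fun _ _ => trivial, continuousAt_id.congr ?_⟩
  exact Filter.Eventually.of_forall fun w => ((coordOrZero_eq (L := pointLine) (p := pointVec w)
    (isFrame_one SpecC) (fun _ _ => trivial)).trans (pointCoord_pointVec w)).symm

/-- The unit sphere of `ℂ` is the circle group. -/
def sphereHomeoCircle : Metric.sphere (0 : ℂ) 1 ≃ₜ Circle where
  toFun z := ⟨z.1, z.2⟩
  invFun z := ⟨z.1, z.2⟩
  left_inv _ := rfl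
  right_inv _ := rfl
  continuous_toFun := continuous_induced_rng.mpr continuous_subtype_val
  continuous_invFun := continuous_induced_rng.mpr continuous_subtype_val

/-- The homeomorphism of the real oriented blow-up of the point in `(𝒪, 0)` with the circle. -/
def pointBlowupHomeo : RealBlowup pointLine ≃ₜ Metric.sphere (0 : ℂ) 1 :=
  blowupHomeoSphere (L := pointLine) rfl pointCoord continuous_pointCoord (fun _ _ _ => rfl)
    (fun p hp => Fibre.apply_ne_zero (oneFrame p.pt.hom) hp)
    (fun _ _ _ _ h => pointCoord_injective h)
    (fun s => pointVec s.1) (continuous_pointVec.comp continuous_subtype_val)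
    (fun s => pointCoord_pointVec s.1)

lemma pointBlowupHomeo_ray (p : BlowupVector pointLine) :
    (pointBlowupHomeo p.ray).1 = ‖pointCoord p.1‖⁻¹ • pointCoord p.1 :=
  blowupHomeoSphere_ray (L := pointLine) _ _ _ _ _ _ _ p

/-- The homeomorphism of the Kato--Nakayama space of `𝖲_0` with the circle. -/
def circleHomeo : KN logPoint ≃ₜ Circle :=
  ((knHomeoBlowup logPoint (0 : Fin 1) fun i => Subsingleton.elim (α := Fin 1) i 0).trans
    pointBlowupHomeo).trans sphereHomeoCircle

lemma coe_circleHomeo (P : KN logPoint) :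
    (circleHomeo P : ℂ) = (pointBlowupHomeo (P.ray (0 : Fin 1))).1 := rfl

lemma exists_circleHomeo (P : KN logPoint) (p : BlowupVector pointLine)
    (h : p.ray = P.ray (0 : Fin 1)) :
    ∃ c : ℝ, 0 < c ∧ (circleHomeo P : ℂ) = c * pointCoord p.1 := by
  have hp : pointCoord p.1 ≠ 0 := Fibre.apply_ne_zero (oneFrame p.1.pt.hom) p.2.1
  refine ⟨‖pointCoord p.1‖⁻¹, inv_pos.mpr (norm_pos_iff.mpr hp), ?_⟩
  rw [coe_circleHomeo, ← h, pointBlowupHomeo_ray, Complex.real_smul]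

lemma circleHomeo_isStandardCircle : IsStandardCircle circleHomeo := exists_circleHomeo

end Circle

/-! ### Frames of inverse images -/

section Pullback
variable {X Y : Scheme.{0}} (f : X ⟶ Y)

lemma pullbackSection_map (M : Y.Modules) {U V : Y.Opens} (h : V ≤ U) (e : Γ(M, U)) :
    pullbackSection f M V (M.presheaf.map (homOfLE h).op e) =
      ((Scheme.Modules.pullback f).obj M).presheaf.map
        (homOfLE (Scheme.Hom.preimage_mono f h)).op (pullbackSection f M U e) :=
  ConcreteCategory.congr_hom ((((Scheme.Modules.pullbackPushforwardAdjunction f).unit.app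
    M).mapPresheaf).naturality (homOfLE h).op) e

lemma pullbackSection_smul (M : Y.Modules) (U : Y.Opens) (r : Γ(Y, U)) (e : Γ(M, U)) :
    pullbackSection f M U (r • e) = f.app U r • pullbackSection f M U e :=
  Scheme.Modules.Hom.app_smul ((Scheme.Modules.pullbackPushforwardAdjunction f).unit.app M) r e

/-- Along an isomorphism of schemes, inverse image identifies the sections. -/
lemma pullbackSection_bijective [IsIso f] (M : Y.Modules) (U : Y.Opens) :
    Function.Bijective (pullbackSection f M U) := by
  -- `f^*` is the restriction along the open immersion `f`, by uniqueness of left adjoints, and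
  -- the unit of that adjunction is given by restriction of sections to `f (f⁻¹ U) = U`
  have h1 : IsIso (((Scheme.Modules.restrictAdjunction f).unit.app M).app U) := by
    rw [Scheme.Modules.restrictAdjunction_unit_app_app]
    have h : f ''ᵁ (f ⁻¹ᵁ U) = U := by
      rw [Scheme.Hom.image_preimage_eq_opensRange_inf, Scheme.Hom.opensRange_of_isIso, top_inf_eq]
    have h' : IsIso (homOfLE (f.image_preimage_le U)).op := ⟨(homOfLE h.ge).op, rfl, rfl⟩
    exact @Functor.map_isIso _ _ _ _ _ _ M.presheaf _ h'
  have h2 := (Scheme.Modules.restrictAdjunction f).unit_leftAdjointUniq_hom_app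
    (Scheme.Modules.pullbackPushforwardAdjunction f) M
  have h3 : IsIso (((Scheme.Modules.pullbackPushforwardAdjunction f).unit.app M).app U) := by
    rw [← h2, Scheme.Modules.Hom.comp_app, Scheme.Modules.pushforward_map_app]
    have h4 : IsIso (((Scheme.Modules.restrictAdjunction f).leftAdjointUniq
        (Scheme.Modules.pullbackPushforwardAdjunction f)).hom.app M) := inferInstance
    exact @IsIso.comp_isIso _ _ _ _ _ _ _ h1 (Scheme.Modules.Hom.isIso_iff_isIso_app.mp h4 _)
  exact ConcreteCategory.bijective_of_isIso
    (((Scheme.Modules.pullbackPushforwardAdjunction f).unit.app M).app U)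

/-- Along an isomorphism of schemes, frames pull back to frames. -/
lemma IsFrame.pullback_of_isIso [IsIso f] {M : Y.Modules} {U : Y.Opens} {e : Γ(M, U)}
    (he : IsFrame M U e) :
    IsFrame ((Scheme.Modules.pullback f).obj M) (f ⁻¹ᵁ U) (pullbackSection f M U e) := by
  intro W hW
  obtain ⟨V, rfl⟩ : ∃ V : Y.Opens, W = f ⁻¹ᵁ V := ⟨f ''ᵁ W, (f.preimage_image_eq W).symm⟩
  have hVU : V ≤ U := by
    intro y hy
    obtain ⟨x, rfl⟩ := f.homeomorph.surjective y
    exact hW hy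
  have hb : Function.Bijective (f.app V) := ConcreteCategory.bijective_of_isIso _
  have h := (pullbackSection_bijective f M V).comp (he V hVU)
  rw [← Function.Bijective.of_comp_iff _ hb]
  convert! h using 1
  funext r
  change f.app V r • _ = pullbackSection f M V (r • M.presheaf.map (homOfLE hVU).op e)
  rw [pullbackSection_smul, pullbackSection_map]

lemma pullbackUnitIso_hom_app_pullbackSection (U : Y.Opens) (s : Γ(Y, U)) :
    (pullbackUnitIso f).hom.app (f ⁻¹ᵁ U) (pullbackSection f (structureModule Y) U s) =
      (f.app U s : Γ(X, f ⁻¹ᵁ U)) := by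
  have : (Opens.map f.base).Final := opensMap_final f
  have : (SheafOfModules.pushforward.{0} f.toRingCatSheafHom).IsRightAdjoint :=
    (Scheme.Modules.pullbackPushforwardAdjunction f).isRightAdjoint
  have h := SheafOfModules.pullbackPushforwardAdjunction_homEquiv_pullbackObjUnitToUnit
    (f.toRingCatSheafHom)
  rw [Adjunction.homEquiv_unit] at h
  exact congrArg (fun g => (g.val.app (.op U)).hom s) h

lemma IsFrame.of_iso {M N : X.Modules} (φ : M ≅ N) {U : X.Opens} {e : Γ(M, U)}
    (he : IsFrame N U (φ.hom.app U e)) : IsFrame M U e := by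
  intro V hV
  have h1 : Function.Bijective (φ.hom.app V) := ConcreteCategory.bijective_of_isIso _
  rw [← Function.Bijective.of_comp_iff' h1]
  convert! he V hV using 1
  funext r
  have h2 := ConcreteCategory.congr_hom (φ.hom.mapPresheaf.naturality (homOfLE hV).op) e
  refine (Scheme.Modules.Hom.app_smul φ.hom r _).trans ?_
  exact congrArg (r • ·) h2

lemma isFrame_structureModule_iff {U : X.Opens} {s : Γ(X, U)} :
    IsFrame (structureModule X) U s ↔ IsUnit s := by
  constructor
  · intro h
    obtain ⟨r, hr⟩ := (h U le_rfl).2 (1 : Γ(X, U))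
    have h1 : r * X.presheaf.map (homOfLE (le_refl U)).op s = 1 := hr
    have h2 : (homOfLE (le_refl U)).op = 𝟙 _ := rfl
    rw [h2, CategoryTheory.Functor.map_id] at h1
    exact IsUnit.of_mul_eq_one_right r h1
  · intro h V hV
    have h1 : IsUnit (X.presheaf.map (homOfLE hV).op s) := h.map (X.presheaf.map (homOfLE hV).op).hom
    exact h1.unit.mulRight_bijective

/-- Frames of the structure sheaf pull back to frames. -/
lemma IsFrame.pullback_structureModule {U : Y.Opens} {s : Γ(structureModule Y, U)}
    (hs : IsFrame (structureModule Y) U s) :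
    IsFrame ((Scheme.Modules.pullback f).obj (structureModule Y)) (f ⁻¹ᵁ U)
      (pullbackSection f (structureModule Y) U s) := by
  refine IsFrame.of_iso (pullbackUnitIso f) ?_
  have h := isFrame_structureModule_iff.mpr ((isFrame_structureModule_iff.mp hs).map (f.app U).hom)
  exact (congrArg (IsFrame (structureModule X) (f ⁻¹ᵁ U))
    (pullbackUnitIso_hom_app_pullbackSection f U s)).mpr h

end Pullback

/-! ### Tensor products of sections -/

lemma adjunction_unit_comp_map {C D : Type*} [Category C] [Category D] {F : C ⥤ D} {G : D ⥤ C}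
    (A : F ⊣ G) {X : C} {Y : D} (α : X ⟶ G.obj Y) :
    A.unit.app X ≫ G.map (F.map α ≫ A.counit.app Y) = α := by
  simp

section Tensor
variable {X : Scheme.{0}}

/-- The section of the sheafification defined by a section of the presheaf. -/
def toSheafify (P : PreModules X) (U : X.Opens) (t : P.obj (.op U)) : Γ((sheafify X).obj P, U) :=
  (((PresheafOfModules.sheafificationAdjunction (𝟙 X.ringCatSheaf.obj)).unit.app P).app (.op U)
    : _ → Γ((sheafify X).obj P, U)) t

/-- A morphism from a presheaf to a sheaf has the same values on sections of the presheaf after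
sheafification. -/
lemma sheafify_map_toSheafify {P : PreModules X} {N : X.Modules} (α : P ⟶ toPre N) (U : X.Opens)
    (t : P.obj (.op U)) :
    ((sheafify X).map α ≫ (sheafifyIso N).hom).app U (toSheafify P U t) =
      (α.app (.op U) t : toPre N |>.obj (.op U)) := by
  have h := adjunction_unit_comp_map
    (PresheafOfModules.sheafificationAdjunction (𝟙 X.ringCatSheaf.obj)) (Y := N) α
  exact congrArg (fun g => (g.app (.op U)).hom t) h

lemma tensorFstIso_hom_app_tensorSection (L : Fin 2 → X.Modules) (U : X.Opens)
    (l : ∀ j, Γ(L j, U)) :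
    (tensorFstIso L).hom.app U (tensorSection L ![1, 0] U l) = l 0 := by
  refine (sheafify_map_toSheafify (preTensorFstIso L).hom U _).trans ?_
  change ((1 : Γ(X, U)) • (1 : Γ(X, U))) • ((1 : Γ(X, U)) • l 0) = l 0
  rw [smul_eq_mul, one_mul, one_smul, one_smul]

lemma tensorSndIso_hom_app_tensorSection (L : Fin 2 → X.Modules) (U : X.Opens)
    (l : ∀ j, Γ(L j, U)) :
    (tensorSndIso L).hom.app U (tensorSection L ![0, 1] U l) = l 1 := by
  refine (sheafify_map_toSheafify (preTensorSndIso L).hom U _).trans ?_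
  change (1 : Γ(X, U)) • ((1 : Γ(X, U)) • ((1 : Γ(X, U)) • l 1)) = l 1
  rw [one_smul, one_smul, one_smul]

lemma tensorMulIso_hom_app_tensorSection (L : Fin 2 → X.Modules) (a : L 0 ≅ structureModule X)
    (U : X.Opens) (l : ∀ j, Γ(L j, U)) :
    (tensorMulIso L a).hom.app U (tensorSection L ![1, 1] U l) =
      (show Γ(X, U) from a.hom.app U (l 0)) • l 1 := by
  refine (sheafify_map_toSheafify (preTensorMulIso L a).hom U _).trans ?_
  change (show Γ(X, U) from a.hom.app U ((1 : Γ(X, U)) • l 0)) • ((1 : Γ(X, U)) • ((1 : Γ(X, U)) • l 1)) = _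
  rw [one_smul, one_smul, one_smul]

end Tensor

/-! ### Fibres of inverse images -/

/-- The map on complex points induced by a morphism of schemes over `ℂ`. -/
def CPoint.map {X Y : LogScheme} (f : X.X ⟶ Y.X) (hf : f ≫ Y.str = X.str) (x : CPoint X) :
    CPoint Y :=
  ⟨x.hom ≫ f, by rw [Category.assoc, hf, x.hom_str]⟩

lemma CPoint.continuous_map {X Y : LogScheme} (f : X.X ⟶ Y.X) (hf : f ≫ Y.str = X.str) :
    Continuous (CPoint.map f hf) := by
  refine continuous_generateFrom_iff.mpr ?_
  rintro _ ⟨U, r, W, hW, rfl⟩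
  convert! isOpen_evalAt (f ⁻¹ᵁ U) (f.app U r) hW using 1

/-- The frames of `M` pull back to frames of `f^* M`. -/
def PullsBackFrames {X Y : Scheme.{0}} (f : X ⟶ Y) (M : Y.Modules) : Prop :=
  ∀ ⦃U : Y.Opens⦄ ⦃e : Γ(M, U)⦄, IsFrame M U e →
    IsFrame ((Scheme.Modules.pullback f).obj M) (f ⁻¹ᵁ U) (pullbackSection f M U e)

section Fibre
variable {X Y : Scheme.{0}} {f : X ⟶ Y} {M : Y.Modules} (hf : PullsBackFrames f M)

/-- The inverse image of a frame. -/
def FrameAt.pullback {x : SpecC ⟶ X} (b : FrameAt M (x ≫ f)) :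
    FrameAt ((Scheme.Modules.pullback f).obj M) x :=
  ⟨f ⁻¹ᵁ b.U, b.mem, pullbackSection f M b.U b.e, hf b.isFrame⟩

/-- The identification of the fibre of `f^* M` at `x` with the fibre of `M` at `f(x)`: the coordinate
in a frame `b` is the coordinate in `f^* b`. -/
def Fibre.push (x : SpecC ⟶ X) : Fibre ((Scheme.Modules.pullback f).obj M) x →ₗ[ℂ] Fibre M (x ≫ f) where
  toFun v := ⟨fun b => v.1 (b.pullback hf), by
    intro a b W ha hb hx r h
    have h1 := v.2 (a.pullback hf) (b.pullback hf) (f ⁻¹ᵁ W) (f.preimage_mono ha)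
      (f.preimage_mono hb) hx (f.app W r) (by
        have h2 := congrArg (pullbackSection f M W) h
        rw [pullbackSection_smul, pullbackSection_map, pullbackSection_map] at h2
        exact h2)
    rw [evalAt_comp x f W hx hx r]
    exact h1⟩
  map_add' _ _ := rfl
  map_smul' _ _ := rfl

lemma Fibre.push_apply {x : SpecC ⟶ X} (v : Fibre ((Scheme.Modules.pullback f).obj M) x)
    (b : FrameAt M (x ≫ f)) : (Fibre.push hf x v).1 b = v.1 (b.pullback hf) := rfl

lemma Fibre.push_injective (x : SpecC ⟶ X) (b : FrameAt M (x ≫ f)) :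
    Function.Injective (Fibre.push hf x) := fun _ _ h =>
  Fibre.ext_frame (b.pullback hf) (congrFun (congrArg Subtype.val h) b)

lemma Fibre.push_surjective (x : SpecC ⟶ X) (b : FrameAt M (x ≫ f)) :
    Function.Surjective (Fibre.push hf x) := by
  intro w
  refine ⟨Fibre.ofFrame (b.pullback hf) (w.1 b), Fibre.ext_frame b ?_⟩
  rw [Fibre.push_apply]
  exact Fibre.ofFrame_apply (b.pullback hf) (w.1 b)

end Fibre

section TotalSpace
variable {X Y : LogScheme} {f : X.X ⟶ Y.X} (hf : f ≫ Y.str = X.str) {L : LineWithSection Y.X}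
  (hL : PullsBackFrames f L.sheaf)

/-- The map from the total space of `f^* L` to the total space of `L`. -/
def TotalSpace.push (p : TotalSpace (X := X) (L.pullback f)) : TotalSpace (X := Y) L :=
  ⟨p.pt.map f hf, Fibre.push hL p.pt.hom p.vec⟩

lemma coordOrZero_push {U : Y.X.Opens} {e : Γ(L.sheaf, U)} (he : IsFrame L.sheaf U e)
    (p : TotalSpace (X := X) (L.pullback f)) :
    coordOrZero L he (p.push hf hL) = coordOrZero (L.pullback f) (hL he) p := rfl

lemma TotalSpace.continuous_push (hF : ∀ y : CPoint Y, Nonempty (FrameAt L.sheaf y.hom)) :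
    Continuous (TotalSpace.push (X := X) (L := L) hf hL) := by
  refine continuous_totalSpace_of_frame ((CPoint.continuous_map f hf).comp continuous_pt)
    fun p => ?_
  obtain ⟨b⟩ := hF (p.pt.map f hf)
  refine ⟨b.U, b.e, b.isFrame, b.mem, ?_⟩
  simp only [coordOrZero_push]
  exact continuousAt_coordOrZero (L := L.pullback f) (hL b.isFrame) b.mem

lemma TotalSpace.exists_push_eq (hF : ∀ y : CPoint Y, Nonempty (FrameAt L.sheaf y.hom))
    (x : CPoint X) (p : TotalSpace (X := Y) L) (h : p.pt = x.map f hf) :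
    ∃ q : TotalSpace (X := X) (L.pullback f), q.pt = x ∧ q.push hf hL = p := by
  obtain ⟨y, v⟩ := p
  change y = _ at h
  subst h
  obtain ⟨b⟩ := hF (x.map f hf)
  obtain ⟨w, rfl⟩ := Fibre.push_surjective hL x.hom b v
  exact ⟨⟨x, w⟩, rfl, rfl⟩

lemma TotalSpace.push_injective (hF : ∀ y : CPoint Y, Nonempty (FrameAt L.sheaf y.hom))
    {p q : TotalSpace (X := X) (L.pullback f)} (h : p.pt = q.pt)
    (h' : p.push hf hL = q.push hf hL) : p = q := by
  obtain ⟨x, v⟩ := p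
  obtain ⟨y, w⟩ := q
  change x = y at h
  subst h
  obtain ⟨b⟩ := hF (x.map f hf)
  congr 1
  apply Fibre.push_injective hL x.hom b
  injection h'

/-- The total space of `f^* L` has the topology of the fibre product of `X(ℂ)` and the total space
of `L` over `Y(ℂ)`. -/
lemma TotalSpace.continuous_of_push {T : Type*} [TopologicalSpace T]
    {g : T → TotalSpace (X := X) (L.pullback f)} (h1 : Continuous fun t => (g t).pt)
    (h2 : Continuous fun t => (g t).push hf hL) (hF : ∀ y : CPoint Y, Nonempty (FrameAt L.sheaf y.hom)) :
    Continuous g := by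
  refine continuous_totalSpace_of_frame h1 fun t => ?_
  obtain ⟨b⟩ := hF ((g t).pt.map f hf)
  refine ⟨f ⁻¹ᵁ b.U, _, hL b.isFrame, b.mem, ?_⟩
  exact (continuousAt_coordOrZero (L := L) b.isFrame
    (p := (g t).push hf hL) b.mem).comp (f := fun t => (g t).push hf hL) h2.continuousAt

end TotalSpace

section Blowup
variable {X Y : LogScheme} {f : X.X ⟶ Y.X} (hf : f ≫ Y.str = X.str) {L : LineWithSection Y.X}
  (hL : PullsBackFrames f L.sheaf) (hF : ∀ y : CPoint Y, Nonempty (FrameAt L.sheaf y.hom))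
  (h0 : L.sec = 0)

/-- The map from the nonzero vectors of `f^* L` to those of `L`, for the zero section of `L`. -/
def BlowupVector.push (p : BlowupVector (X := X) (L.pullback f)) : BlowupVector (X := Y) L :=
  BlowupVector.ofNeZero h0 (p.1.push hf hL) (by
    obtain ⟨b⟩ := hF (p.1.pt.map f hf)
    exact fun h => p.2.1 (Fibre.push_injective hL _ b (h.trans (map_zero _).symm)))

/-- The map of real oriented blow-ups from that of `f^* L` to that of `L`. -/
def RealBlowup.push : RealBlowup (X := X) (L.pullback f) → RealBlowup (X := Y) L :=
  Quotient.lift (fun p => (p.push hf hL hF h0).ray) (by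
    rintro p q ⟨c, hc, h⟩
    refine ray_eq_iff.mpr ⟨c, hc, ?_⟩
    change q.1.push hf hL = _
    rw [h]
    rfl)

lemma RealBlowup.continuous_push : Continuous (RealBlowup.push hf hL hF h0) :=
  Continuous.quotient_lift (continuous_ray.comp
    (((TotalSpace.continuous_push hf hL hF).comp continuous_subtype_val).subtype_mk _)) _

lemma RealBlowup.blowdown_push (R : RealBlowup (X := X) (L.pullback f)) :
    (R.push hf hL hF h0).blowdown = R.blowdown.map f hf := by
  obtain ⟨p, rfl⟩ := exists_ray R
  rfl

lemma RealBlowup.push_injective {R S : RealBlowup (X := X) (L.pullback f)}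
    (h : R.blowdown = S.blowdown) (h' : R.push hf hL hF h0 = S.push hf hL hF h0) : R = S := by
  obtain ⟨p, rfl⟩ := exists_ray R
  obtain ⟨q, rfl⟩ := exists_ray S
  obtain ⟨c, hc, h2⟩ := ray_eq_iff.mp h'
  refine ray_eq_iff.mpr ⟨c, hc, TotalSpace.push_injective hf hL hF h.symm ?_⟩
  exact h2.trans rfl

end Blowup

/-! ### The product -/

section Product
variable (m : ℕ)

/-- The first projection of `Spec ℂ × ℙ^m`. -/
abbrev fstMor : (baseProd m).X ⟶ logPoint.X := Limits.pullback.fst logPoint.str (logProj m).str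

/-- The second projection of `Spec ℂ × ℙ^m`. -/
abbrev sndMor : (baseProd m).X ⟶ (logProj m).X := Limits.pullback.snd logPoint.str (logProj m).str

instance : IsIso (sndMor m) := by
  have : IsIso logPoint.str := inferInstanceAs (IsIso (𝟙 SpecC))
  exact Limits.pullback_snd_iso_of_left_iso logPoint.str (logProj m).str

lemma fstMor_comm : fstMor m ≫ logPoint.str = (baseProd m).str := rfl

lemma sndMor_comm : sndMor m ≫ (logProj m).str = (baseProd m).str := Limits.pullback.condition.symm

lemma inv_sndMor_comm : inv (sndMor m) ≫ (baseProd m).str = (logProj m).str := by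
  rw [IsIso.inv_comp_eq, sndMor_comm]

lemma pullsBackFrames_fst : PullsBackFrames (fstMor m) pointLine.sheaf :=
  fun _ _ h => h.pullback_structureModule _

lemma pullsBackFrames_snd : PullsBackFrames (sndMor m) (tautLine m).sheaf :=
  fun _ _ h => h.pullback_of_isIso _

lemma nonempty_frame_point (y : CPoint logPoint) : Nonempty (FrameAt pointLine.sheaf y.hom) :=
  ⟨oneFrame y.hom⟩

variable {m} in
lemma nonempty_frame_proj (y : CPoint (logProj m)) : Nonempty (FrameAt (tautLine m).sheaf y.hom) := by
  obtain ⟨i, hi⟩ := exists_mem_chart y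
  exact ⟨invFrame i hi⟩

/-- The inverse image of `(𝒪, 0)` on `Spec ℂ × ℙ^m`. -/
abbrev fstLine : LineWithSection (baseProd m).X := pointLine.pullback (fstMor m)

/-- The inverse image of `(𝒪(-1), 0)` on `Spec ℂ × ℙ^m`. -/
abbrev sndLine : LineWithSection (baseProd m).X := (tautLine m).pullback (sndMor m)

variable {m}

/-- The map on Kato--Nakayama spaces induced by the first projection. -/
def fstKN (P : KN (baseProd m)) : KN logPoint :=
  ⟨(P.pt.map (fstMor m) (fstMor_comm m), fun _ => RealBlowup.push (L := pointLine) (fstMor_comm m)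
    (pullsBackFrames_fst m) nonempty_frame_point rfl (P.ray (0 : Fin 2))), fun _ =>
      (RealBlowup.blowdown_push (L := pointLine) (fstMor_comm m)
        (pullsBackFrames_fst m) nonempty_frame_point rfl (P.ray (0 : Fin 2))).trans
      (congrArg (CPoint.map (fstMor m) (fstMor_comm m)) (P.2 (0 : Fin 2)))⟩

/-- The map on Kato--Nakayama spaces induced by the second projection. -/
def sndKN (P : KN (baseProd m)) : KN (logProj m) :=
  ⟨(P.pt.map (sndMor m) (sndMor_comm m), fun _ => RealBlowup.push (L := tautLine m) (sndMor_comm m)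
    (pullsBackFrames_snd m) nonempty_frame_proj rfl (P.ray (1 : Fin 2))), fun _ =>
      (RealBlowup.blowdown_push (L := tautLine m) (sndMor_comm m)
        (pullsBackFrames_snd m) nonempty_frame_proj rfl (P.ray (1 : Fin 2))).trans
      (congrArg (CPoint.map (sndMor m) (sndMor_comm m)) (P.2 (1 : Fin 2)))⟩

lemma continuous_KN_pt {X : LogScheme} : Continuous (KN.pt : KN X → CPoint X) :=
  continuous_fst.comp continuous_subtype_val

lemma continuous_KN_ray {X : LogScheme} (i : Fin X.n) : Continuous fun P : KN X => P.ray i :=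
  (continuous_apply i).comp (continuous_snd.comp continuous_subtype_val)

lemma KN.continuous_of_pt_of_ray {X : LogScheme} {T : Type*} [TopologicalSpace T] {g : T → KN X}
    (h : Continuous fun t => (g t).pt) (h' : ∀ i, Continuous fun t => (g t).ray i) :
    Continuous g :=
  Continuous.subtype_mk (h.prodMk (continuous_pi h')) _

lemma continuous_fstKN : Continuous (fstKN : KN (baseProd m) → KN logPoint) :=
  Continuous.subtype_mk (((CPoint.continuous_map _ _).comp continuous_KN_pt).prodMk
    (continuous_pi fun _ => (RealBlowup.continuous_push (L := pointLine) (fstMor_comm m)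
    (pullsBackFrames_fst m) nonempty_frame_point rfl).comp
      (continuous_KN_ray (X := baseProd m) (0 : Fin 2)))) _

lemma continuous_sndKN : Continuous (sndKN : KN (baseProd m) → KN (logProj m)) :=
  Continuous.subtype_mk (((CPoint.continuous_map _ _).comp continuous_KN_pt).prodMk
    (continuous_pi fun _ => (RealBlowup.continuous_push (L := tautLine m) (sndMor_comm m)
    (pullsBackFrames_snd m) nonempty_frame_proj rfl).comp
      (continuous_KN_ray (X := baseProd m) (1 : Fin 2)))) _

lemma cpoint_map_snd_injective :
    Function.Injective (CPoint.map (X := baseProd m) (sndMor m) (sndMor_comm m)) := by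
  intro x y h
  have h1 : x.hom ≫ sndMor m = y.hom ≫ sndMor m := congrArg CPoint.hom h
  exact CPoint.ext ((cancel_mono (sndMor m)).mp h1)

/-- A point of the product is determined by its projections: the second one determines the point of the
underlying scheme, and the two rays are determined by their images. -/
lemma fstKN_sndKN_injective {P Q : KN (baseProd m)} (h : fstKN P = fstKN Q)
    (h' : sndKN P = sndKN Q) : P = Q := by
  have hpt : P.pt = Q.pt := cpoint_map_snd_injective (congrArg KN.pt h')
  have hray : ∀ j : Fin 2, (P.ray j).blowdown = (Q.ray j).blowdown :=
    fun j => (P.2 j).trans (hpt.trans (Q.2 j).symm)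
  refine Subtype.ext (Prod.ext hpt ?_)
  refine funext (Fin.forall_fin_two (p := fun j => P.ray j = Q.ray j) |>.mpr ⟨?_, ?_⟩)
  · exact RealBlowup.push_injective (L := pointLine) (fstMor_comm m)
      (pullsBackFrames_fst m) nonempty_frame_point rfl (hray 0)
      (congrArg (fun R : KN logPoint => R.ray (0 : Fin 1)) h)
  · exact RealBlowup.push_injective (L := tautLine m) (sndMor_comm m)
      (pullsBackFrames_snd m) nonempty_frame_proj rfl (hray 1)
      (congrArg (fun R : KN (logProj m) => R.ray (0 : Fin 1)) h')

/-- The point of `Spec ℂ × ℙ^m` below a nonzero vector. -/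
def prodPoint (v : UnitSphere (m + 1)) : CPoint (baseProd m) :=
  (projPoint (complexCoord v.1) (complexCoord_ne_zero v)).map (Y := baseProd m) (inv (sndMor m))
    (inv_sndMor_comm m)

lemma prodPoint_map_snd (v : UnitSphere (m + 1)) :
    (prodPoint v).map (sndMor m) (sndMor_comm m) =
      projPoint (complexCoord v.1) (complexCoord_ne_zero v) := by
  apply CPoint.ext
  change (_ ≫ inv (sndMor m)) ≫ sndMor m = _
  rw [Category.assoc, IsIso.inv_hom_id, Category.comp_id]

lemma continuous_prodPoint :
    Continuous (prodPoint : UnitSphere (m + 1) → CPoint (baseProd m)) :=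
  (CPoint.continuous_map (Y := baseProd m) _ _).comp
    (continuous_projPoint (continuous_complexCoord.comp continuous_subtype_val) _)

lemma exists_fstLine_vec (v : UnitSphere (m + 1)) (z : Circle) :
    ∃ p : TotalSpace (X := baseProd m) (fstLine m), p.pt = prodPoint v ∧
      p.push (L := pointLine) (fstMor_comm m) (pullsBackFrames_fst m) = pointVec z :=
  TotalSpace.exists_push_eq (L := pointLine) (fstMor_comm m) (pullsBackFrames_fst m)
    nonempty_frame_point _ _ (Subsingleton.elim _ _)

lemma exists_sndLine_vec (v : UnitSphere (m + 1)) :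
    ∃ p : TotalSpace (X := baseProd m) (sndLine m), p.pt = prodPoint v ∧
      p.push (L := tautLine m) (sndMor_comm m) (pullsBackFrames_snd m) =
        tautPoint (complexCoord v.1) (complexCoord_ne_zero v) :=
  TotalSpace.exists_push_eq (L := tautLine m) (sndMor_comm m) (pullsBackFrames_snd m)
    nonempty_frame_proj _ _ (prodPoint_map_snd v).symm

/-- The vector of the fibre of `π_1^* 𝒪` given by a complex number. -/
def fstVec (t : Circle × UnitSphere (m + 1)) : TotalSpace (X := baseProd m) (fstLine m) :=
  (exists_fstLine_vec t.2 t.1).choose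

/-- The vector of the fibre of `π_2^* 𝒪(-1)` given by a vector of `ℂ^{m+1}`. -/
def sndVec (t : Circle × UnitSphere (m + 1)) : TotalSpace (X := baseProd m) (sndLine m) :=
  (exists_sndLine_vec t.2).choose

lemma fstVec_pt (t : Circle × UnitSphere (m + 1)) : (fstVec t).pt = prodPoint t.2 :=
  (exists_fstLine_vec t.2 t.1).choose_spec.1

lemma fstVec_push (t : Circle × UnitSphere (m + 1)) :
    (fstVec t).push (L := pointLine) (fstMor_comm m) (pullsBackFrames_fst m) = pointVec t.1 :=
  (exists_fstLine_vec t.2 t.1).choose_spec.2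

lemma sndVec_pt (t : Circle × UnitSphere (m + 1)) : (sndVec t).pt = prodPoint t.2 :=
  (exists_sndLine_vec t.2).choose_spec.1

lemma sndVec_push (t : Circle × UnitSphere (m + 1)) :
    (sndVec t).push (L := tautLine m) (sndMor_comm m) (pullsBackFrames_snd m) =
      tautPoint (complexCoord t.2.1) (complexCoord_ne_zero t.2) :=
  (exists_sndLine_vec t.2).choose_spec.2

lemma continuous_fstVec : Continuous (fstVec (m := m)) := by
  refine TotalSpace.continuous_of_push (L := pointLine) (fstMor_comm m) (pullsBackFrames_fst m)
    ?_ ?_ nonempty_frame_point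
  · simp only [fstVec_pt]
    exact continuous_prodPoint.comp continuous_snd
  · refine (continuous_pointVec.comp (continuous_subtype_val.comp continuous_fst)).congr ?_
    exact fun t => (fstVec_push t).symm

lemma continuous_sndVec : Continuous (sndVec (m := m)) := by
  refine TotalSpace.continuous_of_push (L := tautLine m) (sndMor_comm m) (pullsBackFrames_snd m)
    ?_ ?_ nonempty_frame_proj
  · simp only [sndVec_pt]
    exact continuous_prodPoint.comp continuous_snd
  · refine (continuous_tautPoint (v := fun t : Circle × UnitSphere (m + 1) => complexCoord t.2.1)
      (continuous_complexCoord.comp (continuous_subtype_val.comp continuous_snd))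
      (fun t => complexCoord_ne_zero t.2)).congr ?_
    exact fun t => (sndVec_push t).symm

lemma fstVec_ne_zero (t : Circle × UnitSphere (m + 1)) : (fstVec t).vec ≠ 0 := by
  intro h
  have h1 := congrArg pointCoord (fstVec_push t)
  rw [pointCoord_pointVec] at h1
  have h2 : pointCoord ((fstVec t).push (L := pointLine) (fstMor_comm m) (pullsBackFrames_fst m)) = 0 :=
    congrFun (congrArg Subtype.val h) _
  exact t.1.coe_ne_zero (h1.symm.trans h2)

lemma tautCoord_eq_zero (p : TautSpace m) (h : p.vec = 0) : tautCoord p = 0 := by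
  obtain ⟨x, v⟩ := p
  change v = 0 at h
  rw [h, ← zero_smul ℂ (0 : Fibre (tautLine m).sheaf x.hom), tautCoord_smul, zero_smul]

lemma sndVec_ne_zero (t : Circle × UnitSphere (m + 1)) : (sndVec t).vec ≠ 0 := by
  intro h
  have h1 := congrArg (tautCoord (m := m)) (sndVec_push t)
  rw [tautCoord_tautPoint] at h1
  refine complexCoord_ne_zero t.2 (h1.symm.trans ?_)
  exact tautCoord_eq_zero _ ((congrArg (Fibre.push (pullsBackFrames_snd m) _) h).trans (map_zero _))

/-- The vector `fstVec`, as a vector in the direction of the zero section. -/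
def fstBlowupVec (t : Circle × UnitSphere (m + 1)) : BlowupVector (X := baseProd m) (fstLine m) :=
  BlowupVector.ofNeZero (L := fstLine m) (pullbackSection_zero _ _ _) (fstVec t) (fstVec_ne_zero t)

/-- The vector `sndVec`, as a vector in the direction of the zero section. -/
def sndBlowupVec (t : Circle × UnitSphere (m + 1)) : BlowupVector (X := baseProd m) (sndLine m) :=
  BlowupVector.ofNeZero (L := sndLine m) (pullbackSection_zero _ _ _) (sndVec t) (sndVec_ne_zero t)

/-- The point of the Kato--Nakayama space of the product given by a point of each of the spheres. -/
def prodInv (t : Circle × UnitSphere (m + 1)) : KN (baseProd m) :=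
  ⟨(prodPoint t.2, Fin.cons (α := fun j : Fin 2 => RealBlowup (X := baseProd m) ((baseProd m).L j))
      (fstBlowupVec t).ray (Fin.cons (α := fun j : Fin 1 => RealBlowup (X := baseProd m)
        ((baseProd m).L (j.succ : Fin 2))) (sndBlowupVec t).ray fun j => j.elim0)),
    Fin.forall_fin_two.mpr ⟨fstVec_pt t, sndVec_pt t⟩⟩

lemma continuous_prodInv : Continuous (prodInv (m := m)) := by
  have h : ∀ j : Fin 2, Continuous fun t : Circle × UnitSphere (m + 1) =>
      KN.ray (X := baseProd m) (prodInv t) j :=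
    Fin.forall_fin_two.mpr ⟨continuous_ray.comp (continuous_fstVec.subtype_mk _),
      continuous_ray.comp (continuous_sndVec.subtype_mk _)⟩
  have h' : Continuous fun t : Circle × UnitSphere (m + 1) => KN.pt (prodInv t) :=
    continuous_prodPoint.comp continuous_snd
  exact KN.continuous_of_pt_of_ray (X := baseProd m) h' h

lemma circleHomeo_fstKN_prodInv (t : Circle × UnitSphere (m + 1)) :
    circleHomeo (fstKN (prodInv t)) = t.1 := by
  obtain ⟨c, hc, h⟩ := exists_circleHomeo (fstKN (prodInv t))
    (BlowupVector.push (L := pointLine) (fstMor_comm m) (pullsBackFrames_fst m)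
      nonempty_frame_point rfl (fstBlowupVec t)) rfl
  have h1 : (circleHomeo (fstKN (prodInv t)) : ℂ) = c * t.1 :=
    h.trans (congrArg ((c : ℂ) * ·) ((congrArg pointCoord (fstVec_push t)).trans
      (pointCoord_pointVec _)))
  have h2 := congrArg norm h1
  rw [norm_mul, Circle.norm_coe, Circle.norm_coe, mul_one, Complex.norm_real,
    Real.norm_of_nonneg hc.le] at h2
  apply Circle.ext
  rw [h1, ← h2, Complex.ofReal_one, one_mul]

/-- Two unit vectors on the same ray are equal. -/
lemma unitSphere_ext {k : ℕ} {v w : UnitSphere k} {c : ℝ} (hc : 0 < c)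
    (h : complexCoord v.1 = (c : ℂ) • complexCoord w.1) : v = w := by
  have h1 : v.1 = c • w.1 := by
    apply complexCoord_injective
    rw [h]
    funext j
    rw [complexCoord_smul]
    rfl
  have h2 := congrArg norm h1
  rw [norm_smul, norm_eq_of_mem_sphere, norm_eq_of_mem_sphere, mul_one,
    Real.norm_of_nonneg hc.le] at h2
  apply Subtype.ext
  rw [h1, ← h2, one_smul]

lemma sphereHomeo_sndKN_prodInv (t : Circle × UnitSphere (m + 1)) :
    sphereHomeo m (sndKN (prodInv t)) = t.2 := by
  obtain ⟨c, hc, h⟩ := exists_complexCoord_sphereHomeo (sndKN (prodInv t))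
    (BlowupVector.push (L := tautLine m) (sndMor_comm m) (pullsBackFrames_snd m)
      nonempty_frame_proj rfl (sndBlowupVec t)) rfl
  refine unitSphere_ext hc (h.trans (congrArg ((c : ℂ) • ·) ?_))
  exact (congrArg tautCoord (sndVec_push t)).trans (tautCoord_tautPoint _ _)

/-- The homeomorphism of the Kato--Nakayama space of the product with the product of the
Kato--Nakayama spaces of the factors. -/
def prodHomeo (m : ℕ) : KN (baseProd m) ≃ₜ KN logPoint × KN (logProj m) where
  toFun P := (fstKN P, sndKN P)
  invFun Q := prodInv (circleHomeo Q.1, sphereHomeo m Q.2)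
  left_inv _ := fstKN_sndKN_injective
    (circleHomeo.injective (circleHomeo_fstKN_prodInv _))
    ((sphereHomeo m).injective (sphereHomeo_sndKN_prodInv _))
  right_inv _ := Prod.ext (circleHomeo.injective (circleHomeo_fstKN_prodInv _))
    ((sphereHomeo m).injective (sphereHomeo_sndKN_prodInv _))
  continuous_toFun := continuous_fstKN.prodMk continuous_sndKN
  continuous_invFun := continuous_prodInv.comp
    ((circleHomeo.continuous.comp continuous_fst).prodMk
      ((sphereHomeo m).continuous.comp continuous_snd))


end Product

/-! ### The analytification of a morphism -/

section Analytification
variable {X Y : LogScheme}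

/-- The equation `φ(f^* b) = r • ⨂_j a_j^{⊗ e_{ij}}` over `W`, for local frames `a_j` and `b`. -/
def FrameEquation (φ : X.Hom Y) (i : Fin Y.n) {x : SpecC ⟶ X.X}
    (a : ∀ j, FrameAt (X.L j).sheaf x) (b : FrameAt (Y.L i).sheaf (x ≫ φ.f)) (W : X.X.Opens)
    (ha : ∀ j, W ≤ (a j).U) (hb : W ≤ φ.f ⁻¹ᵁ b.U) (r : Γ(X.X, W)) : Prop :=
  (φ.iso i).hom.app W (((Y.L i).pullback φ.f).sheaf.presheaf.map (homOfLE hb).op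
      (pullbackSection φ.f (Y.L i).sheaf b.U b.e)) =
    r • tensorSection (fun j => (X.L j).sheaf) (φ.e i) W
      (fun j => (X.L j).sheaf.presheaf.map (homOfLE (ha j)).op (a j).e)

lemma BlowupVector.exists_eq_mk {P : KN X} {j : Fin X.n} (p : BlowupVector (X := X) (X.L j))
    (h : p.ray = P.ray j) : ∃ v, p.1 = ⟨P.pt, v⟩ := by
  have hpt : p.1.pt = P.pt := (congrArg RealBlowup.blowdown h).trans (P.2 j)
  obtain ⟨⟨x, v⟩, hv⟩ := p
  change x = _ at hpt
  subst hpt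
  exact ⟨v, rfl⟩

lemma BlowupVector.exists_mk {L : LineWithSection X.X} (p : BlowupVector (X := X) L)
    {t : TotalSpace L} (h : p.1 = t) : ∃ ht, p = ⟨t, ht⟩ := by
  subst h
  exact ⟨p.2, rfl⟩

/-- To compute the analytification of `φ`, it is enough to give a rule `T` for vectors which agrees with
`φ` in all local frames: a map `g` is the analytification if and only if it has the rays of the
vectors given by `T`. The uniqueness uses that suitable frames exist near each point. -/
lemma isAnalytification_iff (φ : X.Hom Y) (i₀ : Fin Y.n)
    (T : ∀ (i : Fin Y.n) (x : CPoint X) (_ : ∀ j, Fibre (X.L j).sheaf x.hom),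
      Fibre (Y.L i).sheaf (x.hom ≫ φ.f))
    (hT : ∀ i x v a b W hx ha hb r, FrameEquation φ i (x := x.hom) a b W ha hb r →
      evalAt x.hom W hx r * (T i x v).1 b = ∏ j, (v j).1 (a j) ^ φ.e i j)
    (htest : ∀ i (x : CPoint X), ∃ a b W ha hb r, ∃ hx : ⊤ ≤ x.hom ⁻¹ᵁ W,
      FrameEquation φ i (x := x.hom) a b W ha hb r ∧ evalAt x.hom W hx r ≠ 0)
    (g : KN X → KN Y) :
    IsAnalytification φ g ↔ ∀ (P : KN X) (i : Fin Y.n) (p : ∀ j, BlowupVector (X := X) (X.L j))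
      (v : ∀ j, Fibre (X.L j).sheaf P.pt.hom), (∀ j, (p j).1 = ⟨P.pt, v j⟩) →
      (∀ j, (p j).ray = P.ray j) →
      ∀ q : BlowupVector (X := Y) (Y.L i), q.ray = (g P).ray i →
      ∃ c : ℝ, 0 < c ∧ q.1 = ⟨P.pt.map φ.f φ.comm, (c : ℂ) • T i P.pt v⟩ := by
  constructor
  · intro h P i p v hp hpP q hq
    obtain ⟨hpt, hP⟩ := h P
    have hpt' : (g P).pt = P.pt.map φ.f φ.comm := CPoint.ext hpt
    obtain ⟨a, b, W, ha, hb, r, hx, hr, hr0⟩ := htest i P.pt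
    have hqpt : q.1.pt = P.pt.map φ.f φ.comm :=
      ((congrArg RealBlowup.blowdown hq).trans ((g P).2 i)).trans hpt'
    obtain ⟨⟨y, w⟩, hw⟩ := q
    change y = _ at hqpt
    subst hqpt
    choose hv hpv using fun j => BlowupVector.exists_mk (p j) (hp j)
    obtain rfl : p = fun j => ⟨⟨P.pt, v j⟩, hv j⟩ := funext hpv
    obtain ⟨c, hc, hqc⟩ := hP i (fun j => ⟨⟨P.pt, v j⟩, hv j⟩) ⟨⟨_, w⟩, hw⟩ hpP hq a b W hx ha hb r hr
    refine ⟨c, hc, ?_⟩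
    refine congrArg (TotalSpace.mk _) (Fibre.ext_frame b ?_)
    -- both vectors have the same coordinate in `b`, as `r` is invertible at the point
    apply mul_left_cancel₀ hr0
    refine hqc.trans ?_
    change _ = _ * ((c : ℂ) * _)
    rw [mul_left_comm, hT i P.pt v a b W hx ha hb r hr]
  · intro h P
    constructor
    · choose p hp using fun j => exists_ray (P.ray j)
      choose v hv using fun j => (p j).exists_eq_mk (hp j)
      obtain ⟨q, hq⟩ := exists_ray ((g P).ray i₀)
      obtain ⟨c, -, hqc⟩ := h P i₀ p v hv hp q hq
      have h1 : q.1.pt = (g P).pt := (congrArg RealBlowup.blowdown hq).trans ((g P).2 i₀)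
      rw [← h1, hqc]
      rfl
    · intro i p q hp hq
      choose v hpv using fun j => (p j).exists_eq_mk (hp j)
      obtain ⟨c, hc, hqc⟩ := h P i p v hpv hp q hq
      choose hv hpv' using fun j => BlowupVector.exists_mk (p j) (hpv j)
      obtain rfl : p = fun j => ⟨⟨P.pt, v j⟩, hv j⟩ := funext hpv'
      obtain ⟨q, hq0⟩ := q
      change q = _ at hqc
      subst hqc
      intro a b W hx ha hb r hr
      refine ⟨c, hc, ?_⟩
      refine Eq.trans ?_ (congrArg ((c : ℂ) * ·) (hT i P.pt v a b W hx ha hb r hr))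
      exact mul_left_comm _ _ _

end Analytification

/-! ### The analytifications of the projections and of scalar multiplication -/

lemma inv_app_eq_smul_iff {X : Scheme.{0}} {M N : X.Modules} (α : M ≅ N) {W : X.Opens}
    {r : Γ(X, W)} {s : Γ(N, W)} {t : Γ(M, W)} {u : Γ(N, W)} (h : α.hom.app W t = u) :
    α.inv.app W s = r • t ↔ s = r • u := by
  subst h
  have h1 : ∀ s, α.hom.app W (α.inv.app W s) = s := fun s =>
    congrArg (fun g : N ⟶ N => g.app W s) α.inv_hom_id
  have h2 : ∀ t, α.inv.app W (α.hom.app W t) = t := fun t =>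
    congrArg (fun g : M ⟶ M => g.app W t) α.hom_inv_id
  rw [← Scheme.Modules.Hom.app_smul]
  constructor
  · intro h
    rw [← h, h1]
  · rintro rfl
    rw [h2]

section Maps
variable {m : ℕ}

/-- A family of frames of the two line bundles of the product. -/
def framePair {x : SpecC ⟶ (baseProd m).X} (a : FrameAt (fstLine m).sheaf x)
    (b : FrameAt (sndLine m).sheaf x) : ∀ j : Fin 2, FrameAt ((baseProd m).L j).sheaf x :=
  Fin.cons (α := fun j : Fin 2 => FrameAt ((baseProd m).L j).sheaf x) a
    (Fin.cons (α := fun j : Fin 1 => FrameAt ((baseProd m).L (j.succ : Fin 2)).sheaf x) b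
      fun j => j.elim0)

lemma frameEquation_fst_iff {i : Fin 1} {x : SpecC ⟶ (baseProd m).X}
    {a : ∀ j : Fin 2, FrameAt ((baseProd m).L j).sheaf x}
    {b : FrameAt pointLine.sheaf (x ≫ fstMor m)} {W : (baseProd m).X.Opens}
    {ha : ∀ j, W ≤ (a j).U} {hb : W ≤ fstMor m ⁻¹ᵁ b.U} {r : Γ((baseProd m).X, W)} :
    FrameEquation (fstHom m) i a b W ha hb r ↔
      (fstLine m).sheaf.presheaf.map (homOfLE hb).op (b.pullback (pullsBackFrames_fst m)).e =
        r • (fstLine m).sheaf.presheaf.map (homOfLE (ha 0)).op (a 0).e := by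
  exact inv_app_eq_smul_iff (tensorFstIso (prodSheaf m))
    (tensorFstIso_hom_app_tensorSection (prodSheaf m) W
      fun j => (prodSheaf m j).presheaf.map (homOfLE (ha j)).op (a j).e)

lemma frameEquation_snd_iff {i : Fin 1} {x : SpecC ⟶ (baseProd m).X}
    {a : ∀ j : Fin 2, FrameAt ((baseProd m).L j).sheaf x}
    {b : FrameAt (tautLine m).sheaf (x ≫ sndMor m)} {W : (baseProd m).X.Opens}
    {ha : ∀ j, W ≤ (a j).U} {hb : W ≤ sndMor m ⁻¹ᵁ b.U} {r : Γ((baseProd m).X, W)} :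
    FrameEquation (sndHom m) i a b W ha hb r ↔
      (sndLine m).sheaf.presheaf.map (homOfLE hb).op (b.pullback (pullsBackFrames_snd m)).e =
        r • (sndLine m).sheaf.presheaf.map (homOfLE (ha 1)).op (a 1).e := by
  exact inv_app_eq_smul_iff (tensorSndIso (prodSheaf m))
    (tensorSndIso_hom_app_tensorSection (prodSheaf m) W
      fun j => (prodSheaf m j).presheaf.map (homOfLE (ha j)).op (a j).e)

/-- The function `u` with `a = u • π_1^* 1` for a section `a` of `π_1^* 𝒪`. -/
def fstCoeff (m : ℕ) (W : (baseProd m).X.Opens) (a : Γ((fstLine m).sheaf, W)) :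
    Γ((baseProd m).X, W) :=
  (pullbackUnitIso (fstMor m)).hom.app W a

lemma frameEquation_action_iff {i : Fin 1} {x : SpecC ⟶ (baseProd m).X}
    {a : ∀ j : Fin 2, FrameAt ((baseProd m).L j).sheaf x}
    {b : FrameAt (tautLine m).sheaf (x ≫ sndMor m)} {W : (baseProd m).X.Opens}
    {ha : ∀ j, W ≤ (a j).U} {hb : W ≤ sndMor m ⁻¹ᵁ b.U} {r : Γ((baseProd m).X, W)} :
    FrameEquation (actionHom m) i a b W ha hb r ↔
      (sndLine m).sheaf.presheaf.map (homOfLE hb).op (b.pullback (pullsBackFrames_snd m)).e =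
        r • (fstCoeff m W ((fstLine m).sheaf.presheaf.map (homOfLE (ha 0)).op (a 0).e) •
          (sndLine m).sheaf.presheaf.map (homOfLE (ha 1)).op (a 1).e) := by
  exact inv_app_eq_smul_iff (tensorMulIso (prodSheaf m) (pullbackUnitIso (fstMor m)))
    (tensorMulIso_hom_app_tensorSection (prodSheaf m) (pullbackUnitIso (fstMor m)) W
      fun j => (prodSheaf m j).presheaf.map (homOfLE (ha j)).op (a j).e)

/-- The frame `π_1^* 1` of `π_1^* 𝒪`. -/
def fstOneFrame (x : SpecC ⟶ (baseProd m).X) : FrameAt (fstLine m).sheaf x :=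
  (oneFrame (x ≫ fstMor m)).pullback (pullsBackFrames_fst m)

lemma fstCoeff_one (x : SpecC ⟶ (baseProd m).X) {W : (baseProd m).X.Opens}
    (h : W ≤ (fstOneFrame x).U) :
    fstCoeff m W ((fstLine m).sheaf.presheaf.map (homOfLE h).op (fstOneFrame x).e) = 1 := by
  have h1 := ConcreteCategory.congr_hom
    ((pullbackUnitIso (fstMor m)).hom.mapPresheaf.naturality (homOfLE h).op) (fstOneFrame x).e
  have h2 := pullbackUnitIso_hom_app_pullbackSection (fstMor m) ⊤ (1 : Γ(SpecC, ⊤))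
  refine h1.trans ((congrArg ((structureModule (baseProd m).X).presheaf.map (homOfLE h).op) h2).trans ?_)
  change (baseProd m).X.presheaf.map (homOfLE h).op ((fstMor m).app ⊤ 1) = 1
  rw [map_one]
  exact map_one _

lemma eq_fstCoeff_smul (x : SpecC ⟶ (baseProd m).X) {W : (baseProd m).X.Opens}
    (h : W ≤ (fstOneFrame x).U) (a : Γ((fstLine m).sheaf, W)) :
    a = fstCoeff m W a • (fstLine m).sheaf.presheaf.map (homOfLE h).op (fstOneFrame x).e := by
  have hinj : Function.Injective ((pullbackUnitIso (fstMor m)).hom.app W) :=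
    (ConcreteCategory.bijective_of_isIso ((pullbackUnitIso (fstMor m)).hom.app W)).1
  apply hinj
  refine Eq.trans ?_ (Scheme.Modules.Hom.app_smul (pullbackUnitIso (fstMor m)).hom _ _).symm
  change fstCoeff m W a = fstCoeff m W a * fstCoeff m W _
  rw [fstCoeff_one, mul_one]

end Maps

/-- A ray of `L` consists of the positive multiples of a pushed vector if and only if it is the push of
the ray of that vector. -/
lemma forall_ray_push_iff {X Y : LogScheme} {f : X.X ⟶ Y.X} (hf : f ≫ Y.str = X.str)
    {L : LineWithSection Y.X} (hL : PullsBackFrames f L.sheaf)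
    (hF : ∀ y : CPoint Y, Nonempty (FrameAt L.sheaf y.hom)) (h0 : L.sec = 0)
    (p : BlowupVector (X := X) (L.pullback f)) {x : CPoint X} {v} (hp : p.1 = ⟨x, v⟩)
    (R : RealBlowup (X := Y) L) :
    (∀ q : BlowupVector (X := Y) L, q.ray = R →
      ∃ c : ℝ, 0 < c ∧ q.1 = ⟨x.map f hf, (c : ℂ) • Fibre.push hL x.hom v⟩) ↔
    R = RealBlowup.push hf hL hF h0 p.ray := by
  have hray : ∀ q : BlowupVector (X := Y) L, (p.push hf hL hF h0).ray = q.ray ↔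
      ∃ c : ℝ, 0 < c ∧ q.1 = ⟨x.map f hf, (c : ℂ) • Fibre.push hL x.hom v⟩ := by
    intro q
    obtain ⟨p, hp'⟩ := p
    change p = _ at hp
    subst hp
    exact ray_eq_iff
  constructor
  · intro h
    obtain ⟨q, rfl⟩ := exists_ray R
    exact ((hray q).mpr (h q rfl)).symm
  · rintro rfl q hq
    exact (hray q).mp hq.symm

lemma KN.ext_ray {X : LogScheme} (i₀ : Fin X.n) (h : ∀ i, i = i₀) {P Q : KN X}
    (hPQ : P.ray i₀ = Q.ray i₀) : P = Q :=
  (knHomeoBlowup X i₀ h).injective hPQ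

section Maps
variable {m : ℕ}

/-- The product of a number, viewed in the fibre of `π_1^* 𝒪`, and a vector of `π_2^* 𝒪(-1)`. -/
def actionVec (x : CPoint (baseProd m)) (v : Fibre (fstLine m).sheaf x.hom)
    (w : Fibre (sndLine m).sheaf x.hom) : Fibre (tautLine m).sheaf (x.hom ≫ sndMor m) :=
  v.1 (fstOneFrame x.hom) • Fibre.push (pullsBackFrames_snd m) x.hom w

lemma isAnalytification_fst_iff (g : KN (baseProd m) → KN logPoint) :
    IsAnalytification (fstHom m) g ↔ g = fstKN := by
  refine (isAnalytification_iff (X := baseProd m) (fstHom m) (0 : Fin 1)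
    (fun _ x v => Fibre.push (pullsBackFrames_fst m) x.hom (v (0 : Fin 2))) ?_ ?_ g).trans ?_
  · intro i x v a b W hx ha hb r h
    have h1 := (v (0 : Fin 2)).2 (a (0 : Fin 2)) (b.pullback (pullsBackFrames_fst m)) W
      (ha (0 : Fin 2)) hb hx r (frameEquation_fst_iff.mp h)
    refine h1.symm.trans (Eq.symm ((Fin.prod_univ_two _).trans ?_))
    change (v (0 : Fin 2)).1 (a (0 : Fin 2)) ^ 1 * (v (1 : Fin 2)).1 (a (1 : Fin 2)) ^ 0 = _
    rw [pow_one, pow_zero, mul_one]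
  · intro i x
    obtain ⟨b⟩ := nonempty_frame_proj (x.map (sndMor m) (sndMor_comm m))
    let a := framePair (fstOneFrame x.hom) (b.pullback (pullsBackFrames_snd m))
    refine ⟨a, oneFrame (x.hom ≫ fstMor m), (a 0).U ⊓ (a 1).U,
      Fin.forall_fin_two.mpr ⟨inf_le_left, inf_le_right⟩, inf_le_left, 1, fun _ h => ⟨(a 0).mem h, (a 1).mem h⟩,
      frameEquation_fst_iff.mpr (one_smul _ _).symm, ?_⟩
    rw [map_one]
    exact one_ne_zero
  · constructor
    · intro h
      funext P
      refine KN.ext_ray (X := logPoint) (0 : Fin 1) (fun i => Subsingleton.elim (α := Fin 1) i 0) ?_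
      choose p hp using fun j => exists_ray (P.ray j)
      choose v hv using fun j => (p j).exists_eq_mk (hp j)
      refine ((forall_ray_push_iff (L := pointLine) (fstMor_comm m) (pullsBackFrames_fst m)
        nonempty_frame_point rfl (p (0 : Fin 2)) (hv (0 : Fin 2)) _).mp
        (h P (0 : Fin 1) p v hv hp)).trans ?_
      exact congrArg (RealBlowup.push (L := pointLine) (fstMor_comm m) (pullsBackFrames_fst m)
        nonempty_frame_point rfl) (hp (0 : Fin 2))
    · rintro rfl P i p v hv hp
      exact (forall_ray_push_iff (L := pointLine) (fstMor_comm m) (pullsBackFrames_fst m)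
        nonempty_frame_point rfl (p (0 : Fin 2)) (hv (0 : Fin 2)) _).mpr
        (congrArg (RealBlowup.push (L := pointLine) (fstMor_comm m) (pullsBackFrames_fst m)
        nonempty_frame_point rfl) (hp (0 : Fin 2))).symm

lemma isAnalytification_snd_iff (g : KN (baseProd m) → KN (logProj m)) :
    IsAnalytification (sndHom m) g ↔ g = sndKN := by
  refine (isAnalytification_iff (X := baseProd m) (sndHom m) (0 : Fin 1)
    (fun _ x v => Fibre.push (pullsBackFrames_snd m) x.hom (v (1 : Fin 2))) ?_ ?_ g).trans ?_
  · intro i x v a b W hx ha hb r h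
    have h1 := (v (1 : Fin 2)).2 (a (1 : Fin 2)) (b.pullback (pullsBackFrames_snd m)) W
      (ha (1 : Fin 2)) hb hx r (frameEquation_snd_iff.mp h)
    refine h1.symm.trans (Eq.symm ((Fin.prod_univ_two _).trans ?_))
    change (v (0 : Fin 2)).1 (a (0 : Fin 2)) ^ 0 * (v (1 : Fin 2)).1 (a (1 : Fin 2)) ^ 1 = _
    rw [pow_one, pow_zero, one_mul]
  · intro i x
    obtain ⟨b⟩ := nonempty_frame_proj (x.map (sndMor m) (sndMor_comm m))
    let a := framePair (fstOneFrame x.hom) (b.pullback (pullsBackFrames_snd m))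
    refine ⟨a, b, (a 0).U ⊓ (a 1).U,
      Fin.forall_fin_two.mpr ⟨inf_le_left, inf_le_right⟩, inf_le_right, 1, fun _ h => ⟨(a 0).mem h, (a 1).mem h⟩,
      frameEquation_snd_iff.mpr (one_smul _ _).symm, ?_⟩
    rw [map_one]
    exact one_ne_zero
  · constructor
    · intro h
      funext P
      refine KN.ext_ray (X := logProj m) (0 : Fin 1) (fun i => Subsingleton.elim (α := Fin 1) i 0) ?_
      choose p hp using fun j => exists_ray (P.ray j)
      choose v hv using fun j => (p j).exists_eq_mk (hp j)
      refine ((forall_ray_push_iff (L := tautLine m) (sndMor_comm m) (pullsBackFrames_snd m)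
        nonempty_frame_proj rfl (p (1 : Fin 2)) (hv (1 : Fin 2)) _).mp
        (h P (0 : Fin 1) p v hv hp)).trans ?_
      exact congrArg (RealBlowup.push (L := tautLine m) (sndMor_comm m) (pullsBackFrames_snd m)
        nonempty_frame_proj rfl) (hp (1 : Fin 2))
    · rintro rfl P i p v hv hp
      exact (forall_ray_push_iff (L := tautLine m) (sndMor_comm m) (pullsBackFrames_snd m)
        nonempty_frame_proj rfl (p (1 : Fin 2)) (hv (1 : Fin 2)) _).mpr
        (congrArg (RealBlowup.push (L := tautLine m) (sndMor_comm m) (pullsBackFrames_snd m)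
        nonempty_frame_proj rfl) (hp (1 : Fin 2))).symm

/-- The product of a number, viewed in the fibre of `π_1^* 𝒪`, and a vector of `π_2^* 𝒪(-1)`, is the
rule that the morphism of scalar multiplication defines on vectors. -/
lemma isAnalytification_action_iff_actionVec (g : KN (baseProd m) → KN (logProj m)) :
    IsAnalytification (actionHom m) g ↔
      ∀ (P : KN (baseProd m)) (p : BlowupVector (X := baseProd m) (fstLine m))
        (q : BlowupVector (X := baseProd m) (sndLine m)) (v) (w),
        p.1 = ⟨P.pt, v⟩ → q.1 = ⟨P.pt, w⟩ → p.ray = P.ray (0 : Fin 2) → q.ray = P.ray (1 : Fin 2) →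
        ∀ s : BlowupVector (X := logProj m) (tautLine m), s.ray = (g P).ray (0 : Fin 1) →
        ∃ c : ℝ, 0 < c ∧ s.1 = ⟨P.pt.map (sndMor m) (sndMor_comm m), (c : ℂ) • actionVec P.pt v w⟩ := by
  refine (isAnalytification_iff (X := baseProd m) (actionHom m) (0 : Fin 1)
    (fun _ x v => actionVec x (v (0 : Fin 2)) (v (1 : Fin 2))) ?_ ?_ g).trans ?_
  · intro i x v a b W hx ha hb r h
    have h0 := frameEquation_action_iff.mp h
    rw [smul_smul] at h0
    have h1 := (v (1 : Fin 2)).2 (a (1 : Fin 2)) (b.pullback (pullsBackFrames_snd m)) W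
      (ha (1 : Fin 2)) hb hx _ h0
    -- `a_0 = u • π_1^* 1` and `π_2^* b = r u • a_1` give the coordinates of both vectors
    have h2 := (v (0 : Fin 2)).2 (fstOneFrame x.hom) (a (0 : Fin 2)) W
      (fun _ _ => trivial) (ha (0 : Fin 2)) hx _ (eq_fstCoeff_smul x.hom _ _)
    refine Eq.symm ((Fin.prod_univ_two _).trans ?_)
    change (v (0 : Fin 2)).1 (a (0 : Fin 2)) ^ 1 * (v (1 : Fin 2)).1 (a (1 : Fin 2)) ^ 1 =
      evalAt x.hom W hx r * ((v (0 : Fin 2)).1 (fstOneFrame x.hom) *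
        (v (1 : Fin 2)).1 (b.pullback (pullsBackFrames_snd m)))
    rw [h1, h2, map_mul]
    have key : ∀ α u ρ β : ℂ, α ^ 1 * (ρ * u * β) ^ 1 = ρ * (u * α * β) := by intros; ring
    exact key _ _ _ _
  · intro i x
    obtain ⟨b⟩ := nonempty_frame_proj (x.map (sndMor m) (sndMor_comm m))
    let a := framePair (fstOneFrame x.hom) (b.pullback (pullsBackFrames_snd m))
    refine ⟨a, b, (a 0).U ⊓ (a 1).U,
      Fin.forall_fin_two.mpr ⟨inf_le_left, inf_le_right⟩, inf_le_right, 1, fun _ h => ⟨(a 0).mem h, (a 1).mem h⟩,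
      frameEquation_action_iff.mpr ?_, ?_⟩
    · rw [one_smul]
      refine Eq.symm ((congrArg (· • _) (fstCoeff_one x.hom _)).trans (one_smul _ _))
    · rw [map_one]
      exact one_ne_zero
  · constructor
    · intro h P p q v w hv hw hp hq
      let p' : ∀ j : Fin 2, BlowupVector (X := baseProd m) ((baseProd m).L j) :=
        Fin.cons (α := fun j : Fin 2 => BlowupVector (X := baseProd m) ((baseProd m).L j)) p
          (Fin.cons (α := fun j : Fin 1 => BlowupVector (X := baseProd m)
            ((baseProd m).L (j.succ : Fin 2))) q fun j => j.elim0)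
      let v' : ∀ j : Fin 2, Fibre ((baseProd m).L j).sheaf P.pt.hom :=
        Fin.cons (α := fun j : Fin 2 => Fibre ((baseProd m).L j).sheaf P.pt.hom) v
          (Fin.cons (α := fun j : Fin 1 => Fibre ((baseProd m).L (j.succ : Fin 2)).sheaf P.pt.hom)
            w fun j => j.elim0)
      exact h P (0 : Fin 1) p' v' (Fin.forall_fin_two.mpr ⟨hv, hw⟩)
        (Fin.forall_fin_two.mpr ⟨hp, hq⟩)
    · intro h P i p v hv hp
      obtain rfl : i = (0 : Fin 1) := Subsingleton.elim (α := Fin 1) i 0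
      exact h P _ _ _ _ (hv (0 : Fin 2)) (hv (1 : Fin 2)) (hp (0 : Fin 2)) (hp (1 : Fin 2))

end Maps

/-! ### The action on coordinates -/

section Rotation
variable {m k : ℕ}

lemma norm_sq_eq_sum_complexCoord (v : EuclideanSpace ℝ (Fin 2 × Fin k)) :
    ‖v‖ ^ 2 = ∑ j, ‖complexCoord v j‖ ^ 2 := by
  rw [EuclideanSpace.norm_sq_eq, Fintype.sum_prod_type, Fin.sum_univ_two, ← Finset.sum_add_distrib]
  refine Finset.sum_congr rfl fun j _ => ?_
  rw [Complex.sq_norm, Complex.normSq_apply, Real.norm_eq_abs, Real.norm_eq_abs, sq_abs, sq_abs,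
    sq, sq]
  rfl

/-- The diagonal action of the circle on the unit sphere of `ℂ^k`. -/
def rotate (z : Circle) (v : UnitSphere k) : UnitSphere k :=
  ⟨ofComplexCoord ((z : ℂ) • complexCoord v.1), by
    rw [mem_sphere_zero_iff_norm, ← sq_eq_sq₀ (norm_nonneg _) zero_le_one,
      norm_sq_eq_sum_complexCoord, complexCoord_ofComplexCoord]
    simp only [Pi.smul_apply, smul_eq_mul, norm_mul, Circle.norm_coe, one_mul]
    rw [← norm_sq_eq_sum_complexCoord, norm_eq_of_mem_sphere]⟩

lemma complexCoord_rotate (z : Circle) (v : UnitSphere k) :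
    complexCoord (rotate z v).1 = (z : ℂ) • complexCoord v.1 :=
  complexCoord_ofComplexCoord _

lemma coe_circleEquivSO (z : Circle) : (circleEquivSO z).1 =
    !![(z : ℂ).re, -(z : ℂ).im; (z : ℂ).im, (z : ℂ).re] := rfl

lemma coe_diagonalSO (A : Matrix.specialOrthogonalGroup (Fin 2) ℝ) :
    (diagonalSO k A).1 = Matrix.blockDiagonal fun _ : Fin k => A.1 := rfl

lemma coe_rotate (z : Circle) (v : UnitSphere k) : (rotate z v).1 = WithLp.toLp 2
    ((diagonalSO k (circleEquivSO z)).1.mulVec (WithLp.ofLp v.1)) := by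
  apply complexCoord_injective
  rw [complexCoord_rotate]
  funext j
  rw [coe_diagonalSO, coe_circleEquivSO]
  apply Complex.ext <;>
  simp [complexCoord, Matrix.mulVec, dotProduct,
    Fintype.sum_prod_type, Matrix.blockDiagonal_apply, sub_eq_add_neg, add_comm]

lemma tautCoord_actionVec (x : CPoint (baseProd m)) (v : Fibre (fstLine m).sheaf x.hom)
    (w : Fibre (sndLine m).sheaf x.hom) (c : ℂ) :
    tautCoord (⟨x.map (sndMor m) (sndMor_comm m), c • actionVec x v w⟩ : TautSpace m) =
      c • pointCoord (TotalSpace.push (L := pointLine) (fstMor_comm m) (pullsBackFrames_fst m)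
        ⟨x, v⟩) • tautCoord (TotalSpace.push (L := tautLine m) (sndMor_comm m)
          (pullsBackFrames_snd m) ⟨x, w⟩) := by
  refine (tautCoord_smul _ _ _).trans (congrArg (c • ·) ?_)
  exact tautCoord_smul (x.map (sndMor m) (sndMor_comm m)) _ _

/-- The action on the coordinates of rays agrees, up to positive factors, with the product of vectors
on them. -/
lemma exists_complexCoord_rotate {P : KN (baseProd m)}
    {p : BlowupVector (X := baseProd m) (fstLine m)} {q : BlowupVector (X := baseProd m) (sndLine m)}
    {v w} (hv : p.1 = ⟨P.pt, v⟩) (hw : q.1 = ⟨P.pt, w⟩) (hp : p.ray = P.ray (0 : Fin 2))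
    (hq : q.ray = P.ray (1 : Fin 2)) :
    ∃ (c : ℝ) (u : Fin (m + 1) → ℂ), 0 < c ∧
      complexCoord (rotate (circleHomeo (fstKN P)) (sphereHomeo m (sndKN P))).1 = (c : ℂ) • u ∧
      ∀ e : ℂ, tautCoord (⟨P.pt.map (sndMor m) (sndMor_comm m), e • actionVec P.pt v w⟩ :
        TautSpace m) = e • u := by
  obtain ⟨c, hc, h1⟩ := exists_circleHomeo (fstKN P)
    (BlowupVector.push (L := pointLine) (fstMor_comm m) (pullsBackFrames_fst m)
      nonempty_frame_point rfl p) (congrArg (RealBlowup.push (L := pointLine) (fstMor_comm m)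
        (pullsBackFrames_fst m) nonempty_frame_point rfl) hp)
  obtain ⟨d, hd, h2⟩ := exists_complexCoord_sphereHomeo (sndKN P)
    (BlowupVector.push (L := tautLine m) (sndMor_comm m) (pullsBackFrames_snd m)
      nonempty_frame_proj rfl q) (congrArg (RealBlowup.push (L := tautLine m) (sndMor_comm m)
        (pullsBackFrames_snd m) nonempty_frame_proj rfl) hq)
  have h1' : (circleHomeo (fstKN P) : ℂ) = c * pointCoord (TotalSpace.push (L := pointLine)
      (fstMor_comm m) (pullsBackFrames_fst m) ⟨P.pt, v⟩) := by
    rw [← hv]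
    exact h1
  have h2' : complexCoord (sphereHomeo m (sndKN P)).1 = (d : ℂ) • tautCoord (TotalSpace.push
      (L := tautLine m) (sndMor_comm m) (pullsBackFrames_snd m) ⟨P.pt, w⟩) := by
    rw [← hw]
    exact h2
  refine ⟨c * d, _, mul_pos hc hd, ?_, fun e => tautCoord_actionVec P.pt v w e⟩
  rw [complexCoord_rotate, h1', h2', smul_smul, smul_smul,
    Complex.ofReal_mul]
  congr 1
  ring

lemma isAnalytification_action_iff (F : KN (baseProd m) → KN (logProj m)) :
    IsAnalytification (actionHom m) F ↔ ∀ P : KN (baseProd m),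
      sphereHomeo m (F P) = rotate (circleHomeo (fstKN P)) (sphereHomeo m (sndKN P)) := by
  refine (isAnalytification_action_iff_actionVec F).trans ?_
  constructor
  · intro h P
    choose p hp using fun j => exists_ray (P.ray j)
    choose v hv using fun j => (p j).exists_eq_mk (hp j)
    obtain ⟨s, hs⟩ := exists_ray ((F P).ray (0 : Fin 1))
    obtain ⟨a, u, ha, h1, hu⟩ := exists_complexCoord_rotate (hv (0 : Fin 2)) (hv (1 : Fin 2))
      (hp (0 : Fin 2)) (hp (1 : Fin 2))
    obtain ⟨c, hc, h2⟩ := h P _ _ _ _ (hv (0 : Fin 2)) (hv (1 : Fin 2))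
      (hp (0 : Fin 2)) (hp (1 : Fin 2)) s hs
    obtain ⟨d, hd, h3⟩ := exists_complexCoord_sphereHomeo (F P) s hs
    have h4 : tautCoord s.1 = (c : ℂ) • u := (congrArg tautCoord h2).trans (hu c)
    refine unitSphere_ext (c := d * c * a⁻¹) (by positivity) ?_
    have ha' : (a : ℂ) ≠ 0 := by exact_mod_cast ha.ne'
    rw [h1, h3, h4, smul_smul, smul_smul]
    congr 1
    push_cast
    field_simp
  · intro h P p q v w hv hw hp hq s hs
    obtain ⟨a, u, ha, h1, hu⟩ := exists_complexCoord_rotate hv hw hp hq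
    obtain ⟨d, hd, h3⟩ := exists_complexCoord_sphereHomeo (F P) s hs
    rw [h P, h1] at h3
    have hd' : (d : ℂ) ≠ 0 := by exact_mod_cast hd.ne'
    have h4 : tautCoord s.1 = ((d⁻¹ * a : ℝ) : ℂ) • u := by
      have h5 := congrArg ((d : ℂ)⁻¹ • ·) h3
      simp only [smul_smul, inv_mul_cancel₀ hd', one_smul] at h5
      rw [← h5]
      push_cast
      rfl
    have h6 := h4.trans (hu _).symm
    refine ⟨d⁻¹ * a, by positivity, tautCoord_injective s.2.1 (fun h0 => ?_) h6⟩
    exact tautCoord_ne_zero s.1 s.2.1 (h6.trans (tautCoord_eq_zero _ h0))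

end Rotation

end DFLog

end

theorem mainTheorem6 (m : ℕ) :
    ∃ (h0 : DFLog.KN DFLog.logPoint ≃ₜ Circle)
      (hS : DFLog.KN (DFLog.logProj m) ≃ₜ DFLog.UnitSphere (m + 1))
      (hP : DFLog.KN (DFLog.logPoint.prod (DFLog.logProj m)) ≃ₜ
        DFLog.KN DFLog.logPoint × DFLog.KN (DFLog.logProj m)),
      DFLog.IsStandardCircle h0 ∧
      DFLog.IsStandardSphere hS ∧
      (∀ g, DFLog.IsAnalytification (DFLog.fstHom m) g ↔ g = Prod.fst ∘ hP) ∧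
      (∀ g, DFLog.IsAnalytification (DFLog.sndHom m) g ↔ g = Prod.snd ∘ hP) ∧
      ∀ F : DFLog.KN (DFLog.logPoint.prod (DFLog.logProj m)) → DFLog.KN (DFLog.logProj m),
        DFLog.IsAnalytification (DFLog.actionHom m) F ↔
          ∀ (z : Circle) (v : DFLog.UnitSphere (m + 1)),
            (hS (F (hP.symm (h0.symm z, hS.symm v)))).1 =
              WithLp.toLp 2
                ((DFLog.diagonalSO (m + 1) (DFLog.circleEquivSO z)).1.mulVec (WithLp.ofLp v.1)) := by
  refine ⟨DFLog.circleHomeo, DFLog.sphereHomeo m, DFLog.prodHomeo m,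
    DFLog.circleHomeo_isStandardCircle, DFLog.sphereHomeo_isStandardSphere m,
    DFLog.isAnalytification_fst_iff, DFLog.isAnalytification_snd_iff, fun F => ?_⟩
  refine (DFLog.isAnalytification_action_iff F).trans ?_
  constructor
  · intro h z v
    have h1 := (DFLog.prodHomeo m).apply_symm_apply
      (DFLog.circleHomeo.symm z, (DFLog.sphereHomeo m).symm v)
    have h2 : DFLog.fstKN ((DFLog.prodHomeo m).symm
      (DFLog.circleHomeo.symm z, (DFLog.sphereHomeo m).symm v)) = _ := congrArg Prod.fst h1
    have h3 : DFLog.sndKN ((DFLog.prodHomeo m).symm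
      (DFLog.circleHomeo.symm z, (DFLog.sphereHomeo m).symm v)) = _ := congrArg Prod.snd h1
    rw [h, h2, h3, Homeomorph.apply_symm_apply, Homeomorph.apply_symm_apply, DFLog.coe_rotate]
  · intro h P
    have h1 := h (DFLog.circleHomeo (DFLog.fstKN P)) (DFLog.sphereHomeo m (DFLog.sndKN P))
    rw [Homeomorph.symm_apply_apply, Homeomorph.symm_apply_apply, ← DFLog.coe_rotate] at h1
    have h2 : (DFLog.prodHomeo m).symm (DFLog.fstKN P, DFLog.sndKN P) = P :=
      (DFLog.prodHomeo m).symm_apply_apply P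
    rw [h2] at h1
    exact Subtype.ext h1
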